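/- Theorem. Let $d\ge 1$ and $q\in(0,1)$. Consider the Fredrickson--Andersen one-spin facilitated (FA-1f) model on $\mathbb Z^d$: configurations are $\eta\in\{0,1\}^{\mathbb Z^d}$, a site $x$ being called empty if $\eta_x=0$; $\nu$ is the probability measure on $\{0,1\}$ with $\nu(0)=q$, $\nu(1)=1-q$, and $\mu=\prod_{x\in\mathbb Z^d}\nu$ is the product measure; $c_x(\eta)=1$ if at least one of the $2d$ nearest neighbours of $x$ is empty in $\eta$, and $c_x(\eta)=0$ otherwise. The generator $\mathcal L$ is the closure in $L^2(\mu)$ of the operator $$\mathcal L f(\eta)=\sum_{x\in\mathbb Z^d}c_x(\eta)\bigl(\nu_x(f)(\eta)-f(\eta)\bigr)$$ defined on the functions $f$ that depend on finitely many sites, where $\nu_x(f)$ is the average of $f$ with respect to the variable $\eta_x\sim\nu$, the other variables being held fixed. Write $\mathrm{Var}$ for the variance with respect to $\mu$ and $\mathrm{Var}_x(f)$ for the variance of $f$ with respect to the variable $\eta_x\sim\nu$, the other variables being held fixed. The Dirichlet form is $\mathcal D(f)=\sum_{x\in\mathbb Z^d}\mu\bigl(c_x\,\mathrm{Var}_x(f)\bigr)$,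 and the spectral gap is $$\mathrm{gap}(\mathcal L)=\inf\Bigl\{\frac{\mathcal D(f)}{\mathrm{Var}(f)}:\ f\in \mathrm{Dom}(\mathcal L),\ \mathrm{Var}(f)\neq 0\Bigr\}.$$ Then for every $d\ge 1$ there is a constant $C=C(d)>0$ such that, for every $q\in(0,1)$, $$C^{-1}q^3\le \mathrm{gap}(\mathcal L)\le C\,q^3\qquad\text{if } d=1,$$ $$C^{-1}\,\frac{q^2}{\max\{1,\log(1/q)\}}\le \mathrm{gap}(\mathcal L)\le C\,q^2\qquad\text{if } d=2,$$ $$C^{-1}q^2\le \mathrm{gap}(\mathcal L)\le C\,q^{1+2/d}\qquad\text{if } d\ge 3.$$ -/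

import Mathlib

open MeasureTheory ProbabilityTheory Filter Topology
open scoped ENNReal unitInterval

noncomputable section

namespace KCSM

/-- Sites of the lattice `ℤ^d`. -/
abbrev Site (d : ℕ) : Type := Fin d → ℤ

/-- Configurations `η ∈ {0,1}^{ℤ^d}`; the value `0` (empty) is the good state. -/
abbrev Config (d : ℕ) : Type := Site d → Fin 2

/-- The nearest neighbours of `x`, i.e. the sites at `ℓ¹` distance one from `x`. -/
def neighbors {d : ℕ} (x : Site d) : Set (Site d) :=
  {y | ∑ i, |x i - y i| = 1}

/-- The influence classes `x ↦ C_x` of the Fredrickson–Andersen `j`-facilitated (FA-jf) model: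
all sets of at least `j` nearest neighbours of `x`. -/
def faClass (d j : ℕ) (x : Site d) : Set (Finset (Site d)) :=
  {A | (∀ y ∈ A, y ∈ neighbors x) ∧ j ≤ A.card}

/-- The constraint `c_x(η) ∈ {0,1}` at `x`: it equals one iff some set `A ∈ C_x` is entirely
empty in `η`. -/
def constraint {d : ℕ} (𝒞 : Site d → Set (Finset (Site d))) (x : Site d) (η : Config d) : ℝ :=
  Set.indicator {ω : Config d | ∃ A ∈ 𝒞 x, ∀ y ∈ A, ω y = 0} 1 η

/-- The single-site measure `ν` on `{0,1}`, with `ν(0) = q` and `ν(1) = 1 - q`. -/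
abbrev siteMeasure (q : I) : Measure (Fin 2) :=
  bernoulliMeasure 0 1 q

/-- The Bernoulli product measure `μ = ∏_x ν` on `{0,1}^{ℤ^d}`. -/
def bernoulli (d : ℕ) (q : I) : Measure (Config d) :=
  Measure.infinitePi fun _ : Site d => siteMeasure q

/-- Functions depending on finitely many sites. -/
def IsLocal {d : ℕ} (f : Config d → ℝ) : Prop :=
  ∃ Λ : Finset (Site d), DependsOn f (Λ : Set (Site d))

/-- The action of the generator on local functions,
`(L f)(η) = ∑_x c_x(η) (ν_x(f)(η) - f(η))`, where `ν_x(f)` is the average of `f` over the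
variable at `x`. For local `f` only finitely many terms are nonzero. -/
def localGenerator {d : ℕ} (𝒞 : Site d → Set (Finset (Site d))) (q : I)
    (f : Config d → ℝ) (η : Config d) : ℝ :=
  ∑ᶠ x : Site d,
    constraint 𝒞 x η * ((∫ s, f (Function.update η x s) ∂(siteMeasure q)) - f η)

/-- The generator `L` on `L²(μ)`, as a graph: `f ∈ Dom(L)` and `L f = g`. It is the closure in
`L²(μ)` of its restriction to the local functions, which form a core. -/
def IsGenerator {d : ℕ} (𝒞 : Site d → Set (Finset (Site d))) (q : I)
    (f g : Config d → ℝ) : Prop :=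
  MemLp f 2 (bernoulli d q) ∧ MemLp g 2 (bernoulli d q) ∧
    ∃ u : ℕ → Config d → ℝ, (∀ n, IsLocal (u n)) ∧
      Tendsto (fun n => eLpNorm (u n - f) 2 (bernoulli d q)) atTop (𝓝 0) ∧
      Tendsto (fun n => eLpNorm (localGenerator 𝒞 q (u n) - g) 2 (bernoulli d q)) atTop (𝓝 0)

/-- The domain `Dom(L)` of the generator in `L²(μ)`. -/
def generatorDomain {d : ℕ} (𝒞 : Site d → Set (Finset (Site d))) (q : I) :
    Set (Config d → ℝ) :=
  {f | ∃ g, IsGenerator 𝒞 q f g}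

/-- The local variance `Var_x(f)(η)` of `f` with respect to the variable at `x`, the other
variables being held fixed. -/
def siteVariance {d : ℕ} (q : I) (x : Site d) (f : Config d → ℝ) (η : Config d) : ℝ≥0∞ :=
  evariance (fun s => f (Function.update η x s)) (siteMeasure q)

/-- The Dirichlet form `D(f) = ∑_x μ(c_x Var_x(f))`. -/
def dirichletForm {d : ℕ} (𝒞 : Site d → Set (Finset (Site d))) (q : I)
    (f : Config d → ℝ) : ℝ≥0∞ :=
  ∑' x : Site d, ∫⁻ η, ENNReal.ofReal (constraint 𝒞 x η) * siteVariance q x f η ∂(bernoulli d q)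

/-- The spectral gap `gap(L)`: the infimum of `D(f) / Var(f)` over the `f ∈ Dom(L)` that are not
`μ`-almost surely constant, i.e. with `Var(f) ≠ 0`. -/
def gap {d : ℕ} (𝒞 : Site d → Set (Finset (Site d))) (q : I) : ℝ≥0∞ :=
  ⨅ f ∈ {f ∈ generatorDomain 𝒞 q | evariance f (bernoulli d q) ≠ 0},
    dirichletForm 𝒞 q f / evariance f (bernoulli d q)

end KCSM

end

/-! Lower bound. Cut ℤ^d into cubes of side ℓ with ℓ^d of order 1/q, so that a cube contains a
vacancy with probability at least 7/8. On each line of cubes parallel to the first axis consider the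
block dynamics that resamples a cube only when the next one contains a vacancy. Its Poincaré
constant is 4 (`chain_variance_le`), and distinct lines tensorise. It remains to bound the variance
at a site x of a cube, restricted to the presence of a vacancy in the next cube, by the FA-1f
Dirichlet form on the two cubes (`flow_bound`, `block_flow`). For this a vacancy is picked uniformly
among those present outside x and carried along a discretised straight line to a neighbour of x,
where it makes the flip of x legal. An elementary move is a creation followed by an annihilation and
costs 1/q times the energy (`expect_emp_mul_exch_le`).

Two savings make the bound sharp enough. Dividing by the number of vacancies keeps the total path
weight over all x of order 1 + qℓ^d, hence bounded (`sum_pathWeight_le`). Straight lines spread out: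
a site at distance τ from x lies on O(ℓ^d/τ^(d-1)) of them. Weights τ^(d-1) therefore level the
congestion at ℓ^d, of order 1/q (`ray_congestion`), and leave a resistance s of the order of the sum
of τ^(1-d), which is O(1/q), O(log(1/q)) or O(1) for d = 1, d = 2, d ≥ 3. Altogether Var(f) ≤ C s
q^(-2) D(f) for local f (`poincare_local`), and `poincare_of_local` extends this to the domain of
the generator.

Upper bound. The test function is the distance from the origin to the closest vacancy, truncated at
order r = q^(-1/d). It fluctuates on the scale r, so its variance is of order r². A legal flip
changes it by at most 1, each site contributes O(q²), and O(1/q) sites matter, so D = O(q). The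
quotient is q/r² = q^(1+2/d). -/

noncomputable section

namespace KCSM

variable {d : ℕ}

/-! ### Local functions -/

/-- `F` does not depend on the state of the site `x`. -/
def Free (x : Site d) (F : Config d → ℝ) : Prop :=
  ∀ η a, F (Function.update η x a) = F η

lemma isLocal_const (a : ℝ) : IsLocal (fun _ : Config d => a) :=
  ⟨∅, fun _ _ _ => rfl⟩

lemma IsLocal.map₂ {F G : Config d → ℝ} (hF : IsLocal F) (hG : IsLocal G) (φ : ℝ → ℝ → ℝ) :
    IsLocal (fun η => φ (F η) (G η)) := by
  classical
  obtain ⟨S, hS⟩ := hF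
  obtain ⟨T, hT⟩ := hG
  refine ⟨S ∪ T, fun η ω h => ?_⟩
  have h1 : F η = F ω := hS fun i hi => h i (by simp only [Finset.coe_union]; exact Or.inl hi)
  have h2 : G η = G ω := hT fun i hi => h i (by simp only [Finset.coe_union]; exact Or.inr hi)
  simp only [h1, h2]

lemma IsLocal.map {F : Config d → ℝ} (hF : IsLocal F) (φ : ℝ → ℝ) :
    IsLocal (fun η => φ (F η)) := hF.map₂ hF (fun a _ => φ a)

lemma IsLocal.add {F G : Config d → ℝ} (hF : IsLocal F) (hG : IsLocal G) : IsLocal (F + G) :=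
  hF.map₂ hG (· + ·)

lemma IsLocal.sub {F G : Config d → ℝ} (hF : IsLocal F) (hG : IsLocal G) : IsLocal (F - G) :=
  hF.map₂ hG (· - ·)

lemma IsLocal.mul {F G : Config d → ℝ} (hF : IsLocal F) (hG : IsLocal G) : IsLocal (F * G) :=
  hF.map₂ hG (· * ·)

lemma IsLocal.pow {F : Config d → ℝ} (hF : IsLocal F) (n : ℕ) : IsLocal (F ^ n) :=
  hF.map (· ^ n)

lemma IsLocal.sum {ι : Type*} (s : Finset ι) {F : ι → Config d → ℝ}
    (hF : ∀ i ∈ s, IsLocal (F i)) : IsLocal (fun η => ∑ i ∈ s, F i η) := by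
  classical
  induction s using Finset.induction_on with
  | empty => simpa using isLocal_const (d := d) 0
  | insert a s ha ih =>
    simp only [Finset.sum_insert ha]
    exact (hF a (by simp)).map₂ (ih fun i hi => hF i (by simp [hi])) (· + ·)

lemma isLocal_site (x : Site d) (φ : Fin 2 → ℝ) : IsLocal (fun η : Config d => φ (η x)) :=
  ⟨{x}, fun η ω h => by simp only [h x (by simp)]⟩

lemma IsLocal.comp_update {F : Config d → ℝ} (hF : IsLocal F) (x : Site d) (a : Fin 2) :
    IsLocal (fun η => F (Function.update η x a)) := by
  obtain ⟨S, hS⟩ := hF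
  refine ⟨S, fun η ω h => hS fun i hi => ?_⟩
  by_cases hix : i = x
  · subst hix; simp
  · simp [Function.update_of_ne hix, h i hi]

/-- Exchange of the contents of the sites `u` and `v`. -/
def exch (u v : Site d) (η : Config d) : Config d := fun y => η (Equiv.swap u v y)

lemma IsLocal.comp_exch {F : Config d → ℝ} (hF : IsLocal F) (u v : Site d) :
    IsLocal (fun η => F (exch u v η)) := by
  classical
  obtain ⟨S, hS⟩ := hF
  refine ⟨S.image (Equiv.swap u v), fun η ω h => hS fun i hi => ?_⟩
  exact h _ (Finset.mem_coe.2 (Finset.mem_image_of_mem _ (Finset.mem_coe.1 hi)))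

lemma IsLocal.exists_free {F : Config d → ℝ} (hF : IsLocal F) :
    ∃ S : Finset (Site d), ∀ x ∉ S, Free x F := by
  obtain ⟨S, hS⟩ := hF
  refine ⟨S, fun x hx η a => hS fun i hi => ?_⟩
  rw [Function.update_of_ne]
  rintro rfl
  exact hx hi

/-- Factoring through the finite set of configurations on `S` makes measurability and boundedness of
local functions automatic. -/
lemma IsLocal.exists_comp_restrict {F : Config d → ℝ} (hF : IsLocal F) :
    ∃ (S : Finset (Site d)) (G : (S → Fin 2) → ℝ), F = fun η => G (fun i => η i) := by
  classical
  obtain ⟨S, hS⟩ := hF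
  refine ⟨S, fun τ => F (fun y => if h : y ∈ S then τ ⟨y, h⟩ else 0), ?_⟩
  funext η
  refine hS fun i hi => ?_
  have : i ∈ S := hi
  simp [this]

lemma IsLocal.measurable {F : Config d → ℝ} (hF : IsLocal F) : Measurable F := by
  obtain ⟨S, G, rfl⟩ := hF.exists_comp_restrict
  have hG : Measurable G := measurable_of_countable G
  exact hG.comp (measurable_pi_lambda _ fun i => measurable_pi_apply _)

lemma IsLocal.exists_bound {F : Config d → ℝ} (hF : IsLocal F) : ∃ C, ∀ η, ‖F η‖ ≤ C := by
  obtain ⟨S, G, rfl⟩ := hF.exists_comp_restrict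
  refine ⟨∑ τ, ‖G τ‖, fun η => ?_⟩
  exact Finset.single_le_sum (f := fun τ => ‖G τ‖) (fun _ _ => norm_nonneg _) (Finset.mem_univ _)

instance (q : I) : IsProbabilityMeasure (bernoulli d q) := by
  unfold bernoulli; infer_instance

lemma IsLocal.memLp {F : Config d → ℝ} (hF : IsLocal F) (q : I) (p : ℝ≥0∞) :
    MemLp F p (bernoulli d q) := by
  obtain ⟨C, hC⟩ := hF.exists_bound
  exact MemLp.of_bound hF.measurable.aestronglyMeasurable C (Eventually.of_forall hC)

lemma IsLocal.integrable {F : Config d → ℝ} (hF : IsLocal F) (q : I) :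
    Integrable F (bernoulli d q) :=
  (hF.memLp q 1).integrable le_rfl

/-! ### The expectation of local functions -/

/-- The expectation with respect to the Bernoulli product measure. -/
def expect (q : I) (F : Config d → ℝ) : ℝ := ∫ η, F η ∂(bernoulli d q)

section expect
variable (q : I) {F G : Config d → ℝ}

lemma expect_add (hF : IsLocal F) (hG : IsLocal G) :
    expect q (F + G) = expect q F + expect q G :=
  integral_add (hF.integrable q) (hG.integrable q)

lemma expect_sub (hF : IsLocal F) (hG : IsLocal G) :
    expect q (F - G) = expect q F - expect q G :=
  integral_sub (hF.integrable q) (hG.integrable q)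

lemma expect_const_mul (a : ℝ) (F : Config d → ℝ) :
    expect q (fun η => a * F η) = a * expect q F :=
  integral_const_mul a F

lemma expect_const (a : ℝ) : expect (d := d) q (fun _ => a) = a := by
  simp [expect]

lemma expect_mono (hF : IsLocal F) (hG : IsLocal G) (h : ∀ η, F η ≤ G η) :
    expect q F ≤ expect q G :=
  integral_mono (hF.integrable q) (hG.integrable q) h

lemma expect_nonneg (h : ∀ η, 0 ≤ F η) : 0 ≤ expect q F :=
  integral_nonneg h

lemma expect_sum {ι : Type*} (s : Finset ι) {F : ι → Config d → ℝ}
    (hF : ∀ i ∈ s, IsLocal (F i)) :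
    expect q (fun η => ∑ i ∈ s, F i η) = ∑ i ∈ s, expect q (F i) :=
  integral_finsetSum s fun i hi => (hF i hi).integrable q

end expect

/-! ### The single-site measure and resampling of one site -/

lemma siteMeasure_eq (q : I) :
    siteMeasure q = ENNReal.ofReal (q : ℝ) • Measure.dirac (0 : Fin 2) +
      ENNReal.ofReal (1 - (q : ℝ)) • Measure.dirac (1 : Fin 2) := by
  rw [siteMeasure, bernoulliMeasure_def]
  congr 1
  · rw [ENNReal.smul_def]; congr 1
    rw [ENNReal.ofReal]; congr 1; ext; simp [q.2.1]
  · rw [ENNReal.smul_def]; congr 1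
    rw [ENNReal.ofReal]; congr 1; ext; simp [q.2.2]

lemma integral_siteMeasure (q : I) (φ : Fin 2 → ℝ) :
    ∫ s, φ s ∂(siteMeasure q) = q * φ 0 + (1 - q) * φ 1 := by
  rw [siteMeasure_eq, integral_add_measure, integral_smul_measure, integral_smul_measure]
  · simp [q.2.1, q.2.2]
  · exact Integrable.of_finite.smul_measure (by simp)
  · exact Integrable.of_finite.smul_measure (by simp)

lemma lintegral_siteMeasure (q : I) (φ : Fin 2 → ℝ≥0∞) :
    ∫⁻ s, φ s ∂(siteMeasure q) =
      ENNReal.ofReal q * φ 0 + ENNReal.ofReal (1 - (q : ℝ)) * φ 1 := by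
  rw [siteMeasure_eq, lintegral_add_measure, lintegral_smul_measure, lintegral_smul_measure]
  simp

lemma measurable_update_site (x : Site d) (a : Fin 2) :
    Measurable (fun η : Config d => Function.update η x a) := by
  refine measurable_pi_lambda _ fun y => ?_
  by_cases h : y = x
  · subst h; simp
  · simpa [Function.update_of_ne h] using measurable_pi_apply y

/-- Resampling one site leaves the product measure invariant. -/
lemma bernoulli_resample (q : I) (x : Site d) :
    ENNReal.ofReal (q : ℝ) • (bernoulli d q).map (fun η => Function.update η x 0) +
      ENNReal.ofReal (1 - (q : ℝ)) • (bernoulli d q).map (fun η => Function.update η x 1) =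
      bernoulli d q := by
  classical
  -- A product measure is determined by its finite cylinders. The preimage of a cylinder under an
  -- update at `x` is either the cylinder without the coordinate `x` or empty.
  refine Measure.eq_infinitePi _ fun s t ht => ?_
  have hm : MeasurableSet ((s : Set (Site d)).pi t) :=
    .pi s.countable_toSet fun i _ => ht i
  have key : ∀ a : Fin 2, (bernoulli d q).map (fun η => Function.update η x a)
      ((s : Set (Site d)).pi t) =
      (if x ∈ s → a ∈ t x then 1 else 0) * ∏ i ∈ s.erase x, siteMeasure q (t i) := by
    intro a
    rw [Measure.map_apply (measurable_update_site x a) hm]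
    by_cases h : x ∈ s → a ∈ t x
    · have : (fun η : Config d => Function.update η x a) ⁻¹' ((s : Set (Site d)).pi t) =
          ((s.erase x : Finset (Site d)) : Set (Site d)).pi t := by
        ext η
        simp only [Set.mem_preimage, Set.mem_pi, Finset.mem_coe, Finset.mem_erase]
        constructor
        · rintro h' i ⟨hi, his⟩
          simpa [Function.update_of_ne hi] using h' i his
        · intro h' i his
          by_cases hi : i = x
          · subst hi; simpa using h his
          · simpa [Function.update_of_ne hi] using h' i ⟨hi, his⟩
      rw [this, bernoulli, Measure.infinitePi_pi _ (fun i _ => ht i), if_pos h, one_mul]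
    · have : (fun η : Config d => Function.update η x a) ⁻¹' ((s : Set (Site d)).pi t) = ∅ := by
        ext η
        simp only [Set.mem_preimage, Set.mem_pi, Finset.mem_coe, Set.mem_empty_iff_false,
          iff_false]
        push Not at h
        intro h'
        exact h.2 (by simpa using h' x h.1)
      rw [this, if_neg h]; simp
  simp only [Measure.add_apply, Measure.smul_apply, key, smul_eq_mul]
  have h1 : ENNReal.ofReal (q : ℝ) + ENNReal.ofReal (1 - (q : ℝ)) = 1 := by
    rw [← ENNReal.ofReal_add q.2.1 (by linarith [q.2.2])]; simp
  by_cases hx : x ∈ s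
  · rw [← Finset.mul_prod_erase s _ hx, ← mul_assoc, ← mul_assoc, ← add_mul]
    congr 1
    have := lintegral_siteMeasure q ((t x).indicator 1)
    rw [lintegral_indicator_one (ht x)] at this
    rw [this]
    simp [hx, Set.indicator_apply]
  · simp only [hx, false_imp_iff, if_true, one_mul]
    rw [← add_mul, h1, one_mul, Finset.erase_eq_of_notMem hx]

lemma lintegral_resample (q : I) (x : Site d) {F : Config d → ℝ≥0∞} (hF : Measurable F) :
    ENNReal.ofReal (q : ℝ) * ∫⁻ η, F (Function.update η x 0) ∂(bernoulli d q) +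
      ENNReal.ofReal (1 - (q : ℝ)) * ∫⁻ η, F (Function.update η x 1) ∂(bernoulli d q) =
      ∫⁻ η, F η ∂(bernoulli d q) := by
  conv_rhs => rw [← bernoulli_resample q x]
  rw [lintegral_add_measure, lintegral_smul_measure, lintegral_smul_measure,
    lintegral_map hF (measurable_update_site x 0), lintegral_map hF (measurable_update_site x 1)]
  rfl

/-! ### Averaging operators -/

/-- The average over the state of the site `x`. -/
def avg (q : I) (x : Site d) : Module.End ℝ (Config d → ℝ) where
  toFun F η := q * F (Function.update η x 0) + (1 - q) * F (Function.update η x 1)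
  map_add' F G := by funext η; simp only [Pi.add_apply]; ring
  map_smul' a F := by
    funext η; simp only [Pi.smul_apply, smul_eq_mul, RingHom.id_apply]; ring

lemma avg_apply (q : I) (x : Site d) (F : Config d → ℝ) (η : Config d) :
    avg q x F η = q * F (Function.update η x 0) + (1 - q) * F (Function.update η x 1) := rfl

lemma avg_commute (q : I) (x y : Site d) : Commute (avg q x) (avg q y) := by
  by_cases h : x = y
  · subst h; rfl
  · refine LinearMap.ext fun F => ?_
    funext η
    simp only [Module.End.mul_apply, avg_apply]
    rw [Function.update_comm h, Function.update_comm h, Function.update_comm h,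
      Function.update_comm h]
    ring

lemma IsLocal.avg {F : Config d → ℝ} (hF : IsLocal F) (q : I) (x : Site d) :
    IsLocal (avg q x F) :=
  (hF.comp_update x 0).map₂ (hF.comp_update x 1) fun a b => (q : ℝ) * a + (1 - q) * b

lemma Free.avg_eq {F : Config d → ℝ} {x : Site d} (hF : Free x F) (q : I) : avg q x F = F := by
  funext η; rw [avg_apply, hF, hF]; ring

lemma free_avg_self (q : I) (x : Site d) (F : Config d → ℝ) : Free x (avg q x F) := by
  intro η a; simp [avg_apply]

lemma Free.avg {F : Config d → ℝ} {x : Site d} (hF : Free x F) (q : I) (y : Site d) :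
    Free x (avg q y F) := by
  by_cases h : x = y
  · subst h; exact free_avg_self q x F
  · intro η a
    simp only [avg_apply]
    rw [Function.update_comm h, Function.update_comm h, hF, hF]

lemma Free.map₂ {F G : Config d → ℝ} {x : Site d} (hF : Free x F) (hG : Free x G)
    (φ : ℝ → ℝ → ℝ) : Free x (fun η => φ (F η) (G η)) := by
  intro η a; simp only [hF η a, hG η a]

lemma Free.sub {F G : Config d → ℝ} {x : Site d} (hF : Free x F) (hG : Free x G) :
    Free x (F - G) := hF.map₂ hG (· - ·)

lemma Free.mul {F G : Config d → ℝ} {x : Site d} (hF : Free x F) (hG : Free x G) :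
    Free x (F * G) := hF.map₂ hG (· * ·)

lemma free_const (x : Site d) (a : ℝ) : Free x (fun _ : Config d => a) := fun _ _ => rfl

lemma Free.avg_mul {F : Config d → ℝ} {x : Site d} (hF : Free x F) (q : I) (G : Config d → ℝ) :
    KCSM.avg q x (F * G) = F * KCSM.avg q x G := by
  funext η
  simp only [avg_apply, Pi.mul_apply, hF η 0, hF η 1]; ring

lemma avg_nonneg (q : I) (x : Site d) {F : Config d → ℝ} (hF : ∀ η, 0 ≤ F η) (η : Config d) :
    0 ≤ avg q x F η := by
  rw [avg_apply]
  have := q.2.1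
  have := sub_nonneg.2 q.2.2
  have := hF (Function.update η x 0)
  have := hF (Function.update η x 1)
  positivity

lemma expect_avg (q : I) (x : Site d) {F : Config d → ℝ} (hF : IsLocal F) :
    expect q (avg q x F) = expect q F := by
  have h := bernoulli_resample q x
  have hm0 := measurable_update_site x 0
  have hm1 := measurable_update_site x 1
  have hi : ∀ a : Fin 2, Integrable F
      ((bernoulli d q).map (fun η : Config d => Function.update η x a)) := fun a =>
    (integrable_map_measure hF.measurable.aestronglyMeasurable
      (measurable_update_site x a).aemeasurable).2 ((hF.comp_update x a).integrable q)
  conv_rhs => rw [expect, ← h]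
  rw [integral_add_measure ((hi 0).smul_measure (by simp)) ((hi 1).smul_measure (by simp)),
    integral_smul_measure, integral_smul_measure,
    integral_map hm0.aemeasurable hF.measurable.aestronglyMeasurable,
    integral_map hm1.aemeasurable hF.measurable.aestronglyMeasurable,
    ENNReal.toReal_ofReal q.2.1, ENNReal.toReal_ofReal (sub_nonneg.2 q.2.2)]
  simp only [smul_eq_mul]
  rw [← integral_const_mul, ← integral_const_mul, ← integral_add]
  · rfl
  · exact ((hF.comp_update x 0).integrable q).const_mul _
  · exact ((hF.comp_update x 1).integrable q).const_mul _

lemma bernoulli_map_exch (q : I) (u v : Site d) :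
    (bernoulli d q).map (exch u v) = bernoulli d q := by
  have h := Measure.infinitePi_map_piCongrLeft (μ := fun _ : Site d => siteMeasure q)
    (Equiv.swap u v)
  have : exch u v = MeasurableEquiv.piCongrLeft (fun _ : Site d => Fin 2) (Equiv.swap u v) := by
    funext η y
    have := MeasurableEquiv.piCongrLeft_apply_apply (β := fun _ : Site d => Fin 2)
      (Equiv.swap u v) η (Equiv.swap u v y)
    rw [Equiv.swap_apply_self] at this
    rw [this]; rfl
  rw [this]
  exact h

lemma expect_exch (q : I) (u v : Site d) {F : Config d → ℝ} (hF : IsLocal F) :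
    expect q (fun η => F (exch u v η)) = expect q F := by
  have hm : Measurable (exch u v : Config d → Config d) :=
    measurable_pi_lambda _ fun y => measurable_pi_apply _
  conv_rhs => rw [expect, ← bernoulli_map_exch q u v]
  rw [integral_map hm.aemeasurable hF.measurable.aestronglyMeasurable]
  rfl

/-! ### Conditional expectations over finite sets of sites -/

lemma avg_pairwise_commute (q : I) (S : Finset (Site d)) :
    (S : Set (Site d)).Pairwise (Function.onFun Commute (avg q)) := fun x _ y _ _ => avg_commute q x y

/-- The average over the states of the sites in `S`. -/
def avgOn (q : I) (S : Finset (Site d)) : Module.End ℝ (Config d → ℝ) :=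
  S.noncommProd (avg q) (avg_pairwise_commute q S)

lemma avgOn_empty (q : I) (F : Config d → ℝ) : avgOn q ∅ F = F := by
  simp [avgOn]

lemma avgOn_insert (q : I) {S : Finset (Site d)} {x : Site d} (hx : x ∉ S) (F : Config d → ℝ) :
    avgOn q (insert x S) F = avg q x (avgOn q S F) := by
  rw [avgOn, Finset.noncommProd_insert_of_notMem _ _ _ _ hx]; rfl

lemma avgOn_union (q : I) {S T : Finset (Site d)} (h : Disjoint S T) (F : Config d → ℝ) :
    avgOn q (S ∪ T) F = avgOn q S (avgOn q T F) := by
  rw [avgOn, Finset.noncommProd_union_of_disjoint h]; rfl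

section
variable {F G : Config d → ℝ} {S : Finset (Site d)} (q : I)

lemma avgOn_induction (P : (Config d → ℝ) → Prop) (h : ∀ x ∈ S, ∀ G, P G → P (avg q x G))
    (hF : P F) : P (avgOn q S F) := by
  classical
  induction S using Finset.induction_on with
  | empty => rwa [avgOn_empty]
  | insert a S ha ih =>
    rw [avgOn_insert q ha]
    exact h a (by simp) _ (ih fun x hx => h x (by simp [hx]))

lemma IsLocal.avgOn (hF : IsLocal F) : IsLocal (avgOn q S F) :=
  avgOn_induction q IsLocal (fun x _ _ h => h.avg q x) hF

lemma Free.avgOn {x : Site d} (hF : Free x F) : Free x (avgOn q S F) :=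
  avgOn_induction q (Free x) (fun y _ _ h => h.avg q y) hF

lemma free_avgOn {x : Site d} (hx : x ∈ S) (F : Config d → ℝ) : Free x (avgOn q S F) := by
  classical
  rw [← Finset.insert_erase hx, avgOn_insert q (Finset.notMem_erase x S)]
  exact free_avg_self q x _

lemma avgOn_nonneg (hF : ∀ η, 0 ≤ F η) (η : Config d) : 0 ≤ avgOn q S F η :=
  avgOn_induction q (fun F => ∀ η, 0 ≤ F η) (fun x _ _ h => avg_nonneg q x h) hF η

lemma avgOn_of_free (hF : ∀ x ∈ S, Free x F) : avgOn q S F = F :=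
  avgOn_induction q (fun G => G = F) (fun x hx G h => by rw [h, (hF x hx).avg_eq]) rfl

lemma avgOn_comm (S T : Finset (Site d)) (F : Config d → ℝ) :
    avgOn q S (avgOn q T F) = avgOn q T (avgOn q S F) := by
  have : Commute (avgOn (d := d) q S) (avgOn q T) := by
    unfold avgOn
    exact Finset.noncommProd_commute _ _ _ _ fun x _ =>
      (Finset.noncommProd_commute _ _ _ _ fun y _ => avg_commute q x y).symm
  exact LinearMap.congr_fun this.eq F

lemma avgOn_mul (hF : ∀ x ∈ S, Free x F) (G : Config d → ℝ) :
    avgOn q S (F * G) = F * avgOn q S G := by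
  classical
  induction S using Finset.induction_on with
  | empty => simp only [avgOn_empty]
  | insert a S ha ih =>
    rw [avgOn_insert q ha, avgOn_insert q ha, ih fun x hx => hF x (by simp [hx]),
      (hF a (by simp)).avg_mul]

lemma expect_avgOn (hF : IsLocal F) : expect q (avgOn q S F) = expect q F :=
  (avgOn_induction q (fun G => IsLocal G ∧ expect q G = expect q F)
    (fun x _ G h => ⟨h.1.avg q x, by rw [expect_avg q x h.1, h.2]⟩) ⟨hF, rfl⟩).2

/-- `avgOn` is linear and positive, so `t ↦ avgOn q S ((t F + G)²) η` is a nonnegative quadratic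
polynomial; its discriminant is at most zero. -/
lemma avgOn_cauchy_schwarz (F G : Config d → ℝ) (η : Config d) :
    (avgOn q S (F * G) η) ^ 2 ≤ avgOn q S (F ^ 2) η * avgOn q S (G ^ 2) η := by
  have h : ∀ t : ℝ, 0 ≤ avgOn q S (F ^ 2) η * (t * t) + 2 * avgOn q S (F * G) η * t +
      avgOn q S (G ^ 2) η := by
    intro t
    have := avgOn_nonneg q (S := S) (F := (t • F + G) ^ 2) (fun η => sq_nonneg _) η
    have e : (t • F + G) ^ 2 = (t * t) • F ^ 2 + (2 * t) • (F * G) + G ^ 2 := by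
      funext η; simp only [Pi.add_apply, Pi.pow_apply, Pi.smul_apply, Pi.mul_apply, smul_eq_mul]
      ring
    rw [e, map_add, map_add, map_smul, map_smul] at this
    simp only [Pi.add_apply, Pi.smul_apply, smul_eq_mul] at this
    linarith
  have := discrim_le_zero h
  rw [discrim] at this
  linarith

lemma avgOn_sq_le (F : Config d → ℝ) (η : Config d) :
    (avgOn q S F η) ^ 2 ≤ avgOn q S (F ^ 2) η := by
  have h := avgOn_cauchy_schwarz q (S := S) 1 F η
  have h1 : avgOn q S (1 : Config d → ℝ) = 1 := avgOn_of_free q fun x _ => free_const x 1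
  simpa [h1] using h

lemma expect_avgOn_sq_le (hF : IsLocal F) :
    expect q (avgOn q S F ^ 2) ≤ expect q (F ^ 2) := by
  rw [← expect_avgOn q (S := S) (hF.pow 2)]
  exact expect_mono q ((hF.avgOn q).pow 2) ((hF.pow 2).avgOn q) fun η => avgOn_sq_le q F η

/-- Pythagoras for the conditional expectation given the sites outside `S`. -/
lemma expect_mul_sq_sub_avgOn {c : Config d → ℝ} (hc : IsLocal c) (hcS : ∀ x ∈ S, Free x c)
    (hF : IsLocal F) :
    expect q (c * (F - avgOn q S F) ^ 2) =
      expect q (c * F ^ 2) - expect q (c * avgOn q S F ^ 2) := by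
  have hE := hF.avgOn q (S := S)
  have hfree : ∀ x ∈ S, Free x (c * avgOn q S F) := fun x hx =>
    (hcS x hx).mul (free_avgOn q hx F)
  -- Orthogonality: `c * avgOn q S F` does not depend on the sites of `S`, hence factors out of the
  -- average over `S`.
  have h1 : expect q (c * avgOn q S F * F) = expect q (c * avgOn q S F ^ 2) := by
    rw [← expect_avgOn q (S := S) ((hc.mul hE).mul hF), avgOn_mul q hfree]
    congr 1; ring
  have h2 : c * (F - avgOn q S F) ^ 2 =
      (c * F ^ 2 + c * avgOn q S F ^ 2) - (c * avgOn q S F * F + c * avgOn q S F * F) := by ring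
  have l1 := hc.mul (hF.pow 2)
  have l2 := hc.mul (hE.pow 2)
  have l3 := (hc.mul hE).mul hF
  rw [h2, expect_sub q (l1.add l2) (l3.add l3), expect_add q l1 l2, expect_add q l3 l3, h1]
  ring

lemma expect_sq_sub_avgOn (hF : IsLocal F) :
    expect q ((F - avgOn q S F) ^ 2) = expect q (F ^ 2) - expect q (avgOn q S F ^ 2) := by
  have := expect_mul_sq_sub_avgOn q (S := S) (isLocal_const 1) (fun x _ => free_const x 1) hF
  have e : (fun _ : Config d => (1 : ℝ)) = 1 := rfl
  simpa only [e, one_mul] using this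

/-- Tensorisation of the variance over a disjoint union. -/
lemma expect_mul_sq_sub_union_le {T : Finset (Site d)} (hST : Disjoint S T) {c : Config d → ℝ}
    (hc : IsLocal c) (hc0 : ∀ η, 0 ≤ c η) (hcS : ∀ x ∈ S, Free x c) (hcT : ∀ x ∈ T, Free x c)
    (hF : IsLocal F) :
    expect q (c * (F - avgOn q (S ∪ T) F) ^ 2) ≤
      expect q (c * (F - avgOn q S F) ^ 2) + expect q (c * (F - avgOn q T F) ^ 2) := by
  classical
  have hE := hF.avgOn q (S := T)
  rw [expect_mul_sq_sub_avgOn q hc (fun x hx => (Finset.mem_union.1 hx).elim (hcS x) (hcT x)) hF,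
    avgOn_union q hST, expect_mul_sq_sub_avgOn q hc hcT hF]
  have h1 := expect_mul_sq_sub_avgOn q hc hcS hE
  -- The two averages commute, so the second increment is `avgOn q T` applied to `F - avgOn q S F`,
  -- and Jensen removes the outer average.
  have h2 : expect q (c * (avgOn q T F - avgOn q S (avgOn q T F)) ^ 2) ≤
      expect q (c * (F - avgOn q S F) ^ 2) := by
    have e : avgOn q T F - avgOn q S (avgOn q T F) = avgOn q T (F - avgOn q S F) := by
      rw [map_sub, avgOn_comm q S T]
    have hL := hF.sub (hF.avgOn q (S := S))
    rw [e, ← expect_avgOn q (S := T) (hc.mul (hL.pow 2)), avgOn_mul q hcT]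
    refine expect_mono q (hc.mul ((hL.avgOn q).pow 2)) (hc.mul ((hL.pow 2).avgOn q)) fun η => ?_
    exact mul_le_mul_of_nonneg_left (avgOn_sq_le q _ η) (hc0 η)
  linarith

lemma expect_mul_sq_sub_biUnion_le {ι : Type*} [DecidableEq ι] (s : Finset ι)
    (B : ι → Finset (Site d)) (hB : (s : Set ι).PairwiseDisjoint B) {c : Config d → ℝ}
    (hc : IsLocal c) (hc0 : ∀ η, 0 ≤ c η) (hcB : ∀ i ∈ s, ∀ x ∈ B i, Free x c) (hF : IsLocal F) :
    expect q (c * (F - avgOn q (s.biUnion B) F) ^ 2) ≤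
      ∑ i ∈ s, expect q (c * (F - avgOn q (B i) F) ^ 2) := by
  classical
  induction s using Finset.induction_on with
  | empty =>
    rw [Finset.biUnion_empty, avgOn_empty, sub_self]
    simp [expect]
  | insert a s ha ih =>
    rw [Finset.biUnion_insert, Finset.sum_insert ha]
    have hdis : Disjoint (B a) (s.biUnion B) := by
      rw [Finset.disjoint_biUnion_right]
      intro i hi
      exact hB (by simp) (by simp [hi]) (by rintro rfl; exact ha hi)
    refine (expect_mul_sq_sub_union_le q hdis hc hc0 (hcB a (by simp)) ?_ hF).trans ?_
    · intro x hx
      obtain ⟨i, hi, hxi⟩ := Finset.mem_biUnion.1 hx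
      exact hcB i (by simp [hi]) x hxi
    · gcongr
      exact ih (hB.subset (by simp)) fun i hi => hcB i (by simp [hi])

lemma avgOn_singleton (x : Site d) (F : Config d → ℝ) : avgOn q {x} F = avg q x F := by
  rw [avgOn, Finset.noncommProd_singleton]

lemma expect_mul_sq_sub_avgOn_le_sum {c : Config d → ℝ}
    (hc : IsLocal c) (hc0 : ∀ η, 0 ≤ c η) (hcS : ∀ x ∈ S, Free x c) (hF : IsLocal F) :
    expect q (c * (F - avgOn q S F) ^ 2) ≤ ∑ x ∈ S, expect q (c * (F - avg q x F) ^ 2) := by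
  classical
  have h := expect_mul_sq_sub_biUnion_le q S (fun x => {x})
    (fun x _ y _ hxy => by simpa [Function.onFun] using hxy) hc hc0
    (fun x hx y hy => by rw [Finset.mem_singleton.1 hy]; exact hcS x hx) hF
  simpa only [Finset.biUnion_singleton_eq_self, avgOn_singleton] using h

end

/-! ### A chain of blocks with oriented constraints -/

section chain
variable (q : I)

/-- The increment produced by averaging over `S` is split according to `c`. Where `c = 1` it is
bounded by the constrained variance; where `c = 0`, Cauchy–Schwarz over `S'` gains the small
probability `ε`. The error term involves the variance over both `S` and `S'`, which is why it must
be absorbed along a whole chain. -/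
lemma constrained_step {S S' W : Finset (Site d)} (h1 : Disjoint S S') (h3 : Disjoint S' W)
    {c f : Config d → ℝ} (hc : IsLocal c) (hc01 : ∀ η, c η = 0 ∨ c η = 1)
    (hcS : ∀ x ∈ S, Free x c) (hcW : ∀ x ∈ W, Free x c) {ε : ℝ}
    (hε : ∀ η, avgOn q S' (1 - c) η ≤ ε) (hf : IsLocal f) :
    expect q (avgOn q S' (avgOn q W f) ^ 2) -
        expect q (avgOn q S (avgOn q S' (avgOn q W f)) ^ 2) ≤
      2 * expect q (c * (f - avgOn q S f) ^ 2) +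
      2 * ε * (expect q (avgOn q W f ^ 2) -
        expect q (avgOn q S (avgOn q S' (avgOn q W f)) ^ 2)) := by
  classical
  set g := avgOn q W f with hg
  have lg : IsLocal g := hf.avgOn q
  set m := avgOn q S (avgOn q S' g) with hm
  have lm : IsLocal m := (lg.avgOn q).avgOn q
  have l1c : IsLocal (1 - c) := (isLocal_const 1).sub hc
  set X := avgOn q S' (c * (g - avgOn q S g)) with hX
  set Y := avgOn q S' ((1 - c) * (g - m)) with hY
  have lX : IsLocal X := (hc.mul (lg.sub (lg.avgOn q))).avgOn q
  have lY : IsLocal Y := (l1c.mul (lg.sub lm)).avgOn q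
  have hmS : ∀ x ∈ S, Free x m := fun x hx => free_avgOn q hx _
  have hmS' : ∀ x ∈ S', Free x m := fun x hx => by
    rw [hm, avgOn_comm q]; exact free_avgOn q hx _
  -- decomposition
  have hdec : avgOn q S' g - avgOn q S (avgOn q S' g) = X + (Y - avgOn q S Y) := by
    have e1 : avgOn q S (avgOn q S' (c * g)) = avgOn q S' (c * avgOn q S g) := by
      rw [avgOn_comm q, avgOn_mul q hcS]
    -- Subtracting `m` is harmless because `avgOn q S' ((1 - c) * m)` is free of `S` and is killed
    -- by `id - avgOn q S`. It replaces the second moment of `g` by its variance over `S ∪ S'`.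
    have e2 : avgOn q S (avgOn q S' ((1 - c) * m)) = avgOn q S' ((1 - c) * m) := by
      apply avgOn_of_free
      intro x hx
      exact Free.avgOn q (((free_const x 1).sub (hcS x hx)).mul (hmS x hx))
    have e3 : avgOn q S' g = avgOn q S' (c * g) + avgOn q S' ((1 - c) * g) := by
      rw [← map_add]; congr 1; ring
    have e4 : Y = avgOn q S' ((1 - c) * g) - avgOn q S' ((1 - c) * m) := by
      rw [hY, ← map_sub]; congr 1; ring
    have e5 : X = avgOn q S' (c * g) - avgOn q S' (c * avgOn q S g) := by
      rw [hX, ← map_sub]; congr 1; ring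
    rw [e4, e5, e3, map_sub, map_add, e2, e1]; abel
  have hT : expect q (avgOn q S' g ^ 2) - expect q (m ^ 2) =
      expect q ((X + (Y - avgOn q S Y)) ^ 2) := by
    rw [← hdec, expect_sq_sub_avgOn q (lg.avgOn q)]
  have hle : expect q ((X + (Y - avgOn q S Y)) ^ 2) ≤
      2 * expect q (X ^ 2) + 2 * expect q (Y ^ 2) := by
    have lYY := lY.sub (lY.avgOn q (S := S))
    have a1 : expect q ((Y - avgOn q S Y) ^ 2) ≤ expect q (Y ^ 2) := by
      rw [expect_sq_sub_avgOn q lY]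
      linarith [expect_nonneg q (F := avgOn q S Y ^ 2) fun η => sq_nonneg _]
    have a2 : expect q ((X + (Y - avgOn q S Y)) ^ 2) ≤
        expect q ((X ^ 2 + X ^ 2) + ((Y - avgOn q S Y) ^ 2 + (Y - avgOn q S Y) ^ 2)) := by
      refine expect_mono q ((lX.add lYY).pow 2)
        (((lX.pow 2).add (lX.pow 2)).add ((lYY.pow 2).add (lYY.pow 2))) fun η => ?_
      simp only [Pi.add_apply, Pi.pow_apply]
      nlinarith [sq_nonneg (X η - (Y - avgOn q S Y) η)]
    rw [expect_add q ((lX.pow 2).add (lX.pow 2)) ((lYY.pow 2).add (lYY.pow 2)),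
      expect_add q (lX.pow 2) (lX.pow 2), expect_add q (lYY.pow 2) (lYY.pow 2)] at a2
    linarith
  have hXle : expect q (X ^ 2) ≤ expect q (c * (f - avgOn q S f) ^ 2) := by
    have e1 : c * (g - avgOn q S g) = avgOn q W (c * (f - avgOn q S f)) := by
      rw [avgOn_mul q hcW, map_sub, hg, avgOn_comm q S W]
    have lf := hc.mul (hf.sub (hf.avgOn q (S := S)))
    rw [hX, e1, ← avgOn_union q h3]
    refine (expect_avgOn_sq_le q lf).trans (le_of_eq ?_)
    congr 1
    funext η
    simp only [Pi.mul_apply, Pi.pow_apply, mul_pow]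
    rcases hc01 η with h | h <;> simp [h]
  have hYle : expect q (Y ^ 2) ≤ ε * (expect q (g ^ 2) - expect q (m ^ 2)) := by
    have lgm := (lg.sub lm).pow 2
    have a1 : expect q (Y ^ 2) ≤ expect q (fun η => ε * avgOn q S' ((g - m) ^ 2) η) := by
      refine expect_mono q (lY.pow 2) ((lgm.avgOn q).map (ε * ·)) fun η => ?_
      refine (avgOn_cauchy_schwarz q (1 - c) (g - m) η).trans ?_
      have e : (1 - c) ^ 2 = 1 - c := by
        funext η
        simp only [Pi.pow_apply, Pi.sub_apply, Pi.one_apply]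
        rcases hc01 η with h | h <;> simp [h]
      rw [e]
      exact mul_le_mul_of_nonneg_right (hε η) (avgOn_nonneg q (fun η => sq_nonneg _) η)
    rw [expect_const_mul, expect_avgOn q lgm] at a1
    have hm' : m = avgOn q (S ∪ S') g := by rw [avgOn_union q h1]
    rwa [hm', expect_sq_sub_avgOn q lg, ← hm'] at a1
  rw [hT]
  refine hle.trans ?_
  nlinarith

/-- Variance bound for a chain of blocks, each block being resampled only when the next one is
good. -/
lemma chain_variance_le (B : ℕ → Finset (Site d)) (hB : Pairwise (Function.onFun Disjoint B))
    (n : ℕ) {f : Config d → ℝ} (hf : IsLocal f) (hfn : ∀ x ∈ B n, Free x f)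
    (c : ℕ → Config d → ℝ) (hc : ∀ k, IsLocal (c k)) (hc01 : ∀ k η, c k η = 0 ∨ c k η = 1)
    (hfree : ∀ k, ∀ x ∉ B (k + 1), Free x (c k))
    (hε : ∀ k η, avgOn q (B (k + 1)) (1 - c k) η ≤ 1 / 8) :
    expect q ((f - avgOn q ((Finset.range n).biUnion B) f) ^ 2) ≤
      4 * ∑ k ∈ Finset.range n, expect q (c k * (f - avgOn q (B k) f) ^ 2) := by
  classical
  -- `h k` is the average of `f` over the blocks from `k` to `n`. The `T k` below are the squared
  -- martingale increments, whose sum is the variance to be bounded.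
  let U : ℕ → Finset (Site d) := fun k => (Finset.Ico k (n + 1)).biUnion B
  let h : ℕ → Config d → ℝ := fun k => avgOn q (U k) f
  have hU : ∀ k ≤ n, U k = B k ∪ U (k + 1) := by
    intro k hk
    simp only [U]
    rw [← Finset.insert_Ico_add_one_left_eq_Ico (by omega : k < n + 1), Finset.biUnion_insert]
  have hUd : ∀ j k, j < k → Disjoint (B j) (U k) := by
    intro j k hjk
    simp only [U]
    rw [Finset.disjoint_biUnion_right]
    intro i hi
    exact hB (by rw [Finset.mem_Ico] at hi; omega)
  have hh : ∀ k ≤ n, h k = avgOn q (B k) (h (k + 1)) := by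
    intro k hk
    simp only [h]
    rw [hU k hk, avgOn_union q (hUd k (k + 1) (by omega))]
  have hlast : h (n + 1) = f := by simp [h, U, avgOn_empty]
  have hn : h n = f := by
    rw [hh n le_rfl, hlast, avgOn_of_free q hfn]
  let T : ℕ → ℝ := fun k => expect q (h (k + 1) ^ 2) - expect q (h k ^ 2)
  have hTn : T n = 0 := by simp only [T, hn, hlast]; ring
  have hT0 : ∀ k ≤ n, 0 ≤ T k := by
    intro k hk
    simp only [T]
    rw [hh k hk, ← expect_sq_sub_avgOn q (hf.avgOn q)]
    exact expect_nonneg q fun η => sq_nonneg _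
  -- With `ε = 1/8` the error is `(T k + T (k + 1)) / 4`. Since `T n = 0` and `T 0 ≥ 0`, these
  -- errors add up to at most half of the sum of the `T k`, which turns the factor 2 into 4.
  have hstep : ∀ k < n, T k ≤ 2 * expect q (c k * (f - avgOn q (B k) f) ^ 2) +
      (T k + T (k + 1)) / 4 := by
    intro k hk
    have := constrained_step q (S := B k) (S' := B (k + 1)) (W := U (k + 2)) (c := c k) (f := f)
      (hB (by omega)) (hUd _ _ (by omega)) (hc k) (hc01 k)
      (fun x hx => hfree k x fun hx' =>
        (Finset.disjoint_left.1 (hB (by omega : k ≠ k + 1)) hx) hx')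
      (fun x hx => hfree k x fun hx' =>
        (Finset.disjoint_left.1 (hUd (k + 1) (k + 2) (by omega)) hx') hx) (hε k) hf
    have e2 : avgOn q (B (k + 1)) (avgOn q (U (k + 2)) f) = h (k + 1) :=
      (hh (k + 1) (by omega)).symm
    rw [e2, ← hh k (by omega)] at this
    simp only [T]
    have e3 : avgOn q (U (k + 2)) f = h (k + 2) := rfl
    rw [e3] at this
    linarith
  have hsum : ∑ k ∈ Finset.range n, T k = expect q (f ^ 2) - expect q (h 0 ^ 2) := by
    simp only [T]
    rw [Finset.sum_range_sub (fun k => expect q (h k ^ 2)), hn]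
  have hshift : ∑ k ∈ Finset.range n, T (k + 1) ≤ ∑ k ∈ Finset.range n, T k := by
    have e1 := Finset.sum_range_succ T n
    have e2 := Finset.sum_range_succ' T n
    rw [hTn] at e1
    have := hT0 0 (Nat.zero_le n)
    linarith
  have hall := Finset.sum_le_sum fun k hk => hstep k (Finset.mem_range.1 hk)
  rw [Finset.sum_add_distrib, ← Finset.mul_sum, ← Finset.sum_div, Finset.sum_add_distrib] at hall
  have hfin : expect q ((f - avgOn q ((Finset.range n).biUnion B) f) ^ 2) =
      expect q (f ^ 2) - expect q (h 0 ^ 2) := by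
    rw [expect_sq_sub_avgOn q hf]
    congr 3
    simp only [h, U]
    have : Finset.Ico 0 (n + 1) = insert n (Finset.range n) := by
      rw [← Finset.range_eq_Ico, Finset.range_add_one]
    rw [this, Finset.biUnion_insert, Finset.union_comm, avgOn_union q, avgOn_of_free q hfn]
    rw [Finset.disjoint_biUnion_left]
    intro i hi
    exact hB (by rw [Finset.mem_range] at hi; omega)
  rw [hfin]
  linarith

end chain

/-! ### The constraint of the FA-1f model and the local Dirichlet energy -/

/-- The indicator of the event that the site `z` is empty. -/
def emp (z : Site d) (η : Config d) : ℝ := if η z = 0 then 1 else 0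

lemma emp_nonneg (z : Site d) (η : Config d) : 0 ≤ emp z η := by unfold emp; split_ifs <;> simp

lemma isLocal_emp (z : Site d) : IsLocal (emp z) := isLocal_site z fun s => if s = 0 then 1 else 0

lemma free_emp {x z : Site d} (h : z ≠ x) : Free x (emp z) := by
  intro η a; simp only [emp, Function.update_of_ne h]

lemma emp_update_zero (x : Site d) (η : Config d) : emp x (Function.update η x 0) = 1 := by
  simp [emp]

lemma emp_update_one (x : Site d) (η : Config d) : emp x (Function.update η x 1) = 0 := by
  simp [emp]

lemma not_mem_neighbors_self (x : Site d) : x ∉ neighbors x := by simp [neighbors]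

lemma mem_neighbors_comm {x y : Site d} : y ∈ neighbors x ↔ x ∈ neighbors y := by
  simp only [neighbors, Set.mem_ofPred_eq, abs_sub_comm]

/-- The sites at `ℓ^∞` distance at most one from `x`. -/
def unitBox (x : Site d) : Finset (Site d) := Fintype.piFinset fun i => Finset.Icc (x i - 1) (x i + 1)

lemma card_unitBox (x : Site d) : (unitBox x).card = 3 ^ d := by
  rw [unitBox, Fintype.card_piFinset]
  simp only [Int.card_Icc]
  have : ∀ i, (x i + 1 + 1 - (x i - 1)).toNat = 3 := fun i => by omega
  simp [this]

lemma mem_unitBox_of_mem_neighbors {x y : Site d} (h : y ∈ neighbors x) : y ∈ unitBox x := by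
  rw [unitBox, Fintype.mem_piFinset]
  intro i
  have h1 : |x i - y i| ≤ ∑ i, |x i - y i| :=
    Finset.single_le_sum (f := fun i => |x i - y i|) (fun _ _ => abs_nonneg _) (Finset.mem_univ i)
  rw [show ∑ i, |x i - y i| = 1 from h, abs_le] at h1
  rw [Finset.mem_Icc]; omega

/-- The constraint of the FA-1f model. -/
abbrev con (x : Site d) : Config d → ℝ := constraint (faClass d 1) x

open Classical in
lemma con_eq (x : Site d) (η : Config d) :
    con x η = if ∃ y ∈ neighbors x, η y = 0 then 1 else 0 := by
  have : (∃ A ∈ faClass d 1 x, ∀ y ∈ A, η y = 0) ↔ ∃ y ∈ neighbors x, η y = 0 := by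
    constructor
    · rintro ⟨A, ⟨hA, hc⟩, h0⟩
      obtain ⟨y, hy⟩ := Finset.card_pos.1 hc
      exact ⟨y, hA y hy, h0 y hy⟩
    · rintro ⟨y, hy, h0⟩
      exact ⟨{y}, ⟨by simpa using hy, by simp⟩, by simpa using h0⟩
  simp only [con, constraint, Set.indicator_apply, Set.mem_ofPred_eq, this, Pi.one_apply]

lemma con_zero_or_one (x : Site d) (η : Config d) : con x η = 0 ∨ con x η = 1 := by
  rw [con_eq]; split_ifs <;> simp

lemma con_nonneg (x : Site d) (η : Config d) : 0 ≤ con x η := by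
  rw [con_eq]; split_ifs <;> simp

lemma con_le_one (x : Site d) (η : Config d) : con x η ≤ 1 := by
  rw [con_eq]; split_ifs <;> simp

lemma emp_le_con {x y : Site d} (h : y ∈ neighbors x) (η : Config d) : emp y η ≤ con x η := by
  rw [con_eq, emp]
  split_ifs with h1 h2
  · exact le_rfl
  · exact absurd ⟨y, h, h1⟩ h2
  · simp
  · exact le_rfl

lemma con_le_sum (x : Site d) (η : Config d) :
    con x η ≤ ∑ y ∈ (unitBox x).erase x, emp y η := by
  rw [con_eq]
  split_ifs with h
  · obtain ⟨y, hy, h0⟩ := h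
    have h1 : emp y η = 1 := by simp [emp, h0]
    rw [← h1]
    refine Finset.single_le_sum (f := fun y => emp y η) (fun _ _ => emp_nonneg _ _) ?_
    rw [Finset.mem_erase]
    refine ⟨?_, mem_unitBox_of_mem_neighbors hy⟩
    rintro rfl
    exact not_mem_neighbors_self _ hy
  · exact Finset.sum_nonneg fun _ _ => emp_nonneg _ _

lemma isLocal_con (x : Site d) : IsLocal (con x) := by
  refine ⟨unitBox x, fun η ω h => ?_⟩
  classical
  rw [con_eq, con_eq]
  have : (∃ y ∈ neighbors x, η y = 0) ↔ ∃ y ∈ neighbors x, ω y = 0 := by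
    refine exists_congr fun y => and_congr_right fun hy => ?_
    rw [h y (mem_unitBox_of_mem_neighbors hy)]
  exact if_congr this rfl rfl

lemma free_con (x : Site d) : Free x (con x) := by
  intro η a
  classical
  rw [con_eq, con_eq]
  have : (∃ y ∈ neighbors x, Function.update η x a y = 0) ↔ ∃ y ∈ neighbors x, η y = 0 := by
    refine exists_congr fun y => and_congr_right fun hy => ?_
    rw [Function.update_of_ne]
    rintro rfl
    exact not_mem_neighbors_self _ hy
  exact if_congr this rfl rfl

/-- The discrete gradient of `f` at the site `x`. -/
def grad (x : Site d) (f : Config d → ℝ) (η : Config d) : ℝ :=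
  f (Function.update η x 0) - f (Function.update η x 1)

lemma IsLocal.grad {f : Config d → ℝ} (hf : IsLocal f) (x : Site d) : IsLocal (grad x f) :=
  (hf.comp_update x 0).map₂ (hf.comp_update x 1) (· - ·)

lemma free_grad_self (x : Site d) (f : Config d → ℝ) : Free x (grad x f) := by
  intro η a; simp [grad]

/-- The contribution of the site `x` to the Dirichlet form of a local function. -/
def energy (q : I) (f : Config d → ℝ) (x : Site d) : ℝ :=
  expect q (con x * (f - avg q x f) ^ 2)

lemma energy_nonneg (q : I) (f : Config d → ℝ) (x : Site d) : 0 ≤ energy q f x :=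
  expect_nonneg q fun η => mul_nonneg (con_nonneg x η) (sq_nonneg _)

lemma avg_sq_sub_avg (q : I) (x : Site d) (f : Config d → ℝ) :
    avg q x ((f - avg q x f) ^ 2) = fun η => (q : ℝ) * (1 - q) * grad x f η ^ 2 := by
  funext η
  simp only [avg_apply, Pi.pow_apply, Pi.sub_apply, grad, Function.update_idem]
  ring

lemma expect_mul_sq_sub_avg (q : I) {x : Site d} {c f : Config d → ℝ} (hc : IsLocal c)
    (hcx : Free x c) (hf : IsLocal f) :
    expect q (c * (f - avg q x f) ^ 2) = q * (1 - q) * expect q (c * grad x f ^ 2) := by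
  rw [← expect_avg q x (hc.mul ((hf.sub (hf.avg q x)).pow 2)), hcx.avg_mul, avg_sq_sub_avg,
    ← expect_const_mul]
  congr 1
  funext η
  simp only [Pi.mul_apply, Pi.pow_apply]; ring

lemma energy_eq (q : I) (x : Site d) {f : Config d → ℝ} (hf : IsLocal f) :
    energy q f x = q * (1 - q) * expect q (con x * grad x f ^ 2) :=
  expect_mul_sq_sub_avg q (isLocal_con x) (free_con x) hf

/-- The energy cost of moving a vacancy along an edge. -/
lemma expect_emp_mul_exch_le (q : I) (hq0 : 0 < (q : ℝ)) {u v : Site d}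
    (huv : v ∈ neighbors u) {f : Config d → ℝ} (hf : IsLocal f) :
    expect q (emp u * (fun η => (f (exch u v η) - f η) ^ 2)) ≤
      2 / q * (energy q f u + energy q f v) := by
  have hq1 := q.2.2
  have hne : u ≠ v := by rintro rfl; exact not_mem_neighbors_self _ huv
  have lu := isLocal_emp u
  have lv := isLocal_emp v
  have l1v : IsLocal (1 - emp v) := (isLocal_const 1).sub lv
  have lgv := (hf.grad v).pow 2
  have lgu := (hf.grad u).pow 2
  have lgu' := lgu.comp_update v 0
  set P : Config d → ℝ := (1 - emp v) * (emp u * grad v f ^ 2) with hP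
  set Q : Config d → ℝ := (1 - emp v) * (emp u * fun η => (grad u f ^ 2) (Function.update η v 0))
    with hQ
  have lP : IsLocal P := l1v.mul (lu.mul lgv)
  have lQ : IsLocal Q := l1v.mul (lu.mul lgu')
  have hpt : expect q (emp u * (fun η => (f (exch u v η) - f η) ^ 2)) ≤
      expect q (P + P + (Q + Q)) := by
    refine expect_mono q (lu.mul (((hf.comp_exch u v).sub hf).pow 2)) ((lP.add lP).add (lQ.add lQ))
      fun η => ?_
    simp only [hP, hQ, Pi.mul_apply, Pi.add_apply, Pi.pow_apply, Pi.sub_apply, Pi.one_apply]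
    by_cases h0 : η u = 0
    · by_cases h1 : η v = 0
      · have : exch u v η = η := by
          funext y
          simp only [exch, Equiv.swap_apply_def]
          split_ifs with h h'
          · rw [h, h0, h1]
          · rw [h', h0, h1]
          · rfl
        rw [this]; simp [emp, h1]
      · have hv1 : η v = 1 := by
          have : ∀ a : Fin 2, a ≠ 0 → a = 1 := by decide
          exact this _ h1
        have e1 : Function.update η v 1 = η := by rw [← hv1, Function.update_eq_self]
        have e2 : Function.update (Function.update η v 0) u 0 = Function.update η v 0 := by
          have : (Function.update η v 0) u = 0 := by rw [Function.update_of_ne hne, h0]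
          exact Function.update_eq_self_iff.2 this.symm
        have e3 : Function.update (Function.update η v 0) u 1 = exch u v η := by
          funext y
          simp only [exch, Equiv.swap_apply_def, Function.update_apply]
          split_ifs <;> simp_all
        simp only [emp, h0, h1, if_true, if_false, grad, e1, e2, e3]
        nlinarith [sq_nonneg ((f (Function.update η v 0) - f η) +
          (f (Function.update η v 0) - f (exch u v η)))]
    · simp [emp, h0]
  rw [expect_add q (lP.add lP) (lQ.add lQ), expect_add q lP lP, expect_add q lQ lQ] at hpt
  -- `P` carries the weight `1 - q` of an occupied `v`, the energy the weight `q (1 - q)`: a factor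
  -- `1/q` is lost.
  have hPle : q * expect q P ≤ energy q f v := by
    have fr : Free v (emp u * grad v f ^ 2) :=
      (free_emp hne).mul ((free_grad_self v f).map₂ (free_grad_self v f) fun a _ => a ^ 2)
    have e : avg q v P = fun η => (1 - (q : ℝ)) * (emp u * grad v f ^ 2) η := by
      rw [hP, mul_comm (1 - emp v), fr.avg_mul]
      funext η
      simp only [Pi.mul_apply, avg_apply, Pi.sub_apply, Pi.one_apply, emp_update_zero,
        emp_update_one]
      ring
    rw [← expect_avg q v lP, e, expect_const_mul, energy_eq q v hf, ← mul_assoc]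
    refine mul_le_mul_of_nonneg_left ?_ (mul_nonneg hq0.le (by linarith))
    refine expect_mono q (lu.mul lgv) ((isLocal_con v).mul lgv) fun η => ?_
    exact mul_le_mul_of_nonneg_right (emp_le_con (mem_neighbors_comm.1 huv) η) (sq_nonneg _)
  -- `Q` has mean `q (1 - q)` times that of `R` below, the squared gradient at `u` with `v` emptied.
  -- The part of the energy at `u` with `v` empty has one more factor `q`.
  have hQle : q * expect q Q ≤ energy q f u := by
    set R : Config d → ℝ := fun η => (grad u f ^ 2) (Function.update η v 0) with hR
    have lR : IsLocal R := lgu'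
    have frv : Free v R := by intro η a; simp [hR]
    have fru : Free u R := by
      intro η a
      simp only [hR, Pi.pow_apply]
      rw [Function.update_comm hne, free_grad_self]
    have e1 : avg q u (avg q v Q) = fun η => (q : ℝ) * (1 - q) * R η := by
      rw [hQ, ← mul_assoc, mul_comm _ R, frv.avg_mul, fru.avg_mul]
      funext η
      simp only [Pi.mul_apply, avg_apply, Pi.sub_apply, Pi.one_apply, emp_update_zero,
        emp_update_one]
      simp only [Function.update_comm hne, emp_update_zero, emp_update_one]
      ring
    have e2 : avg q v (emp v * grad u f ^ 2) = fun η => (q : ℝ) * R η := by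
      funext η
      simp only [Pi.mul_apply, avg_apply, emp_update_zero, emp_update_one, hR, Pi.pow_apply]
      ring
    have e3 : expect q (emp v * grad u f ^ 2) = q * expect q R := by
      rw [← expect_avg q v (lv.mul lgu), e2, expect_const_mul]
    rw [← expect_avg q v lQ, ← expect_avg q u (lQ.avg q v), e1, expect_const_mul,
      energy_eq q u hf]
    have e4 : (q : ℝ) * (q * (1 - q) * expect q R) = q * (1 - q) * (q * expect q R) := by ring
    rw [e4, ← e3]
    refine mul_le_mul_of_nonneg_left ?_ (mul_nonneg hq0.le (by linarith))
    refine expect_mono q (lv.mul lgu) ((isLocal_con u).mul lgu) fun η => ?_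
    exact mul_le_mul_of_nonneg_right (emp_le_con huv η) (sq_nonneg _)
  rw [div_mul_eq_mul_div, le_div_iff₀ hq0]
  nlinarith

/-! ### Moving a vacancy along a path -/

/-- Cauchy–Schwarz for two resistances `s` and `t` in series. -/
lemma sq_add_le_weighted {s t : ℝ} (hs : 0 < s) (ht : 0 < t) (a b : ℝ) :
    (a + b) ^ 2 ≤ (s + t) * (a ^ 2 / s + b ^ 2 / t) := by
  have h : (s + t) * (a ^ 2 / s + b ^ 2 / t) - (a + b) ^ 2 = (t * a - s * b) ^ 2 / (s * t) := by
    field_simp; ring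
  have : 0 ≤ (t * a - s * b) ^ 2 / (s * t) := by positivity
  linarith

/-- The energy of a jump of the contents between `u` and `v`, seen with both states of `x`. -/
def jump (x u v : Site d) (f : Config d → ℝ) (η : Config d) : ℝ :=
  (f (exch u v (Function.update η x 0)) - f (Function.update η x 0)) ^ 2 +
  (f (exch u v (Function.update η x 1)) - f (Function.update η x 1)) ^ 2

lemma IsLocal.jump {f : Config d → ℝ} (hf : IsLocal f) (x u v : Site d) :
    IsLocal (jump x u v f) :=
  (((hf.comp_exch u v).sub hf).pow 2 |>.comp_update x 0).add
    (((hf.comp_exch u v).sub hf).pow 2 |>.comp_update x 1)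

lemma exch_update {x u v : Site d} (hu : u ≠ x) (hv : v ≠ x) (η : Config d) (a : Fin 2) :
    exch u v (Function.update η x a) = Function.update (exch u v η) x a := by
  funext y
  by_cases hy : y = x
  · subst hy; simp [exch, Equiv.swap_apply_of_ne_of_ne hu.symm hv.symm]
  · rw [Function.update_of_ne hy]
    simp only [exch]
    rw [Function.update_of_ne]
    intro h
    apply hy
    rw [← Equiv.swap_apply_self u v y, h, Equiv.swap_apply_of_ne_of_ne hu.symm hv.symm]

/-- The gradient at `x` equals the gradient after the exchange plus two increments of `f` along the
exchange. The exchange preserves the measure and `h` and turns `emp u` into `emp v`, so the vacancy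
is transported from `v` to `u`. Here `s` is the resistance accumulated so far and `2 / w` that of
the new edge, the 2 coming from the two increments. -/
lemma path_step (q : I) {x u v : Site d} (hu : u ≠ x) (hv : v ≠ x) {h f : Config d → ℝ}
    (hh : IsLocal h) (hh0 : ∀ η, 0 ≤ h η) (hex : ∀ η, h (exch u v η) = h η) (hf : IsLocal f)
    {s w : ℝ} (hs : 0 < s) (hw : 0 < w) :
    expect q (emp v * h * grad x f ^ 2) ≤
      (s + 2 / w) * (expect q (emp u * h * grad x f ^ 2) / s +
        w * expect q (emp v * h * jump x u v f)) := by
  have lv := isLocal_emp v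
  have lu := isLocal_emp u
  have lg := (hf.grad x).pow 2
  have lj := hf.jump x u v
  set R : Config d → ℝ := emp u * h * grad x f ^ 2 with hR
  have lR : IsLocal R := (lu.mul hh).mul lg
  have lR' := lR.comp_exch u v
  have lJ : IsLocal (emp v * h * jump x u v f) := (lv.mul hh).mul lj
  have ht : 0 < 2 / w := by positivity
  have key : expect q (emp v * h * grad x f ^ 2) ≤
      expect q ((fun η => (s + 2 / w) / s * R (exch u v η)) +
        fun η => (s + 2 / w) * w * (emp v * h * jump x u v f) η) := by
    refine expect_mono q ((lv.mul hh).mul lg) ((lR'.map _).add (lJ.map _)) fun η => ?_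
    have e1 : emp u (exch u v η) = emp v η := by simp [emp, exch]
    have e2 : grad x f (exch u v η) = f (exch u v (Function.update η x 0)) -
        f (exch u v (Function.update η x 1)) := by
      rw [grad, exch_update hu hv, exch_update hu hv]
    simp only [Pi.add_apply, Pi.mul_apply, Pi.pow_apply, hR, e1, hex]
    have hp : 0 ≤ emp v η * h η := mul_nonneg (emp_nonneg _ _) (hh0 η)
    have hmain : grad x f η ^ 2 ≤ (s + 2 / w) / s * grad x f (exch u v η) ^ 2 +
        (s + 2 / w) * w * jump x u v f η := by
      rw [e2, jump, grad]
      set a0 := f (exch u v (Function.update η x 0))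
      set a1 := f (exch u v (Function.update η x 1))
      set b0 := f (Function.update η x 0)
      set b1 := f (Function.update η x 1)
      have h1 := sq_add_le_weighted hs ht (a0 - a1) ((b0 - a0) - (b1 - a1))
      have e3 : (a0 - a1) + ((b0 - a0) - (b1 - a1)) = b0 - b1 := by ring
      rw [e3] at h1
      have h2 : ((b0 - a0) - (b1 - a1)) ^ 2 / (2 / w) ≤ w * ((a0 - b0) ^ 2 + (a1 - b1) ^ 2) := by
        rw [div_div_eq_mul_div, div_le_iff₀ (by norm_num)]
        nlinarith [mul_nonneg hw.le (sq_nonneg ((b0 - a0) + (b1 - a1)))]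
      have h3 := mul_le_mul_of_nonneg_left h2 (by positivity : 0 ≤ s + 2 / w)
      calc (b0 - b1) ^ 2 ≤ _ := h1
        _ = (s + 2 / w) / s * (a0 - a1) ^ 2 +
          (s + 2 / w) * (((b0 - a0) - (b1 - a1)) ^ 2 / (2 / w)) := by ring
        _ ≤ _ := by rw [mul_assoc (s + 2 / w) w]; gcongr
    calc emp v η * h η * grad x f η ^ 2 ≤ emp v η * h η *
          ((s + 2 / w) / s * grad x f (exch u v η) ^ 2 + (s + 2 / w) * w * jump x u v f η) :=
        mul_le_mul_of_nonneg_left hmain hp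
      _ = _ := by ring
  rw [expect_add q (lR'.map _) (lJ.map _), expect_const_mul, expect_const_mul,
    expect_exch q u v lR] at key
  refine key.trans (le_of_eq ?_)
  ring

/-- Iteration of `path_step`: resistances add up in series, starting from 1 for the initial term. -/
lemma path_bound (q : I) {x : Site d} {A : Finset (Site d)} {h f : Config d → ℝ}
    (hh : IsLocal h) (hh0 : ∀ η, 0 ≤ h η)
    (hex : ∀ u ∈ A.erase x, ∀ v ∈ A.erase x, ∀ η, h (exch u v η) = h η) (hf : IsLocal f)
    (γ : ℕ → Site d) (w : ℕ → ℝ) (hw : ∀ j, 0 < w j) {a K : ℕ} (haK : a ≤ K)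
    (hγ : ∀ i, a ≤ i → i ≤ K → γ i ∈ A.erase x) :
    expect q (emp (γ K) * h * grad x f ^ 2) ≤
      (1 + ∑ j ∈ Finset.Ico a K, 2 / w j) * (expect q (emp (γ a) * h * grad x f ^ 2) +
        ∑ j ∈ Finset.Ico a K, w j * expect q (emp (γ (j + 1)) * h *
          jump x (γ j) (γ (j + 1)) f)) := by
  induction K, haK using Nat.le_induction with
  | base => simp
  | succ K haK ih =>
    have ih' := ih fun i h1 h2 => hγ i h1 (by omega)
    rw [Finset.sum_Ico_succ_top haK, Finset.sum_Ico_succ_top haK]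
    set s := 1 + ∑ j ∈ Finset.Ico a K, 2 / w j with hs
    have hs0 : 0 < s := by
      have : 0 ≤ ∑ j ∈ Finset.Ico a K, 2 / w j :=
        Finset.sum_nonneg fun j _ => by have := hw j; positivity
      linarith
    have m1 := hγ K haK (by omega)
    have m2 := hγ (K + 1) (by omega) le_rfl
    have hst := path_step q (Finset.ne_of_mem_erase m1) (Finset.ne_of_mem_erase m2) hh hh0
      (hex _ m1 _ m2) hf hs0 (hw K)
    rw [← add_assoc, ← add_assoc]
    refine hst.trans ?_
    have : 0 < 2 / w K := by have := hw K; positivity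
    gcongr
    rwa [div_le_iff₀' hs0]

/-! ### Energy bound for a family of vacancy paths -/

/-- The number of empty sites in `A`. -/
def vac (A : Finset (Site d)) (η : Config d) : ℝ := ∑ y ∈ A, emp y η

lemma vac_nonneg (A : Finset (Site d)) (η : Config d) : 0 ≤ vac A η :=
  Finset.sum_nonneg fun _ _ => emp_nonneg _ _

lemma isLocal_vac (A : Finset (Site d)) : IsLocal (vac A) :=
  IsLocal.sum A fun y _ => isLocal_emp y

lemma emp_le_vac {A : Finset (Site d)} {y : Site d} (hy : y ∈ A) (η : Config d) :
    emp y η ≤ vac A η :=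
  Finset.single_le_sum (f := fun y => emp y η) (fun _ _ => emp_nonneg _ _) hy

lemma free_vac_erase (A : Finset (Site d)) (x : Site d) : Free x (vac (A.erase x)) := by
  intro η a
  exact Finset.sum_congr rfl fun y hy => free_emp (Finset.ne_of_mem_erase hy) η a

/-- This invariance lets the normalisation by the number of vacancies pass unchanged along a path.
-/
lemma vac_exch {A : Finset (Site d)} {u v : Site d} (hu : u ∈ A) (hv : v ∈ A) (η : Config d) :
    vac A (exch u v η) = vac A η := by
  have hsw : ∀ y, y ∈ A ↔ Equiv.swap u v y ∈ A := by
    intro y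
    simp only [Equiv.swap_apply_def]
    split_ifs with h h'
    · subst h; simp [hu, hv]
    · subst h'; simp [hu, hv]
    · rfl
  exact Finset.sum_equiv (Equiv.swap u v) hsw fun y _ => rfl

lemma inv_vac_le_one {A : Finset (Site d)} (η : Config d) : (vac A η)⁻¹ ≤ 1 := by
  by_cases h : ∃ y ∈ A, η y = 0
  · obtain ⟨y, hy, h0⟩ := h
    have h1 : emp y η = 1 := by simp [emp, h0]
    exact inv_le_one_of_one_le₀ (h1 ▸ emp_le_vac hy η)
  · have : vac A η = 0 := by
      refine Finset.sum_eq_zero fun y hy => ?_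
      rw [emp, if_neg fun h0 => h ⟨y, hy, h0⟩]
    simp [this]

/-- The squared increment of `f` under an exchange. -/
def exsq (u v : Site d) (f : Config d → ℝ) (η : Config d) : ℝ := (f (exch u v η) - f η) ^ 2

lemma exsq_comm (u v : Site d) (f : Config d → ℝ) : exsq u v f = exsq v u f := by
  funext η
  have : exch u v η = exch v u η := by unfold exch; rw [Equiv.swap_comm]
  simp only [exsq, this]

lemma exsq_self (u : Site d) (f : Config d → ℝ) (η : Config d) : exsq u u f η = 0 := by
  have : exch u u η = η := by funext y; simp [exch]
  simp [exsq, this]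

lemma exsq_nonneg (u v : Site d) (f : Config d → ℝ) (η : Config d) : 0 ≤ exsq u v f η :=
  sq_nonneg _

lemma IsLocal.exsq {f : Config d → ℝ} (hf : IsLocal f) (u v : Site d) : IsLocal (exsq u v f) :=
  ((hf.comp_exch u v).sub hf).pow 2

/-- The weight with which the configurations enter the congestion of paths starting at `x`. -/
def pathWeight (q : I) (A : Finset (Site d)) (x : Site d) (η : Config d) : ℝ :=
  2 * emp x η / vac A η + q

lemma isLocal_pathWeight (q : I) (A : Finset (Site d)) (x : Site d) :
    IsLocal (pathWeight q A x) :=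
  (isLocal_emp x).map₂ (isLocal_vac A) fun a b => 2 * a / b + q

lemma pathWeight_nonneg (q : I) (A : Finset (Site d)) (x : Site d) (η : Config d) :
    0 ≤ pathWeight q A x η :=
  add_nonneg (div_nonneg (mul_nonneg zero_le_two (emp_nonneg _ _)) (vac_nonneg _ _)) q.2.1

/-- The numerators sum to `2 * vac A`, which cancels the denominator. When `A.card` is of order
`1/q` the bound is a constant, so summing over the starting points of the paths costs no volume
factor. -/
lemma sum_pathWeight_le (q : I) (A : Finset (Site d)) (η : Config d) :
    ∑ x ∈ A, pathWeight q A x η ≤ 2 + q * A.card := by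
  simp only [pathWeight]
  rw [Finset.sum_add_distrib, ← Finset.sum_div, ← Finset.mul_sum]
  have h : ∑ i ∈ A, emp i η = vac A η := rfl
  rw [h, Finset.sum_const, nsmul_eq_mul, mul_div_assoc]
  have := div_self_le_one (vac A η)
  linarith

/-- `jump` counts both states of `x` with weight one, whereas the measure gives them `q` and `1 -
q`; the factor `κ` below compensates. If `x` is empty, the vacancy at `v` ensures that including `x`
at most doubles the count, whence `2 * emp x / vac A`. If `x` is occupied, the weight is at most
`q`. -/
lemma expect_jump_le (q : I) {A : Finset (Site d)} {x u v : Site d} (hx : x ∈ A)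
    (hv : v ∈ A.erase x) {f : Config d → ℝ} (hf : IsLocal f) :
    q * (1 - q) * expect q (emp v * (vac (A.erase x))⁻¹ * jump x u v f) ≤
      expect q (pathWeight q A x * (emp v * exsq v u f)) := by
  have hq0 := q.2.1
  have hq1 := q.2.2
  have hvx := Finset.ne_of_mem_erase hv
  have lv := isLocal_emp v
  have lx := isLocal_emp x
  have lh : IsLocal (vac (A.erase x))⁻¹ := (isLocal_vac (A.erase x)).map (·⁻¹)
  have le := hf.exsq v u
  set H : Config d → ℝ := emp v * (vac (A.erase x))⁻¹ with hH
  have lH : IsLocal H := lv.mul lh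
  have fH : Free x H := (free_emp hvx).mul ((free_vac_erase A x).map₂ (free_vac_erase A x)
    fun a _ => a⁻¹)
  set κ : Config d → ℝ := fun η => (1 - q) * emp x η + q * (1 - emp x η) with hκ
  have lκ : IsLocal κ := lx.map fun a => (1 - q) * a + q * (1 - a)
  have e1 : avg q x (H * (κ * exsq v u f)) = fun η => q * (1 - q) * (H * jump x u v f) η := by
    rw [fH.avg_mul]
    funext η
    simp only [Pi.mul_apply, avg_apply, hκ, emp_update_zero, emp_update_one, jump,
      exsq_comm v u]
    simp only [exsq]
    ring
  rw [← expect_const_mul, ← e1, expect_avg q x (lH.mul (lκ.mul le))]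
  refine expect_mono q (lH.mul (lκ.mul le)) ((isLocal_pathWeight q A x).mul (lv.mul le))
    fun η => ?_
  simp only [Pi.mul_apply, hH, hκ, Pi.inv_apply]
  have hE := exsq_nonneg v u f η
  suffices h : emp v η * ((vac (A.erase x) η)⁻¹ * ((1 - q) * emp x η + q * (1 - emp x η))) ≤
      pathWeight q A x η * emp v η by nlinarith
  have h1 := inv_vac_le_one (A := A.erase x) η
  have h0 := vac_nonneg (A.erase x) η
  by_cases hv0 : η v = 0
  · have ev : emp v η = 1 := by simp [emp, hv0]
    have hN : 1 ≤ vac (A.erase x) η := ev ▸ emp_le_vac hv η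
    rw [ev, one_mul, mul_one, pathWeight]
    by_cases hx0 : η x = 0
    · have ex : emp x η = 1 := by simp [emp, hx0]
      have hA : vac A η = 1 + vac (A.erase x) η := by
        rw [vac, ← Finset.add_sum_erase A _ hx, ex]; rfl
      rw [ex, hA]
      have : (vac (A.erase x) η)⁻¹ ≤ 2 * 1 / (1 + vac (A.erase x) η) := by
        rw [inv_eq_one_div, div_le_div_iff₀ (by linarith) (by linarith)]; linarith
      have h3 : 0 ≤ (vac (A.erase x) η)⁻¹ := inv_nonneg.2 h0
      nlinarith
    · have ex : emp x η = 0 := by simp [emp, hx0]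
      rw [ex]
      simp only [mul_zero, zero_div, zero_add, sub_zero, mul_one]
      exact mul_le_of_le_one_left hq0 h1
  · have ev : emp v η = 0 := by simp [emp, hv0]
    simp [ev]

/-- The total energy of the exchanges of `u` with its neighbours in `A`, weighted by the paths
starting at `x`. -/
def exchEnergy (q : I) (A : Finset (Site d)) (f : Config d → ℝ) (x u : Site d) : ℝ :=
  open Classical in ∑ v ∈ A with v ∈ neighbors u,
    expect q (pathWeight q A x * (emp u * exsq u v f))

lemma exchEnergy_nonneg (q : I) (A : Finset (Site d)) (f : Config d → ℝ) (x u : Site d) :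
    0 ≤ exchEnergy q A f x u :=
  Finset.sum_nonneg fun _ _ => expect_nonneg q fun η =>
    mul_nonneg (pathWeight_nonneg q A x η) (mul_nonneg (emp_nonneg u η) (exsq_nonneg _ _ _ _))

/-- The path is followed backwards from the vacancy at `z` to the site visited just after the last
passage at `x`. That site is a neighbour of `x`, so the initial term of `path_bound` is a legal
flip. Cutting at the last passage keeps `x` out of all exchanges. -/
lemma single_path_bound (q : I) {A : Finset (Site d)} {f : Config d → ℝ} (hf : IsLocal f)
    {x z : Site d} (hx : x ∈ A) (hxz : x ≠ z) (γ : ℕ → Site d) (K : ℕ) (w : ℕ → ℝ)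
    (hw : ∀ j, 0 < w j) (h0 : γ 0 = x) (hK : γ K = z) (hA : ∀ i ≤ K, γ i ∈ A)
    (hstep : ∀ i < K, γ (i + 1) = γ i ∨ γ (i + 1) ∈ neighbors (γ i)) :
    q * (1 - q) * expect q (emp z * (vac (A.erase x))⁻¹ * grad x f ^ 2) ≤
      (1 + ∑ j ∈ Finset.range K, 2 / w j) * (energy q f x +
        ∑ j ∈ Finset.range K, w j * exchEnergy q A f x (γ (j + 1))) := by
  classical
  have hq : 0 ≤ (q : ℝ) * (1 - q) := mul_nonneg q.2.1 (sub_nonneg.2 q.2.2)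
  -- the last visit of the path to `x`
  set m := Nat.findGreatest (fun i => γ i = x) K with hm
  have hmx : γ m = x := Nat.findGreatest_spec (P := fun i => γ i = x) (Nat.zero_le K) h0
  have hmK : m < K := by
    refine lt_of_le_of_ne (Nat.findGreatest_le K) fun h => hxz ?_
    rw [← hmx, h, hK]
  have hafter : ∀ i, m < i → i ≤ K → γ i ≠ x := fun i h1 h2 => Nat.findGreatest_is_greatest h1 h2
  have hγ : ∀ i, m + 1 ≤ i → i ≤ K → γ i ∈ A.erase x := fun i h1 h2 =>
    Finset.mem_erase.2 ⟨hafter i h1 h2, hA i h2⟩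
  have hnb : γ (m + 1) ∈ neighbors x := by
    rcases hstep m hmK with h | h
    · exact absurd (h.trans hmx) (hafter _ (Nat.lt_succ_self m) hmK)
    · rwa [hmx] at h
  have lh : IsLocal (vac (A.erase x))⁻¹ := (isLocal_vac (A.erase x)).map (·⁻¹)
  have hh0 : ∀ η, 0 ≤ (vac (A.erase x))⁻¹ η := fun η => inv_nonneg.2 (vac_nonneg _ _)
  have lg := (hf.grad x).pow 2
  have main := path_bound q lh hh0 (A := A) (x := x)
    (fun u hu v hv η => by simp only [Pi.inv_apply, vac_exch hu hv]) hf γ w hw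
    (Nat.succ_le_of_lt hmK) hγ
  rw [hK] at main
  have hsub : Finset.Ico (m + 1) K ⊆ Finset.range K := fun i hi => by
    rw [Finset.mem_Ico] at hi; exact Finset.mem_range.2 hi.2
  have b1 : q * (1 - q) * expect q (emp (γ (m + 1)) * (vac (A.erase x))⁻¹ * grad x f ^ 2) ≤
      energy q f x := by
    rw [energy_eq q x hf]
    refine mul_le_mul_of_nonneg_left ?_ hq
    refine expect_mono q (((isLocal_emp _).mul lh).mul lg) ((isLocal_con x).mul lg) fun η => ?_
    refine mul_le_mul_of_nonneg_right ?_ (sq_nonneg _)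
    calc emp (γ (m + 1)) η * (vac (A.erase x) η)⁻¹ ≤ emp (γ (m + 1)) η * 1 :=
          mul_le_mul_of_nonneg_left (inv_vac_le_one η) (emp_nonneg _ _)
      _ ≤ con x η := by rw [mul_one]; exact emp_le_con hnb η
  have b2 : ∀ j ∈ Finset.Ico (m + 1) K, q * (1 - q) * (w j * expect q
      (emp (γ (j + 1)) * (vac (A.erase x))⁻¹ * jump x (γ j) (γ (j + 1)) f)) ≤
      w j * exchEnergy q A f x (γ (j + 1)) := by
    intro j hj
    rw [Finset.mem_Ico] at hj
    rw [mul_left_comm]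
    refine mul_le_mul_of_nonneg_left ?_ (hw j).le
    refine (expect_jump_le q hx (hγ (j + 1) (by omega) hj.2) hf).trans ?_
    rcases hstep j hj.2 with h | h
    · rw [h]
      have : pathWeight q A x * (emp (γ j) * exsq (γ j) (γ j) f) = fun _ => 0 := by
        funext η; simp [exsq_self]
      rw [this, expect_const, ← h]
      exact exchEnergy_nonneg q A f x _
    · exact Finset.single_le_sum
        (f := fun v => expect q (pathWeight q A x * (emp (γ (j + 1)) * exsq (γ (j + 1)) v f)))
        (fun v _ => expect_nonneg q fun η => mul_nonneg (pathWeight_nonneg q A x η)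
          (mul_nonneg (emp_nonneg _ η) (exsq_nonneg _ _ _ _)))
        (Finset.mem_filter.2 ⟨hA j (by omega), mem_neighbors_comm.1 h⟩)
  calc _ ≤ q * (1 - q) * ((1 + ∑ j ∈ Finset.Ico (m + 1) K, 2 / w j) *
        (expect q (emp (γ (m + 1)) * (vac (A.erase x))⁻¹ * grad x f ^ 2) +
        ∑ j ∈ Finset.Ico (m + 1) K, w j * expect q (emp (γ (j + 1)) * (vac (A.erase x))⁻¹ *
          jump x (γ j) (γ (j + 1)) f))) := mul_le_mul_of_nonneg_left main hq
    _ = (1 + ∑ j ∈ Finset.Ico (m + 1) K, 2 / w j) *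
        (q * (1 - q) * expect q (emp (γ (m + 1)) * (vac (A.erase x))⁻¹ * grad x f ^ 2) +
        ∑ j ∈ Finset.Ico (m + 1) K, q * (1 - q) * (w j * expect q (emp (γ (j + 1)) *
          (vac (A.erase x))⁻¹ * jump x (γ j) (γ (j + 1)) f))) := by
        rw [← Finset.mul_sum]; ring
    _ ≤ (1 + ∑ j ∈ Finset.Ico (m + 1) K, 2 / w j) * (energy q f x +
        ∑ j ∈ Finset.Ico (m + 1) K, w j * exchEnergy q A f x (γ (j + 1))) := by
        refine mul_le_mul_of_nonneg_left (add_le_add b1 (Finset.sum_le_sum b2)) ?_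
        have : 0 ≤ ∑ j ∈ Finset.Ico (m + 1) K, 2 / w j :=
          Finset.sum_nonneg fun j _ => by have := hw j; positivity
        linarith
    _ ≤ _ := by
        have p1 : ∑ j ∈ Finset.Ico (m + 1) K, 2 / w j ≤ ∑ j ∈ Finset.range K, 2 / w j :=
          Finset.sum_le_sum_of_subset_of_nonneg hsub fun j _ _ => by
            have := hw j; positivity
        have p2 : ∑ j ∈ Finset.Ico (m + 1) K, w j * exchEnergy q A f x (γ (j + 1)) ≤
            ∑ j ∈ Finset.range K, w j * exchEnergy q A f x (γ (j + 1)) :=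
          Finset.sum_le_sum_of_subset_of_nonneg hsub fun j _ _ =>
            mul_nonneg (hw j).le (exchEnergy_nonneg q A f x _)
        have p3 : 0 ≤ ∑ j ∈ Finset.Ico (m + 1) K, w j * exchEnergy q A f x (γ (j + 1)) :=
          Finset.sum_nonneg fun j _ => mul_nonneg (hw j).le (exchEnergy_nonneg q A f x _)
        have p4 : 0 ≤ ∑ j ∈ Finset.range K, 2 / w j :=
          Finset.sum_nonneg fun j _ => by have := hw j; positivity
        have p5 := energy_nonneg q f x
        gcongr

/-- Summing over `x` first turns the path weights into `2 + q * A.card`. Each exchange then costs at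
most `2 / q` times two site energies, and `3 ^ d` is a crude bound on the number of neighbours. -/
lemma sum_exchEnergy_le (q : I) (hq0 : 0 < (q : ℝ)) (A : Finset (Site d)) {f : Config d → ℝ}
    (hf : IsLocal f) :
    ∑ x ∈ A, ∑ u ∈ A, exchEnergy q A f x u ≤
      (2 + q * A.card) * (4 * 3 ^ d / q) * ∑ u ∈ A, energy q f u := by
  classical
  have hcard : ∀ u : Site d, ((A.filter fun v => v ∈ neighbors u).card : ℝ) ≤ 3 ^ d := by
    intro u
    have : (A.filter fun v => v ∈ neighbors u).card ≤ 3 ^ d := by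
      rw [← card_unitBox u]
      exact Finset.card_le_card fun v hv => mem_unitBox_of_mem_neighbors (Finset.mem_filter.1 hv).2
    exact_mod_cast this
  have hC : 0 ≤ 2 + (q : ℝ) * A.card := by positivity
  have h1 : ∀ u ∈ A, ∑ x ∈ A, exchEnergy q A f x u ≤ ∑ v ∈ A with v ∈ neighbors u,
      (2 + (q : ℝ) * A.card) * (2 / q * (energy q f u + energy q f v)) := by
    intro u _
    simp only [exchEnergy]
    rw [Finset.sum_comm]
    refine Finset.sum_le_sum fun v hv => ?_
    have le := hf.exsq u v
    have lW := (isLocal_emp u).mul le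
    rw [← expect_sum q A fun x _ => (isLocal_pathWeight q A x).mul lW]
    calc expect q (fun η => ∑ x ∈ A, (pathWeight q A x * (emp u * exsq u v f)) η)
        ≤ expect q (fun η => (2 + (q : ℝ) * (A.card : ℝ)) * (emp u * exsq u v f) η) := by
          refine expect_mono q (IsLocal.sum A fun x _ => (isLocal_pathWeight q A x).mul lW)
            (lW.map _) fun η => ?_
          simp only [Pi.mul_apply]
          rw [← Finset.sum_mul]
          exact mul_le_mul_of_nonneg_right (sum_pathWeight_le q A η)
            (mul_nonneg (emp_nonneg u η) (exsq_nonneg _ _ _ _))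
      _ = (2 + (q : ℝ) * (A.card : ℝ)) * expect q (emp u * exsq u v f) := expect_const_mul q _ _
      _ ≤ (2 + (q : ℝ) * (A.card : ℝ)) * (2 / q * (energy q f u + energy q f v)) :=
        mul_le_mul_of_nonneg_left (expect_emp_mul_exch_le q hq0 (Finset.mem_filter.1 hv).2 hf) hC
  have hS1 : ∑ u ∈ A, ∑ v ∈ A with v ∈ neighbors u, energy q f u ≤
      3 ^ d * ∑ u ∈ A, energy q f u := by
    rw [Finset.mul_sum]
    refine Finset.sum_le_sum fun u _ => ?_
    rw [Finset.sum_const, nsmul_eq_mul]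
    exact mul_le_mul_of_nonneg_right (hcard u) (energy_nonneg q f u)
  have hS2 : ∑ u ∈ A, ∑ v ∈ A with v ∈ neighbors u, energy q f v =
      ∑ u ∈ A, ∑ v ∈ A with v ∈ neighbors u, energy q f u := by
    simp only [Finset.sum_filter]
    rw [Finset.sum_comm]
    refine Finset.sum_congr rfl fun u _ => Finset.sum_congr rfl fun v _ => ?_
    simp only [mem_neighbors_comm (x := u) (y := v)]
  rw [Finset.sum_comm]
  refine (Finset.sum_le_sum h1).trans ?_
  simp only [← Finset.mul_sum, Finset.sum_add_distrib]
  rw [hS2]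
  have : (2 + (q : ℝ) * A.card) * (2 / q * (∑ u ∈ A, ∑ v ∈ A with v ∈ neighbors u, energy q f u +
      ∑ u ∈ A, ∑ v ∈ A with v ∈ neighbors u, energy q f u)) ≤
      (2 + (q : ℝ) * A.card) * (2 / q * (3 ^ d * ∑ u ∈ A, energy q f u +
      3 ^ d * ∑ u ∈ A, energy q f u)) := by gcongr
  refine this.trans (le_of_eq ?_)
  ring

/-! ### Choice of a vacancy and summation over paths -/

open Classical in
/-- The indicator that `A` has an empty site. -/
def someEmp (A : Finset (Site d)) (η : Config d) : ℝ := if ∃ z ∈ A, η z = 0 then 1 else 0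

lemma someEmp_zero_or_one (A : Finset (Site d)) (η : Config d) :
    someEmp A η = 0 ∨ someEmp A η = 1 := by
  unfold someEmp; split_ifs <;> simp

lemma someEmp_nonneg (A : Finset (Site d)) (η : Config d) : 0 ≤ someEmp A η := by
  unfold someEmp; split_ifs <;> simp

lemma isLocal_someEmp (A : Finset (Site d)) : IsLocal (someEmp A) := by
  refine ⟨A, fun η ω h => ?_⟩
  have : (∃ z ∈ A, η z = 0) ↔ ∃ z ∈ A, ω z = 0 :=
    exists_congr fun z => and_congr_right fun hz => by rw [h z hz]
  exact if_congr this rfl rfl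

lemma free_someEmp {A : Finset (Site d)} {x : Site d} (hx : x ∉ A) : Free x (someEmp A) := by
  intro η a
  have : (∃ z ∈ A, Function.update η x a z = 0) ↔ ∃ z ∈ A, η z = 0 :=
    exists_congr fun z => and_congr_right fun hz => by
      rw [Function.update_of_ne]; rintro rfl; exact hx hz
  exact if_congr this rfl rfl

lemma someEmp_mono {A B : Finset (Site d)} (h : A ⊆ B) (η : Config d) :
    someEmp A η ≤ someEmp B η := by
  unfold someEmp
  split_ifs with h1 h2
  · exact le_rfl
  · exact absurd (h1.imp fun z hz => ⟨h hz.1, hz.2⟩) h2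
  · simp
  · exact le_rfl

/-- A vacancy is picked uniformly among those present; if there is none, both sides vanish. -/
lemma someEmp_eq (A : Finset (Site d)) (η : Config d) :
    someEmp A η = ∑ z ∈ A, emp z η * (vac A η)⁻¹ := by
  rw [← Finset.sum_mul]
  have e : ∑ i ∈ A, emp i η = vac A η := rfl
  rw [e, someEmp]
  split_ifs with h
  · obtain ⟨y, hy, h0⟩ := h
    have h1 : emp y η = 1 := by simp [emp, h0]
    have := emp_le_vac hy η
    rw [mul_inv_cancel₀ (by linarith)]
  · have : vac A η = 0 := by
      refine Finset.sum_eq_zero fun y hy => ?_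
      rw [emp, if_neg fun h0 => h ⟨y, hy, h0⟩]
    simp [this]

/-- The local variances in `A`, restricted to the presence of another vacancy in `A`, are bounded
by the Dirichlet form on `A`, given a family of paths in `A`. -/
lemma flow_bound (q : I) (hq0 : 0 < (q : ℝ)) {A : Finset (Site d)} {f : Config d → ℝ}
    (hf : IsLocal f) (γ : Site d → Site d → ℕ → Site d) (K : Site d → Site d → ℕ) (w : ℕ → ℝ)
    (hw : ∀ j, 0 < w j) {s κ : ℝ} (hs0 : 0 ≤ s) (hκ0 : 0 ≤ κ)
    (h0 : ∀ x ∈ A, ∀ z ∈ A, x ≠ z → γ x z 0 = x)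
    (hK : ∀ x ∈ A, ∀ z ∈ A, x ≠ z → γ x z (K x z) = z)
    (hA : ∀ x ∈ A, ∀ z ∈ A, x ≠ z → ∀ i ≤ K x z, γ x z i ∈ A)
    (hstep : ∀ x ∈ A, ∀ z ∈ A, x ≠ z → ∀ i < K x z,
      γ x z (i + 1) = γ x z i ∨ γ x z (i + 1) ∈ neighbors (γ x z i))
    (hs : ∀ x ∈ A, ∀ z ∈ A, x ≠ z → 1 + ∑ j ∈ Finset.range (K x z), 2 / w j ≤ s)
    (hκ : ∀ x ∈ A, ∀ u ∈ A, ∑ z ∈ A.erase x, ∑ j ∈ Finset.range (K x z),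
      (if γ x z (j + 1) = u then w j else 0) ≤ κ) :
    ∑ x ∈ A, expect q (someEmp (A.erase x) * (f - avg q x f) ^ 2) ≤
      s * (A.card + κ * ((2 + q * A.card) * (4 * 3 ^ d / q))) * ∑ u ∈ A, energy q f u := by
  classical
  -- Decompose over the chosen vacancy `z`, bound each path, then regroup the exchanges by the
  -- visited site `u`: its total weight is at most `κ`.
  have h1 : ∀ x ∈ A, expect q (someEmp (A.erase x) * (f - avg q x f) ^ 2) ≤
      s * (A.card * energy q f x + κ * ∑ u ∈ A, exchEnergy q A f x u) := by
    intro x hx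
    have lh : IsLocal (vac (A.erase x))⁻¹ := (isLocal_vac (A.erase x)).map (·⁻¹)
    have lg := (hf.grad x).pow 2
    have e1 : expect q (someEmp (A.erase x) * (f - avg q x f) ^ 2) =
        ∑ z ∈ A.erase x, q * (1 - q) *
          expect q (emp z * (vac (A.erase x))⁻¹ * grad x f ^ 2) := by
      rw [expect_mul_sq_sub_avg q (isLocal_someEmp _) (free_someEmp (Finset.notMem_erase x A)) hf,
        ← Finset.mul_sum, ← expect_sum q _ fun z _ => ((isLocal_emp z).mul lh).mul lg]
      congr 2
      funext η
      simp only [Pi.mul_apply, someEmp_eq, Finset.sum_mul, Pi.inv_apply]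
    have h2 : ∀ z ∈ A.erase x, q * (1 - q) *
          expect q (emp z * (vac (A.erase x))⁻¹ * grad x f ^ 2) ≤
        s * (energy q f x + ∑ j ∈ Finset.range (K x z), w j * exchEnergy q A f x (γ x z (j + 1))) := by
      intro z hz
      have hzA := Finset.mem_of_mem_erase hz
      have hxz : x ≠ z := (Finset.ne_of_mem_erase hz).symm
      refine (single_path_bound q hf hx hxz (γ x z) (K x z) w hw (h0 x hx z hzA hxz)
        (hK x hx z hzA hxz) (hA x hx z hzA hxz) (hstep x hx z hzA hxz)).trans ?_
      refine mul_le_mul_of_nonneg_right (hs x hx z hzA hxz) ?_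
      exact add_nonneg (energy_nonneg q f x) (Finset.sum_nonneg fun j _ =>
        mul_nonneg (hw j).le (exchEnergy_nonneg q A f x _))
    rw [e1]
    refine (Finset.sum_le_sum h2).trans ?_
    rw [← Finset.mul_sum, Finset.sum_add_distrib, Finset.sum_const, nsmul_eq_mul]
    refine mul_le_mul_of_nonneg_left (add_le_add ?_ ?_) hs0
    · refine mul_le_mul_of_nonneg_right ?_ (energy_nonneg q f x)
      exact_mod_cast Finset.card_le_card (Finset.erase_subset x A)
    · have e2 : ∀ z ∈ A.erase x, ∀ j ∈ Finset.range (K x z),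
          w j * exchEnergy q A f x (γ x z (j + 1)) =
          ∑ u ∈ A, (if γ x z (j + 1) = u then w j else 0) * exchEnergy q A f x u := by
        intro z hz j hj
        have hzA := Finset.mem_of_mem_erase hz
        have hxz : x ≠ z := (Finset.ne_of_mem_erase hz).symm
        have hmem := hA x hx z hzA hxz (j + 1) (by rw [Finset.mem_range] at hj; omega)
        simp only [ite_mul, zero_mul]
        rw [Finset.sum_ite_eq, if_pos hmem]
      rw [Finset.sum_congr rfl fun z hz => Finset.sum_congr rfl (e2 z hz)]
      simp only [Finset.sum_comm (s := Finset.range _) (t := A)]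
      rw [Finset.sum_comm, Finset.mul_sum]
      refine Finset.sum_le_sum fun u hu => ?_
      simp only [← Finset.sum_mul]
      exact mul_le_mul_of_nonneg_right (hκ x hx u hu) (exchEnergy_nonneg q A f x u)
  refine (Finset.sum_le_sum h1).trans ?_
  rw [← Finset.mul_sum, Finset.sum_add_distrib, ← Finset.mul_sum, ← Finset.mul_sum, mul_assoc s]
  refine mul_le_mul_of_nonneg_left ?_ hs0
  rw [add_mul, mul_assoc κ]
  exact add_le_add le_rfl (mul_le_mul_of_nonneg_left (sum_exchEnergy_le q hq0 A hf) hκ0)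

/-! ### Discretised straight lines and their congestion -/

/-- The `ℓ^∞` distance. -/
def supDist (x z : Site d) : ℕ := Finset.univ.sup fun i => (z i - x i).natAbs

lemma natAbs_le_supDist (x z : Site d) (i : Fin d) : (z i - x i).natAbs ≤ supDist x z :=
  Finset.le_sup (f := fun i => (z i - x i).natAbs) (Finset.mem_univ i)

lemma abs_le_supDist (x z : Site d) (i : Fin d) : |z i - x i| ≤ (supDist x z : ℤ) := by
  rw [Int.abs_eq_natAbs]
  exact_mod_cast natAbs_le_supDist x z i

lemma supDist_le {x z : Site d} {n : ℕ} (h : ∀ i, (z i - x i).natAbs ≤ n) : supDist x z ≤ n :=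
  Finset.sup_le fun i _ => h i

lemma exists_eq_supDist (hd : 1 ≤ d) (x z : Site d) : ∃ i, (z i - x i).natAbs = supDist x z := by
  obtain ⟨i, _, hi⟩ := Finset.exists_mem_eq_sup Finset.univ ⟨⟨0, hd⟩, Finset.mem_univ _⟩
    fun i : Fin d => (z i - x i).natAbs
  exact ⟨i, hi.symm⟩

lemma supDist_pos {x z : Site d} (h : x ≠ z) : 0 < supDist x z := by
  obtain ⟨i, hi⟩ := Function.ne_iff.1 h
  have := natAbs_le_supDist x z i
  omega

/-- The number of steps among the first `m` made in direction `i`, when the directions are used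
cyclically. -/
def clock (d m : ℕ) (i : Fin d) : ℕ := (m + (d - 1 - i)) / d

lemma clock_zero (i : Fin d) : clock d 0 i = 0 := by
  have := i.2
  exact Nat.div_eq_of_lt (by omega)

lemma clock_mul (M : ℕ) (i : Fin d) : clock d (d * M) i = M := by
  have := i.2
  rw [clock, Nat.mul_add_div (by omega), Nat.div_eq_of_lt (by omega), add_zero]

lemma clock_mono {m m' : ℕ} (h : m ≤ m') (i : Fin d) : clock d m i ≤ clock d m' i :=
  Nat.div_le_div_right (by omega)

lemma div_le_clock (m : ℕ) (i : Fin d) : m / d ≤ clock d m i :=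
  Nat.div_le_div_right (by omega)

lemma clock_le (m : ℕ) (i : Fin d) : clock d m i ≤ m / d + 1 := by
  have := i.2
  rw [← Nat.add_div_right m (by omega)]
  exact Nat.div_le_div_right (by omega)

/-- The quotient jumps only when `m + 1 + (d - 1 - i)` is a multiple of `d`, that is when `m` is
congruent to `i` modulo `d`. -/
lemma clock_succ_of_ne {m : ℕ} {i : Fin d} (h : m % d ≠ i) : clock d (m + 1) i = clock d m i := by
  have hi := i.2
  rw [clock, clock, show m + 1 + (d - 1 - (i : ℕ)) = (m + (d - 1 - i)) + 1 by omega, Nat.succ_div,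
    if_neg, add_zero]
  intro hdvd
  apply h
  have e : m + (d - 1 - (i : ℕ)) + 1 = (m % d + (d - i)) + d * (m / d) := by
    have := Nat.mod_add_div m d
    omega
  rw [e, Nat.dvd_add_left (Dvd.intro _ rfl)] at hdvd
  have hlt := Nat.mod_lt m (by omega : 0 < d)
  obtain ⟨k, hk⟩ := hdvd
  have h1 : k = 1 := by
    rcases k with _ | _ | k
    · omega
    · rfl
    · have : d * (k + 1 + 1) = d * k + d + d := by ring
      have : 0 ≤ d * k := Nat.zero_le _
      omega
  subst h1
  omega

lemma clock_succ (m : ℕ) (i : Fin d) :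
    clock d (m + 1) i = clock d m i ∨ clock d (m + 1) i = clock d m i + 1 := by
  rw [clock, clock, show m + 1 + (d - 1 - (i : ℕ)) = (m + (d - 1 - i)) + 1 by omega, Nat.succ_div]
  split_ifs <;> simp

lemma mul_ediv_bounds {v M t : ℤ} (hM : 0 < M) (hv : |v| ≤ M) (ht : 0 ≤ t) :
    -t ≤ t * v / M ∧ t * v / M ≤ t := by
  rw [abs_le] at hv
  constructor
  · rw [Int.le_ediv_iff_mul_le hM]; nlinarith
  · exact Int.ediv_le_of_le_mul hM (by nlinarith)

lemma mul_ediv_step {v M t : ℤ} (hM : 0 < M) (hv : |v| ≤ M) :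
    |(t + 1) * v / M - t * v / M| ≤ 1 := by
  rw [abs_le] at hv
  have h1 : (t + 1) * v / M ≤ t * v / M + 1 := by
    rw [← Int.add_mul_ediv_right _ _ hM.ne']
    exact Int.ediv_le_ediv hM (by linarith)
  have h2 : t * v / M + (-1) ≤ (t + 1) * v / M := by
    rw [← Int.add_mul_ediv_right _ _ hM.ne']
    exact Int.ediv_le_ediv hM (by linarith)
  rw [abs_le]; omega

/-- The discretised straight line from `x` to `z`. -/
def ray (x z : Site d) (m : ℕ) : Site d :=
  fun i => x i + (clock d m i : ℤ) * (z i - x i) / (supDist x z : ℤ)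

lemma ray_zero (x z : Site d) : ray x z 0 = x := by
  funext i; simp [ray, clock_zero]

lemma ray_end {x z : Site d} (h : x ≠ z) : ray x z (d * supDist x z) = z := by
  funext i
  have h0 : (supDist x z : ℤ) ≠ 0 := by have := supDist_pos h; omega
  rw [ray, clock_mul, Int.mul_ediv_cancel_left _ h0]
  omega

/-- At time `m` only the clock of the coordinate `m % d` can tick. As every coordinate difference is
at most `supDist x z`, one tick moves the integer part by at most one. -/
lemma ray_step {x z : Site d} (h : x ≠ z) (m : ℕ) :
    ray x z (m + 1) = ray x z m ∨ ray x z (m + 1) ∈ neighbors (ray x z m) := by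
  have hM : (0 : ℤ) < supDist x z := by exact_mod_cast supDist_pos h
  have hd : 0 < d := by
    obtain ⟨i, _⟩ := Function.ne_iff.1 h
    exact i.pos
  set k : Fin d := ⟨m % d, Nat.mod_lt m hd⟩ with hk
  have hne : ∀ i, i ≠ k → ray x z (m + 1) i = ray x z m i := by
    intro i hi
    have : m % d ≠ i := fun e => hi (Fin.ext (by rw [hk]; exact e.symm))
    simp only [ray, clock_succ_of_ne this]
  have hk1 : |ray x z m k - ray x z (m + 1) k| ≤ 1 := by
    simp only [ray]
    rcases clock_succ m k with e | e
    · rw [e]; simp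
    · rw [e, abs_sub_comm, add_sub_add_left_eq_sub]
      push_cast
      exact mul_ediv_step hM (abs_le_supDist x z k)
  by_cases hkk : ray x z (m + 1) k = ray x z m k
  · left
    funext i
    by_cases hi : i = k
    · rw [hi, hkk]
    · exact hne i hi
  · right
    rw [neighbors, Set.mem_ofPred_eq, Finset.sum_eq_single k]
    · have : 0 < |ray x z m k - ray x z (m + 1) k| := abs_pos.2 (sub_ne_zero.2 (Ne.symm hkk))
      omega
    · intro i _ hi
      rw [hne i hi]; simp
    · simp

lemma ray_mem {x z : Site d} (h : x ≠ z) {lo hi : Site d}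
    (hx : x ∈ Fintype.piFinset fun i => Finset.Ico (lo i) (hi i))
    (hz : z ∈ Fintype.piFinset fun i => Finset.Ico (lo i) (hi i)) {m : ℕ}
    (hm : m ≤ d * supDist x z) :
    ray x z m ∈ Fintype.piFinset fun i => Finset.Ico (lo i) (hi i) := by
  rw [Fintype.mem_piFinset] at *
  intro i
  have hM : (0 : ℤ) < supDist x z := by exact_mod_cast supDist_pos h
  have hx' := Finset.mem_Ico.1 (hx i)
  have hz' := Finset.mem_Ico.1 (hz i)
  have ht : (clock d m i : ℤ) ≤ supDist x z := by
    exact_mod_cast (clock_mono hm i).trans (clock_mul _ i).le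
  have ht0 : (0 : ℤ) ≤ clock d m i := by positivity
  rw [Finset.mem_Ico, ray]
  set t : ℤ := ((clock d m i : ℕ) : ℤ)
  set M : ℤ := ((supDist x z : ℕ) : ℤ)
  rcases le_total 0 (z i - x i) with hv | hv
  · have h1 : 0 ≤ t * (z i - x i) / M := Int.ediv_nonneg (mul_nonneg ht0 hv) hM.le
    have h2 : t * (z i - x i) / M ≤ z i - x i := Int.ediv_le_of_le_mul hM (by nlinarith)
    omega
  · have h1 : z i - x i ≤ t * (z i - x i) / M := by
      rw [Int.le_ediv_iff_mul_le hM]; nlinarith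
    have h2 : t * (z i - x i) / M ≤ 0 := by
      refine Int.ediv_le_of_le_mul hM ?_
      rw [zero_mul]; exact mul_nonpos_of_nonneg_of_nonpos ht0 hv
    omega

/-- A coordinate realising the distance moves by exactly one per tick, the others by no more than
their clocks. All clocks lie between `m / d` and `m / d + 1`. -/
lemma supDist_ray (hd : 1 ≤ d) {x z : Site d} (h : x ≠ z) (m : ℕ) :
    m / d ≤ supDist x (ray x z m) ∧ supDist x (ray x z m) ≤ m / d + 1 := by
  have hM : (0 : ℤ) < supDist x z := by exact_mod_cast supDist_pos h
  constructor
  · obtain ⟨i, hi⟩ := exists_eq_supDist hd x z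
    have h1 := natAbs_le_supDist x (ray x z m) i
    have h2 := div_le_clock m i
    have h3 : (ray x z m i - x i).natAbs = clock d m i := by
      rw [ray, add_sub_cancel_left]
      rcases Int.natAbs_eq (z i - x i) with e | e
      · rw [e, hi, Int.mul_ediv_cancel _ hM.ne']; simp
      · rw [e, hi, mul_neg, Int.neg_ediv_of_dvd (Dvd.intro_left _ rfl),
          Int.mul_ediv_cancel _ hM.ne']; simp
    omega
  · refine supDist_le fun i => ?_
    have h1 := mul_ediv_bounds hM (abs_le_supDist x z i) (t := clock d m i) (by positivity)
    have h2 := clock_le m i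
    rw [ray, add_sub_cancel_left]
    omega

/-! ### Number of lines through a given site -/

lemma card_mul_le_of_spread {S : Finset ℤ} {t M : ℤ} (ht : 0 ≤ t)
    (h : ∀ y ∈ S, ∀ y' ∈ S, t * (y - y') ≤ M) (hM : 0 ≤ M) : (S.card : ℤ) * t ≤ M + t := by
  rcases S.eq_empty_or_nonempty with rfl | hS
  · simp; omega
  · have hsub : S ⊆ Finset.Icc (S.min' hS) (S.max' hS) := fun y hy =>
      Finset.mem_Icc.2 ⟨S.min'_le y hy, S.le_max' y hy⟩
    have hc := Finset.card_le_card hsub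
    rw [Int.card_Icc] at hc
    have hle := S.min'_le _ (S.max'_mem hS)
    have h1 := h _ (S.max'_mem hS) _ (S.min'_mem hS)
    have hc' : (S.card : ℤ) ≤ S.max' hS - S.min' hS + 1 := by omega
    nlinarith

/-- The number of lines from `x` through `u` at a given time. -/
lemma card_ray_eq_le (hd : 1 ≤ d) {n : ℕ} (hn : 1 ≤ n) {A : Finset (Site d)} {x u : Site d}
    (hA : ∀ z ∈ A, supDist x z ≤ n) {m : ℕ} (hm : m / d ≤ n) :
    (m / d + 1) ^ (d - 1) * ((A.erase x).filter fun z => ray x z m = u).card ≤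
      d * (4 * n) ^ d := by
  classical
  set τ := m / d with hτ
  -- An end point is described by a coordinate `k` realising the distance and the displacement `b`
  -- along it. Every other coordinate is confined by the integer part prescribed by `u`.
  let S : Fin d → ℤ → Fin d → Finset ℤ := fun k b i =>
    if i = k then {x k + b} else (Finset.Icc (x i - b.natAbs) (x i + b.natAbs)).filter
      fun y => x i + (clock d m i : ℤ) * (y - x i) / (b.natAbs : ℤ) = u i
  have hsub : ((A.erase x).filter fun z => ray x z m = u) ⊆
      (Finset.univ ×ˢ Finset.Icc (-(n : ℤ)) n).biUnion
        fun p : Fin d × ℤ => Fintype.piFinset (S p.1 p.2) := by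
    intro z hz
    obtain ⟨hz1, hz2⟩ := Finset.mem_filter.1 hz
    have hzA := hA z (Finset.mem_of_mem_erase hz1)
    obtain ⟨k, hk⟩ := exists_eq_supDist hd x z
    rw [Finset.mem_biUnion]
    refine ⟨(k, z k - x k), ?_, ?_⟩
    · simp only [Finset.mem_product, Finset.mem_univ, true_and, Finset.mem_Icc]
      omega
    · rw [Fintype.mem_piFinset]
      intro i
      simp only [S]
      split_ifs with hik
      · rw [hik, Finset.mem_singleton]; ring
      · rw [Finset.mem_filter, Finset.mem_Icc, hk]
        have := natAbs_le_supDist x z i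
        refine ⟨by omega, ?_⟩
        rw [← hz2]; rfl
  have hS : ∀ k : Fin d, ∀ b ∈ Finset.Icc (-(n : ℤ)) n, ∀ i, i ≠ k →
      (τ + 1) * (S k b i).card ≤ 4 * n := by
    intro k b hb i hik
    rw [Finset.mem_Icc] at hb
    have hbn : b.natAbs ≤ n := by omega
    have hcard : (S k b i).card ≤ 2 * n + 1 := by
      simp only [S, if_neg hik]
      refine (Finset.card_filter_le _ _).trans ?_
      rw [Int.card_Icc]; omega
    rcases Nat.eq_zero_or_pos τ with h0 | h0
    · rw [h0]; omega
    · have ht : τ ≤ clock d m i := div_le_clock m i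
      -- Equal integer parts of `t (y - x i) / |b|` and `t (y' - x i) / |b|` force `t (y - y') < |b|
      -- ≤ n`, while `τ ≤ t`. If `b = 0` the interval is a single point.
      have hspread : ∀ y ∈ S k b i, ∀ y' ∈ S k b i, (τ : ℤ) * (y - y') ≤ n := by
        intro y hy y' hy'
        simp only [S, if_neg hik, Finset.mem_filter, Finset.mem_Icc] at hy hy'
        rcases le_total y y' with hyy | hyy
        · nlinarith
        · rcases Nat.eq_zero_or_pos b.natAbs with hb0 | hb0
          · have : y = y' := by omega
            rw [this]; simp
          · set M : ℤ := (b.natAbs : ℤ)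
            set t : ℤ := (clock d m i : ℤ)
            have hM : 0 < M := by simp only [M]; omega
            have e : t * (y - x i) / M = t * (y' - x i) / M := by linarith [hy.2, hy'.2]
            have h1 : t * (y - x i) < (t * (y - x i) / M + 1) * M :=
              Int.lt_ediv_add_one_mul_self _ hM
            have h2 : t * (y' - x i) / M * M ≤ t * (y' - x i) := Int.ediv_mul_le _ hM.ne'
            rw [e] at h1
            have h3 : (τ : ℤ) ≤ t := by simp only [t]; exact_mod_cast ht
            have h4 : M ≤ n := by simp only [M]; exact_mod_cast hbn
            nlinarith
      have h1 := card_mul_le_of_spread (by positivity) hspread (by positivity)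
      have h2 : (S k b i).card * τ ≤ n + τ := by exact_mod_cast h1
      have h3 : (S k b i).card ≤ (S k b i).card * τ := Nat.le_mul_of_pos_right _ h0
      rw [add_mul, one_mul, mul_comm]
      omega
  have hprod : ∀ k : Fin d, ∀ b ∈ Finset.Icc (-(n : ℤ)) n,
      (τ + 1) ^ (d - 1) * (Fintype.piFinset (S k b)).card ≤ (4 * n) ^ (d - 1) := by
    intro k b hb
    rw [Fintype.card_piFinset, ← Finset.mul_prod_erase _ _ (Finset.mem_univ k)]
    have e1 : (S k b k).card = 1 := by simp [S]
    have e2 : (Finset.univ.erase k).card = d - 1 := by simp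
    rw [e1, one_mul, ← e2, ← Finset.prod_const, ← Finset.prod_const, ← Finset.prod_mul_distrib]
    exact Finset.prod_le_prod' fun i hi => hS k b hb i (Finset.ne_of_mem_erase hi)
  calc (τ + 1) ^ (d - 1) * ((A.erase x).filter fun z => ray x z m = u).card
      ≤ (τ + 1) ^ (d - 1) * ∑ p ∈ Finset.univ ×ˢ Finset.Icc (-(n : ℤ)) n,
        (Fintype.piFinset (S p.1 p.2)).card :=
        Nat.mul_le_mul_left _ ((Finset.card_le_card hsub).trans Finset.card_biUnion_le)
    _ = ∑ p ∈ Finset.univ ×ˢ Finset.Icc (-(n : ℤ)) n,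
        (τ + 1) ^ (d - 1) * (Fintype.piFinset (S p.1 p.2)).card := Finset.mul_sum _ _ _
    _ ≤ ∑ p ∈ (Finset.univ : Finset (Fin d)) ×ˢ Finset.Icc (-(n : ℤ)) n, (4 * n) ^ (d - 1) :=
        Finset.sum_le_sum fun p hp => hprod p.1 p.2 (Finset.mem_product.1 hp).2
    _ = d * (2 * n + 1) * (4 * n) ^ (d - 1) := by
        rw [Finset.sum_const, Finset.card_product, Int.card_Icc, Finset.card_univ, Fintype.card_fin,
          smul_eq_mul]
        congr 2
        omega
    _ ≤ d * (4 * n) * (4 * n) ^ (d - 1) := by gcongr; omega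
    _ = d * (4 * n) ^ d := by
        rw [mul_assoc, ← pow_succ', Nat.sub_add_cancel hd]

/-- Weights along the discretised lines. -/
def rayWeight (d j : ℕ) : ℝ := ((((j + 1) / d + 1 : ℕ) : ℝ)) ^ (d - 1)

lemma rayWeight_pos (d j : ℕ) : 0 < rayWeight d j := by
  unfold rayWeight; positivity

/-- `rayWeight` is the exact inverse of the dilution of the lines in `card_ray_eq_le`, so every
passage time contributes at most `d (4 n)^d`. By `supDist_ray` the distance from `x` to `u` leaves
at most `2 d` passage times. -/
lemma ray_congestion (hd : 1 ≤ d) {n : ℕ} (hn : 1 ≤ n) {A : Finset (Site d)} (x u : Site d)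
    (hA : ∀ z ∈ A, supDist x z ≤ n) :
    ∑ z ∈ A.erase x, ∑ j ∈ Finset.range (d * supDist x z),
      (if ray x z (j + 1) = u then rayWeight d j else 0) ≤ 2 * d ^ 2 * (4 * n) ^ d := by
  classical
  set r := supDist x u with hr
  let J := (Finset.range (d * n)).filter fun j => (j + 1) / d ≤ r ∧ r ≤ (j + 1) / d + 1
  have hJcard : J.card ≤ 2 * d := by
    have hsub : J ⊆ Finset.Ico (d * r - d - 1) (d * r + d - 1) := by
      intro j hj
      obtain ⟨_, h1, h2⟩ := Finset.mem_filter.1 hj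
      have h3 := Nat.div_add_mod (j + 1) d
      have h4 := Nat.mod_lt (j + 1) (by omega : 0 < d)
      have h5 := Nat.mul_le_mul_left d h1
      have h6 := Nat.mul_le_mul_left d h2
      rw [mul_add, mul_one] at h6
      rw [Finset.mem_Ico]
      omega
    refine (Finset.card_le_card hsub).trans ?_
    rw [Nat.card_Ico]; omega
  have h1 : ∀ z ∈ A.erase x, ∑ j ∈ Finset.range (d * supDist x z),
      (if ray x z (j + 1) = u then rayWeight d j else 0) ≤
      ∑ j ∈ J, (if ray x z (j + 1) = u then rayWeight d j else 0) := by
    intro z hz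
    have hxz : x ≠ z := (Finset.ne_of_mem_erase hz).symm
    rw [← Finset.sum_filter, ← Finset.sum_filter]
    refine Finset.sum_le_sum_of_subset_of_nonneg ?_ fun j _ _ => (rayWeight_pos d j).le
    intro j hj
    obtain ⟨hj1, hj2⟩ := Finset.mem_filter.1 hj
    have hs := supDist_ray hd hxz (j + 1)
    rw [hj2] at hs
    have hle := Nat.mul_le_mul_left d (hA z (Finset.mem_of_mem_erase hz))
    rw [Finset.mem_range] at hj1
    exact Finset.mem_filter.2 ⟨Finset.mem_filter.2 ⟨Finset.mem_range.2 (by omega), hs⟩, hj2⟩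
  refine (Finset.sum_le_sum h1).trans ?_
  rw [Finset.sum_comm]
  have h2 : ∀ j ∈ J, ∑ z ∈ A.erase x, (if ray x z (j + 1) = u then rayWeight d j else 0) ≤
      d * (4 * n) ^ d := by
    intro j hj
    have hjn := Finset.mem_range.1 (Finset.mem_filter.1 hj).1
    have hm : (j + 1) / d ≤ n := by
      calc (j + 1) / d ≤ (d * n) / d := Nat.div_le_div_right (by omega)
        _ = n := Nat.mul_div_cancel_left n (by omega)
    rw [← Finset.sum_filter, Finset.sum_const, nsmul_eq_mul, mul_comm, rayWeight]
    exact_mod_cast card_ray_eq_le hd hn hA hm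
  refine (Finset.sum_le_sum h2).trans ?_
  rw [Finset.sum_const, nsmul_eq_mul]
  have : (J.card : ℝ) ≤ 2 * d := by exact_mod_cast hJcard
  calc (J.card : ℝ) * (d * (4 * n) ^ d) ≤ 2 * d * (d * (4 * n) ^ d) := by gcongr
    _ = _ := by ring

/-! ### Poincaré inequality for local functions -/

lemma IsLocal.const_of_free {F : Config d → ℝ} (hF : IsLocal F) (h : ∀ x, Free x F)
    (η ω : Config d) : F η = F ω := by
  classical
  obtain ⟨S, hS⟩ := hF
  have claim : ∀ (T : Finset (Site d)) (η ω : Config d), (∀ i ∉ T, η i = ω i) → F η = F ω := by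
    intro T
    induction T using Finset.induction_on with
    | empty => intro η ω h; congr 1; funext i; exact h i (by simp)
    | insert a T ha ih =>
      intro η ω hηω
      rw [← h a η (ω a)]
      refine ih _ _ fun i hi => ?_
      by_cases hia : i = a
      · subst hia; simp
      · rw [Function.update_of_ne hia]; exact hηω i (by simp [hia, hi])
  have h1 : F (fun i => if i ∈ S then ω i else η i) = F ω := hS fun i hi => by
    have : i ∈ S := hi
    simp [this]
  rw [← h1]
  exact claim S _ _ fun i hi => by simp [hi]

lemma avgOn_one_sub_someEmp (q : I) (S : Finset (Site d)) (η : Config d) :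
    avgOn q S (1 - someEmp S) η = (1 - (q : ℝ)) ^ S.card := by
  classical
  have hprod : ∀ S : Finset (Site d), (1 - someEmp S) = fun η => ∏ y ∈ S, (1 - emp y η) := by
    intro S
    funext η
    simp only [Pi.sub_apply, Pi.one_apply, someEmp]
    split_ifs with h
    · obtain ⟨z, hz, h0⟩ := h
      rw [Finset.prod_eq_zero hz (by simp [emp, h0]), sub_self]
    · rw [Finset.prod_eq_one, sub_zero]
      intro y hy
      rw [emp, if_neg fun h0 => h ⟨y, hy, h0⟩, sub_zero]
  suffices h : avgOn q S (1 - someEmp S) = fun _ => (1 - (q : ℝ)) ^ S.card by rw [h]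
  induction S using Finset.induction_on with
  | empty => rw [avgOn_empty, hprod]; simp
  | insert a S ha ih =>
    have e1 : (1 - someEmp (insert a S)) = (1 - emp a) * (1 - someEmp S) := by
      rw [hprod, hprod]; funext η; simp [Finset.prod_insert ha]
    have hfree : ∀ x ∈ S, Free x (1 - emp a) := fun x hx =>
      (free_const x 1).sub (free_emp (by rintro rfl; exact ha hx))
    rw [avgOn_insert q ha, e1, avgOn_mul q hfree, ih]
    funext η
    simp only [avg_apply, Pi.mul_apply, Pi.sub_apply, Pi.one_apply, emp_update_zero,
      emp_update_one, Finset.card_insert_of_notMem ha]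
    ring

/-! ### Poincaré inequality from cubic blocks -/

/-- The block of side `ℓ` with index `b`. -/
def block (ℓ : ℕ) (b : Site d) : Finset (Site d) :=
  Fintype.piFinset fun i => Finset.Ico (ℓ * b i) (ℓ * b i + ℓ)

lemma mem_block_iff {ℓ : ℕ} (hℓ : 0 < ℓ) {b x : Site d} :
    x ∈ block ℓ b ↔ ∀ i, x i / (ℓ : ℤ) = b i := by
  have h : (0 : ℤ) < ℓ := by exact_mod_cast hℓ
  simp only [block, Fintype.mem_piFinset, Finset.mem_Ico]
  refine forall_congr' fun i => ?_
  constructor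
  · rintro ⟨h1, h2⟩
    apply le_antisymm
    · have : x i / (ℓ : ℤ) < b i + 1 := by
        rw [Int.ediv_lt_iff_lt_mul h]; linarith [mul_comm (ℓ : ℤ) (b i)]
      omega
    · rw [Int.le_ediv_iff_mul_le h]; linarith
  · intro h1
    rw [← h1]
    have e1 := Int.ediv_mul_le (x i) h.ne'
    have e2 := Int.lt_ediv_add_one_mul_self (x i) h
    constructor <;> nlinarith

lemma disjoint_block {ℓ : ℕ} (hℓ : 0 < ℓ) {b b' : Site d} (h : b ≠ b') :
    Disjoint (block ℓ b) (block ℓ b') := by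
  rw [Finset.disjoint_left]
  intro x hx hx'
  rw [mem_block_iff hℓ] at hx hx'
  exact h (funext fun i => (hx i).symm.trans (hx' i))

lemma card_block (ℓ : ℕ) (b : Site d) : (block ℓ b).card = ℓ ^ d := by
  simp [block, Fintype.card_piFinset]

/-- The constant in the Poincaré inequality for two neighbouring blocks of side `ℓ`. -/
def blockConst (d ℓ : ℕ) (q s : ℝ) : ℝ :=
  s * (2 * ℓ ^ d + 2 * d ^ 2 * (8 * ℓ) ^ d * ((2 + q * (2 * ℓ ^ d)) * (4 * 3 ^ d / q)))

/-- `flow_bound` is applied to the union of two adjacent cubes. This union is again a box, so it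
contains the lines joining its points, and its diameter is at most `2 ℓ`. -/
lemma block_flow (q : I) (hq0 : 0 < (q : ℝ)) (k : Fin d) {ℓ : ℕ} (hℓ : 0 < ℓ) {s : ℝ}
    (hs0 : 0 ≤ s)
    (hs : ∀ M ≤ 2 * ℓ, 1 + ∑ j ∈ Finset.range (d * M), 2 / rayWeight d j ≤ s) {f : Config d → ℝ}
    (hf : IsLocal f) (b : Site d) :
    ∑ x ∈ block ℓ b, expect q (someEmp (block ℓ (Function.update b k (b k + 1))) *
      (f - avg q x f) ^ 2) ≤
      blockConst d ℓ q s * (∑ u ∈ block ℓ b, energy q f u +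
        ∑ u ∈ block ℓ (Function.update b k (b k + 1)), energy q f u) := by
  classical
  set b' := Function.update b k (b k + 1) with hb'
  have hne : b ≠ b' := fun h => by
    have := congr_fun h k
    rw [hb', Function.update_self] at this
    omega
  have hdis := disjoint_block hℓ hne
  have hd : 1 ≤ d := k.pos
  set A := block ℓ b ∪ block ℓ b' with hA
  have hbox : A = Fintype.piFinset fun i =>
      Finset.Ico (ℓ * b i) (if i = k then ℓ * b i + 2 * ℓ else ℓ * b i + ℓ) := by
    ext x
    rw [hA, Finset.mem_union]
    simp only [block, Fintype.mem_piFinset, Finset.mem_Ico]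
    constructor
    · rintro (h | h) i
      · have := h i
        split_ifs <;> omega
      · have := h i
        by_cases hik : i = k
        · subst hik
          rw [hb', Function.update_self, mul_add, mul_one] at this
          rw [if_pos rfl]; omega
        · rw [hb', Function.update_of_ne hik] at this
          rw [if_neg hik]; exact this
    · intro h
      by_cases hk : x k < ℓ * b k + ℓ
      · left
        intro i
        have := h i
        by_cases hik : i = k
        · subst hik; exact ⟨this.1, hk⟩
        · rwa [if_neg hik] at this
      · right
        intro i
        have := h i
        by_cases hik : i = k
        · subst hik
          rw [if_pos rfl] at this
          rw [hb', Function.update_self, mul_add, mul_one]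
          omega
        · rw [if_neg hik] at this
          rwa [hb', Function.update_of_ne hik]
  have hcard : A.card = 2 * ℓ ^ d := by
    rw [hA, Finset.card_union_of_disjoint hdis, card_block, card_block]; ring
  have hdist : ∀ x ∈ A, ∀ z ∈ A, supDist x z ≤ 2 * ℓ := by
    intro x hx z hz
    rw [hbox, Fintype.mem_piFinset] at hx hz
    refine supDist_le fun i => ?_
    have h1 := Finset.mem_Ico.1 (hx i)
    have h2 := Finset.mem_Ico.1 (hz i)
    split_ifs at h1 h2 <;> omega
  have hmem : ∀ x ∈ A, ∀ z ∈ A, x ≠ z → ∀ i ≤ d * supDist x z, ray x z i ∈ A := by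
    intro x hx z hz hxz i hi
    rw [hbox] at hx hz ⊢
    exact ray_mem hxz hx hz hi
  have key := flow_bound q hq0 hf ray (fun x z => d * supDist x z) (rayWeight d) (A := A)
    (rayWeight_pos d) hs0 (κ := 2 * d ^ 2 * (4 * (2 * ℓ : ℕ)) ^ d) (by positivity)
    (fun x _ z _ _ => ray_zero x z) (fun x _ z _ h => ray_end h) hmem
    (fun x _ z _ h i _ => ray_step h i)
    (fun x hx z hz _ => hs _ (hdist x hx z hz))
    (fun x hx u _ => ray_congestion hd (by omega) x u (hdist x hx))
  have hsum : ∑ u ∈ A, energy q f u = ∑ u ∈ block ℓ b, energy q f u +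
      ∑ u ∈ block ℓ b', energy q f u := Finset.sum_union hdis
  rw [hsum, hcard] at key
  have e8 : (4 * ((2 * ℓ : ℕ) : ℝ)) ^ d = (8 * (ℓ : ℝ)) ^ d := by push_cast; ring
  rw [e8] at key
  push_cast at key
  refine le_trans ?_ key
  -- Only the sites of the first cube are kept: for them the second cube avoids `x`, so a vacancy in
  -- it is a vacancy of `A.erase x`.
  refine (Finset.sum_le_sum fun x hx => ?_).trans
    (Finset.sum_le_sum_of_subset_of_nonneg (Finset.subset_union_left : block ℓ b ⊆ A)
      fun x _ _ => expect_nonneg q fun η => mul_nonneg (someEmp_nonneg _ η) (sq_nonneg _))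
  have lg := (hf.sub (hf.avg q x)).pow 2
  refine expect_mono q ((isLocal_someEmp _).mul lg) ((isLocal_someEmp _).mul lg) fun η => ?_
  refine mul_le_mul_of_nonneg_right (someEmp_mono ?_ η) (sq_nonneg _)
  intro y hy
  refine Finset.mem_erase.2 ⟨?_, Finset.mem_union_right _ hy⟩
  rintro rfl
  exact Finset.disjoint_left.1 hdis hx hy

lemma blockConst_nonneg {d ℓ : ℕ} {q s : ℝ} (hq : 0 ≤ q) (hs : 0 ≤ s) :
    0 ≤ blockConst d ℓ q s := by
  unfold blockConst; positivity

lemma poincare_of_blocks (q : I) (hq0 : 0 < (q : ℝ)) (hd : 1 ≤ d) {ℓ : ℕ} (hℓ : 0 < ℓ)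
    (hgood : (1 - (q : ℝ)) ^ (ℓ ^ d) ≤ 1 / 8) {s : ℝ} (hs0 : 0 ≤ s)
    (hs : ∀ M ≤ 2 * ℓ, 1 + ∑ j ∈ Finset.range (d * M), 2 / rayWeight d j ≤ s) {f : Config d → ℝ}
    (hf : IsLocal f) :
    ∃ V : Finset (Site d), expect q ((f - fun _ => expect q f) ^ 2) ≤
      8 * blockConst d ℓ q s * ∑ u ∈ V, energy q f u := by
  classical
  set k : Fin d := ⟨0, hd⟩
  obtain ⟨S, hS⟩ := hf.exists_free
  obtain ⟨N, hN⟩ : ∃ N : ℕ, ∀ x ∈ S, ∀ i, (x i / (ℓ : ℤ)).natAbs < N := by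
    refine ⟨∑ x ∈ S, ∑ i, (x i / (ℓ : ℤ)).natAbs + 1, fun x hx i => Nat.lt_succ_of_le ?_⟩
    exact (Finset.single_le_sum (f := fun i => (x i / (ℓ : ℤ)).natAbs) (fun _ _ => Nat.zero_le _)
      (Finset.mem_univ i)).trans
      (Finset.single_le_sum (f := fun x : Site d => ∑ i, (x i / (ℓ : ℤ)).natAbs)
        (fun _ _ => Nat.zero_le _) hx)
  -- `L` indexes the lines by their first cube, at coordinate `-N`, and `β c j` is the `j`-th cube
  -- of the line. Those with `j < 2 * N` cover the support of `f`; the cube `j = 2 * N` lies beyond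
  -- it and is the inert last block required by `chain_variance_le`.
  let L : Finset (Site d) := Fintype.piFinset fun i =>
    if i = k then {-(N : ℤ)} else Finset.Ico (-(N : ℤ)) N
  let β : Site d → ℕ → Site d := fun c j => Function.update c k (-(N : ℤ) + j)
  let B : Site d → ℕ → Finset (Site d) := fun c j => block ℓ (β c j)
  have hLk : ∀ c ∈ L, c k = -(N : ℤ) := fun c hc => by
    simpa using (Fintype.mem_piFinset.1 hc) k
  have hβ : ∀ c ∈ L, ∀ c' ∈ L, ∀ j j', β c j = β c' j' → c = c' ∧ j = j' := by
    intro c hc c' hc' j j' h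
    refine ⟨funext fun i => ?_, ?_⟩
    · by_cases hik : i = k
      · rw [hik, hLk c hc, hLk c' hc']
      · have := congr_fun h i
        simpa [β, Function.update_of_ne hik] using this
    · have := congr_fun h k
      simp only [β, Function.update_self] at this
      omega
  have hβs : ∀ c j, Function.update (β c j) k (β c j k + 1) = β c (j + 1) := by
    intro c j
    simp only [β, Function.update_self, Function.update_idem]
    congr 1; push_cast; ring
  have hBd : ∀ c ∈ L, Pairwise (Function.onFun Disjoint (B c)) := fun c hc j j' hjj =>
    disjoint_block hℓ fun h => hjj (hβ c hc c hc j j' h).2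
  have hlast : ∀ c ∈ L, ∀ x ∈ B c (2 * N), Free x f := by
    intro c hc x hx
    apply hS
    intro hxS
    have h1 := (mem_block_iff hℓ).1 hx k
    have h2 := hN x hxS k
    simp only [β, Function.update_self] at h1
    push_cast at h1
    omega
  let U : Site d → Finset (Site d) := fun c => (Finset.range (2 * N)).biUnion (B c)
  let W := L.biUnion U
  have hUd : (L : Set (Site d)).PairwiseDisjoint U := by
    intro c hc c' hc' hcc
    simp only [Function.onFun, U]
    rw [Finset.disjoint_biUnion_left]
    intro j _
    rw [Finset.disjoint_biUnion_right]
    intro j' _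
    exact disjoint_block hℓ fun h => hcc (hβ c hc c' hc' j j' h).1
  have hW : ∀ x ∉ W, Free x f := by
    intro x hx
    apply hS
    intro hxS
    apply hx
    refine Finset.mem_biUnion.2 ⟨Function.update (fun i => x i / (ℓ : ℤ)) k (-(N : ℤ)), ?_, ?_⟩
    · refine Fintype.mem_piFinset.2 fun i => ?_
      by_cases hik : i = k
      · subst hik; simp
      · have := hN x hxS i
        rw [if_neg hik, Function.update_of_ne hik, Finset.mem_Ico]
        omega
    · have := hN x hxS k
      refine Finset.mem_biUnion.2 ⟨(x k / (ℓ : ℤ) + N).toNat, Finset.mem_range.2 (by omega), ?_⟩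
      refine (mem_block_iff hℓ).2 fun i => ?_
      by_cases hik : i = k
      · rw [hik]
        simp only [β, Function.update_self]
        omega
      · simp [β, Function.update_of_ne hik]
  -- the average over `W` is the expectation
  have havg : avgOn q W f = fun _ => expect q f := by
    have lW := hf.avgOn q (S := W)
    have hfree : ∀ x, Free x (avgOn q W f) := fun x => by
      by_cases hx : x ∈ W
      · exact free_avgOn q hx f
      · exact Free.avgOn q (hW x hx)
    funext η
    rw [← expect_avgOn q (S := W) hf]
    have e : avgOn q W f = fun _ => avgOn q W f η := funext fun ω => lW.const_of_free hfree ω η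
    conv_rhs => rw [e, expect_const]
  have e1 : (fun _ : Config d => (1 : ℝ)) = 1 := rfl
  have htens := expect_mul_sq_sub_biUnion_le q L U hUd (isLocal_const 1) (fun _ => zero_le_one)
    (fun c _ x _ => free_const x 1) hf
  simp only [e1, one_mul] at htens
  have hK := blockConst_nonneg (d := d) (ℓ := ℓ) (s := s) hq0.le hs0
  set K := blockConst d ℓ q s
  let E : Site d → ℕ → ℝ := fun c j => ∑ u ∈ B c j, energy q f u
  have hE0 : ∀ c j, 0 ≤ E c j := fun c j => Finset.sum_nonneg fun u _ => energy_nonneg q f u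
  have hline : ∀ c ∈ L, expect q ((f - avgOn q (U c) f) ^ 2) ≤
      8 * K * ∑ j ∈ Finset.range (2 * N + 1), E c j := by
    intro c hc
    have hch := chain_variance_le q (B c) (hBd c hc) (2 * N) hf (hlast c hc)
      (fun j => someEmp (B c (j + 1))) (fun j => isLocal_someEmp _)
      (fun j => someEmp_zero_or_one _) (fun j x hx => free_someEmp hx)
      (fun j η => by rw [avgOn_one_sub_someEmp, card_block]; exact hgood)
    have hblk : ∀ j ∈ Finset.range (2 * N),
        expect q (someEmp (B c (j + 1)) * (f - avgOn q (B c j) f) ^ 2) ≤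
        K * (E c j + E c (j + 1)) := by
      intro j _
      refine (expect_mul_sq_sub_avgOn_le_sum q (isLocal_someEmp _) (someEmp_nonneg _)
        (fun x hx => free_someEmp fun hx' => Finset.disjoint_left.1
          (hBd c hc (by omega : j ≠ j + 1)) hx hx') hf).trans ?_
      have := block_flow q hq0 k hℓ hs0 hs hf (β c j)
      rw [hβs] at this
      exact this
    refine hch.trans ?_
    have h1 := Finset.sum_le_sum hblk
    rw [← Finset.mul_sum, Finset.sum_add_distrib] at h1
    have h2 := Finset.sum_range_succ (E c) (2 * N)
    have h3 := Finset.sum_range_succ' (E c) (2 * N)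
    -- Each cube belongs to at most two consecutive pairs; with the 4 of the chain this gives the
    -- factor 8.
    have h4 : ∑ j ∈ Finset.range (2 * N), E c j + ∑ j ∈ Finset.range (2 * N), E c (j + 1) ≤
        2 * ∑ j ∈ Finset.range (2 * N + 1), E c j := by
      linarith [hE0 c 0, hE0 c (2 * N)]
    have h5 := mul_le_mul_of_nonneg_left h4 hK
    linarith
  refine ⟨(L ×ˢ Finset.range (2 * N + 1)).biUnion fun p => B p.1 p.2, ?_⟩
  rw [Finset.sum_biUnion]
  · rw [Finset.sum_product, Finset.mul_sum, ← havg]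
    exact htens.trans (Finset.sum_le_sum hline)
  · rintro ⟨c, j⟩ hp ⟨c', j'⟩ hp' hpp
    refine disjoint_block hℓ fun h => hpp ?_
    have := hβ c (Finset.mem_product.1 hp).1 c' (Finset.mem_product.1 hp').1 j j' h
    exact Prod.ext this.1 this.2

/-! ### Choice of the scale -/

/-- Take `ℓ` to be `(3/q)^(1/d)` rounded up, which at most doubles it because `3/q ≥ 1`. The 3 is
there to make a cube vacancy-free with probability at most `exp (-3) ≤ 1/8`. -/
lemma exists_scale (hd : 1 ≤ d) {q : ℝ} (hq0 : 0 < q) (hq1 : q < 1) :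
    ∃ ℓ : ℕ, 0 < ℓ ∧ 3 / q ≤ (ℓ : ℝ) ^ d ∧ (ℓ : ℝ) ^ d ≤ 3 * 2 ^ d / q := by
  have hd0 : (d : ℝ) ≠ 0 := by positivity
  set y : ℝ := (3 / q) ^ ((d : ℝ)⁻¹) with hy
  have h3 : 1 ≤ 3 / q := by rw [le_div_iff₀ hq0]; linarith
  have hy1 : 1 ≤ y := Real.one_le_rpow h3 (by positivity)
  have hyd : y ^ d = 3 / q := by
    rw [hy, ← Real.rpow_natCast, ← Real.rpow_mul (by positivity), inv_mul_cancel₀ hd0,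
      Real.rpow_one]
  refine ⟨⌈y⌉₊, Nat.ceil_pos.2 (by linarith), ?_, ?_⟩
  · rw [← hyd]
    exact pow_le_pow_left₀ (by linarith) (Nat.le_ceil y) d
  · have h1 : (⌈y⌉₊ : ℝ) ≤ 2 * y := by
      have := Nat.ceil_lt_add_one (by linarith : 0 ≤ y)
      linarith
    calc (⌈y⌉₊ : ℝ) ^ d ≤ (2 * y) ^ d := pow_le_pow_left₀ (by positivity) h1 d
      _ = 3 * 2 ^ d / q := by rw [mul_pow, hyd]; ring

lemma one_sub_pow_le {q : ℝ} (hq0 : 0 < q) (hq1 : q < 1) {n : ℕ} (h : 3 / q ≤ n) :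
    (1 - q) ^ n ≤ 1 / 8 := by
  have h1 : (1 - q) ^ n ≤ Real.exp (-q) ^ n :=
    pow_le_pow_left₀ (by linarith) (by linarith [Real.add_one_le_exp (-q)]) n
  have h2 : Real.exp (-q) ^ n ≤ Real.exp (-3) := by
    rw [← Real.exp_nat_mul]
    apply Real.exp_le_exp.2
    rw [div_le_iff₀ hq0] at h
    linarith
  have h3 : Real.exp (-3) ≤ 1 / 8 := by
    rw [Real.exp_neg, one_div]
    apply inv_anti₀ (by norm_num)
    have : Real.exp 3 = Real.exp 1 ^ 3 := by rw [← Real.exp_nat_mul]; norm_num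
    rw [this]
    have h2 : (2 : ℝ) ≤ Real.exp 1 := by linarith [Real.add_one_le_exp (1 : ℝ)]
    calc (8 : ℝ) = 2 ^ 3 := by norm_num
      _ ≤ _ := pow_le_pow_left₀ (by norm_num) h2 3
  linarith

/-- A dimensional constant. -/
def poincareConst (d : ℕ) : ℝ :=
  8 * (6 * 2 ^ d + 2 * d ^ 2 * 8 ^ d * (3 * 2 ^ d) * ((2 + 6 * 2 ^ d) * (4 * 3 ^ d)))

lemma poincareConst_pos (d : ℕ) : 0 < poincareConst d := by
  unfold poincareConst; positivity

/-- At this scale `q ℓ^d` is bounded. The two remaining factors `1/q` are the congestion and the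
cost of an exchange. -/
lemma blockConst_le {ℓ : ℕ} {q s : ℝ} (hq0 : 0 < q) (hq1 : q < 1) (hs : 0 ≤ s)
    (hℓ : (ℓ : ℝ) ^ d ≤ 3 * 2 ^ d / q) :
    8 * blockConst d ℓ q s ≤ poincareConst d * s / q ^ 2 := by
  have h1 : q * (2 * (ℓ : ℝ) ^ d) ≤ 6 * 2 ^ d := by
    rw [le_div_iff₀ hq0] at hℓ; linarith
  have h2 : 1 / q ≤ 1 / q ^ 2 := by
    apply one_div_le_one_div_of_le (by positivity); nlinarith
  unfold blockConst poincareConst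
  rw [mul_pow]
  calc 8 * (s * (2 * (ℓ : ℝ) ^ d + 2 * d ^ 2 * (8 ^ d * (ℓ : ℝ) ^ d) *
        ((2 + q * (2 * (ℓ : ℝ) ^ d)) * (4 * 3 ^ d / q))))
      ≤ 8 * (s * (2 * (3 * 2 ^ d / q) + 2 * d ^ 2 * (8 ^ d * (3 * 2 ^ d / q)) *
        ((2 + 6 * 2 ^ d) * (4 * 3 ^ d / q)))) := by gcongr
    _ = 8 * (s * (6 * 2 ^ d * (1 / q) + 2 * d ^ 2 * 8 ^ d * (3 * 2 ^ d) *
        ((2 + 6 * 2 ^ d) * (4 * 3 ^ d)) * (1 / q ^ 2))) := by field_simp; ring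
    _ ≤ 8 * (s * (6 * 2 ^ d * (1 / q ^ 2) + 2 * d ^ 2 * 8 ^ d * (3 * 2 ^ d) *
        ((2 + 6 * 2 ^ d) * (4 * 3 ^ d)) * (1 / q ^ 2))) := by gcongr
    _ = _ := by field_simp

lemma poincare_local (q : I) (hq0 : 0 < (q : ℝ)) (hq1 : (q : ℝ) < 1) (hd : 1 ≤ d) {s : ℝ}
    (hs0 : 0 ≤ s)
    (hs : ∀ M : ℕ, (M : ℝ) ≤ 6 * 2 ^ d / q →
      1 + ∑ j ∈ Finset.range (d * M), 2 / rayWeight d j ≤ s)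
    {f : Config d → ℝ} (hf : IsLocal f) :
    ∃ V : Finset (Site d), expect q ((f - fun _ => expect q f) ^ 2) ≤
      poincareConst d * s / q ^ 2 * ∑ u ∈ V, energy q f u := by
  obtain ⟨ℓ, hℓ0, hℓ1, hℓ2⟩ := exists_scale hd hq0 hq1
  -- A crude bound on the length of the lines. It is an equality for `d = 1`, costs a constant
  -- factor in the logarithm for `d = 2`, and is irrelevant for `d ≥ 3`, where the resistance is
  -- bounded uniformly in the length.
  have hℓd : (ℓ : ℝ) ≤ (ℓ : ℝ) ^ d := by
    exact_mod_cast Nat.le_self_pow (by omega) ℓ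
  obtain ⟨V, hV⟩ := poincare_of_blocks q hq0 hd hℓ0
    (one_sub_pow_le hq0 hq1 (by exact_mod_cast hℓ1)) hs0 (fun M hM => hs M (by
      have hM' : (M : ℝ) ≤ 2 * ℓ := by exact_mod_cast hM
      calc (M : ℝ) ≤ 2 * (3 * 2 ^ d / q) := by linarith
        _ = _ := by ring)) hf
  refine ⟨V, hV.trans ?_⟩
  exact mul_le_mul_of_nonneg_right (blockConst_le hq0 hq1 hs0 hℓ2)
    (Finset.sum_nonneg fun u _ => energy_nonneg q f u)

lemma sum_div_rayWeight_le (hd : 1 ≤ d) (M : ℕ) :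
    ∑ j ∈ Finset.range (d * M), 2 / rayWeight d j ≤
      2 * d * ∑ τ ∈ Finset.range M, 1 / ((τ : ℝ) + 1) ^ (d - 1) := by
  induction M with
  | zero => simp
  | succ M ih =>
    rw [mul_add, mul_one, Finset.sum_range_add, Finset.sum_range_succ, mul_add]
    refine add_le_add ih ?_
    have : ∀ j ∈ Finset.range d, 2 / rayWeight d (d * M + j) ≤ 2 / ((M : ℝ) + 1) ^ (d - 1) := by
      intro j _
      have h1 : M + 1 ≤ (d * M + j + 1) / d + 1 := by
        rw [add_assoc, Nat.mul_add_div (by omega)]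
        exact Nat.succ_le_succ (Nat.le_add_right _ _)
      have h2 : (M : ℝ) + 1 ≤ (((d * M + j + 1) / d + 1 : ℕ) : ℝ) := by exact_mod_cast h1
      unfold rayWeight
      gcongr
    refine (Finset.sum_le_sum this).trans (le_of_eq ?_)
    rw [Finset.sum_const, Finset.card_range, nsmul_eq_mul]; ring

lemma sum_inv_sq_le (M : ℕ) : ∑ τ ∈ Finset.range M, 1 / ((τ : ℝ) + 1) ^ 2 ≤ 2 := by
  have h : ∀ M : ℕ, ∑ τ ∈ Finset.range (M + 1), 1 / ((τ : ℝ) + 1) ^ 2 ≤ 2 - 1 / ((M : ℝ) + 1) := by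
    intro M
    induction M with
    | zero => norm_num
    | succ M ih =>
      rw [Finset.sum_range_succ]
      have : 1 / (((M + 1 : ℕ) : ℝ) + 1) ^ 2 ≤ 1 / ((M : ℝ) + 1) - 1 / (((M + 1 : ℕ) : ℝ) + 1) := by
        push_cast
        rw [div_sub_div _ _ (by positivity) (by positivity),
          div_le_div_iff₀ (by positivity) (by positivity)]
        nlinarith [(Nat.cast_nonneg M : (0 : ℝ) ≤ M)]
      linarith
  cases M with
  | zero => norm_num
  | succ M =>
    have : 0 ≤ 1 / ((M : ℝ) + 1) := by positivity
    linarith [h M]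

lemma resistance_one {q : ℝ} (hq0 : 0 < q) (hq1 : q < 1) (M : ℕ)
    (hM : (M : ℝ) ≤ 6 * 2 ^ 1 / q) :
    1 + ∑ j ∈ Finset.range (1 * M), 2 / rayWeight 1 j ≤ 25 / q := by
  have h := sum_div_rayWeight_le le_rfl M
  simp only [Nat.sub_self, pow_zero, div_one, Finset.sum_const, Finset.card_range, nsmul_eq_mul,
    mul_one, Nat.cast_one] at h
  have h1 : 1 ≤ 1 / q := by rw [le_div_iff₀ hq0]; linarith
  have h2 : 25 / q = 1 / q + 2 * (6 * 2 ^ 1 / q) := by ring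
  linarith

lemma resistance_two {q : ℝ} (hq0 : 0 < q) (M : ℕ)
    (hM : (M : ℝ) ≤ 6 * 2 ^ 2 / q) :
    1 + ∑ j ∈ Finset.range (2 * M), 2 / rayWeight 2 j ≤ 101 * max 1 (Real.log (1 / q)) := by
  have h := sum_div_rayWeight_le one_le_two M
  have hm1 := le_max_left 1 (Real.log (1 / q))
  have hm2 := le_max_right 1 (Real.log (1 / q))
  rcases Nat.eq_zero_or_pos M with rfl | hM0
  · simp only [mul_zero, Finset.range_zero, Finset.sum_empty]; linarith
  have hh := harmonic_le_one_add_log M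
  have e : ∑ τ ∈ Finset.range M, 1 / ((τ : ℝ) + 1) ^ (2 - 1) = ((harmonic M : ℚ) : ℝ) := by
    simp [harmonic]
  rw [e] at h
  -- Uses `log 24 ≤ 23`. The total is then `1 + 4 (1 + 23 + log (1/q))`, whence the constant 97 + 4
  -- = 101.
  have hlog : Real.log M ≤ 23 + Real.log (1 / q) := by
    have hM0' : (0 : ℝ) < M := by exact_mod_cast hM0
    have h1 := Real.log_le_log hM0' hM
    have h2 : (6 * 2 ^ 2 / q : ℝ) = 24 * (1 / q) := by ring
    rw [h2, Real.log_mul (by norm_num) (by positivity)] at h1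
    have := Real.log_le_sub_one_of_pos (by norm_num : (0 : ℝ) < 24)
    linarith
  push_cast at h
  linarith

lemma resistance_three (hd : 3 ≤ d) (M : ℕ) :
    1 + ∑ j ∈ Finset.range (d * M), 2 / rayWeight d j ≤ 1 + 4 * d := by
  have h := sum_div_rayWeight_le (by omega : 1 ≤ d) M
  have h1 : ∑ τ ∈ Finset.range M, 1 / ((τ : ℝ) + 1) ^ (d - 1) ≤
      ∑ τ ∈ Finset.range M, 1 / ((τ : ℝ) + 1) ^ 2 := by
    refine Finset.sum_le_sum fun τ _ => ?_
    apply one_div_le_one_div_of_le (by positivity)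
    exact pow_le_pow_right₀ (by linarith [(Nat.cast_nonneg τ : (0 : ℝ) ≤ τ)]) (by omega)
  have h2 := sum_inv_sq_le M
  have h3 : 2 * (d : ℝ) * ∑ τ ∈ Finset.range M, 1 / ((τ : ℝ) + 1) ^ (d - 1) ≤ 2 * d * 2 := by
    gcongr; linarith
  linarith

/-! ### The Dirichlet form as a sum of squared `L²` norms -/

lemma eLpNorm_two_sq (q : I) (h : Config d → ℝ) :
    eLpNorm h 2 (bernoulli d q) ^ 2 = ∫⁻ η, ‖h η‖ₑ ^ 2 ∂(bernoulli d q) := by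
  have := eLpNorm_nnreal_pow_eq_lintegral (f := h) (μ := bernoulli d q) (p := 2) two_ne_zero
  simpa using this

lemma ofReal_integral_sq (q : I) {h : Config d → ℝ} (hh : MemLp h 2 (bernoulli d q)) :
    ENNReal.ofReal (∫ η, h η ^ 2 ∂(bernoulli d q)) = eLpNorm h 2 (bernoulli d q) ^ 2 := by
  rw [eLpNorm_two_sq, ofReal_integral_eq_lintegral_ofReal hh.integrable_sq
    (Eventually.of_forall fun η => sq_nonneg _)]
  refine lintegral_congr fun η => ?_
  rw [← enorm_pow, Real.enorm_of_nonneg (sq_nonneg _)]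

lemma evariance_le (q : I) {f : Config d → ℝ} (hf : MemLp f 2 (bernoulli d q)) (a : ℝ) :
    evariance f (bernoulli d q) ≤ eLpNorm (f - fun _ => a) 2 (bernoulli d q) ^ 2 := by
  have hfa : MemLp (f - fun _ => a) 2 (bernoulli d q) := hf.sub (memLp_const a)
  rw [← hf.ofReal_variance_eq, ← ofReal_integral_sq q hfa]
  apply ENNReal.ofReal_le_ofReal
  have h1 := variance_sub_const (μ := bernoulli d q) hf.1 a
  have h2 : Var[fun ω => f ω - a; bernoulli d q] ≤ ∫ η, (f η - a) ^ 2 ∂(bernoulli d q) :=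
    variance_le_expectation_sq hfa.1.aemeasurable.aestronglyMeasurable
  rw [← h1]
  exact h2

lemma siteVariance_eq (q : I) (x : Site d) (f : Config d → ℝ) (η : Config d) :
    siteVariance q x f η = ENNReal.ofReal (q * (1 - q) * grad x f η ^ 2) := by
  have hq0 := q.2.1
  have hq1 := sub_nonneg.2 q.2.2
  rw [siteVariance, evariance_eq_lintegral_ofReal, lintegral_siteMeasure, integral_siteMeasure,
    ← ENNReal.ofReal_mul hq0, ← ENNReal.ofReal_mul hq1,
    ← ENNReal.ofReal_add (by positivity) (by positivity), grad]
  congr 1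
  ring

/-- The `L²` function whose squared norm is the contribution of `x` to the Dirichlet form. -/
def conGrad (q : I) (x : Site d) (f : Config d → ℝ) (η : Config d) : ℝ :=
  Real.sqrt (q * (1 - q)) * con x η * grad x f η

lemma conGrad_sub (q : I) (x : Site d) (f g : Config d → ℝ) :
    conGrad q x (f - g) = conGrad q x f - conGrad q x g := by
  funext η; simp only [conGrad, grad, Pi.sub_apply]; ring

lemma conGrad_sq (q : I) (x : Site d) (f : Config d → ℝ) (η : Config d) :
    conGrad q x f η ^ 2 = con x η * (q * (1 - q) * grad x f η ^ 2) := by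
  have hq : 0 ≤ (q : ℝ) * (1 - q) := mul_nonneg q.2.1 (sub_nonneg.2 q.2.2)
  rw [conGrad, mul_pow, mul_pow, Real.sq_sqrt hq]
  rcases con_zero_or_one x η with h | h <;> simp [h]

lemma lintegral_con_mul_siteVariance (q : I) (x : Site d) (f : Config d → ℝ) :
    ∫⁻ η, ENNReal.ofReal (con x η) * siteVariance q x f η ∂(bernoulli d q) =
      eLpNorm (conGrad q x f) 2 (bernoulli d q) ^ 2 := by
  rw [eLpNorm_two_sq]
  refine lintegral_congr fun η => ?_
  rw [siteVariance_eq, ← ENNReal.ofReal_mul (con_nonneg x η), ← conGrad_sq, ← enorm_pow,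
    Real.enorm_of_nonneg (sq_nonneg _)]

lemma dirichletForm_eq (q : I) (f : Config d → ℝ) :
    dirichletForm (faClass d 1) q f =
      ∑' x, eLpNorm (conGrad q x f) 2 (bernoulli d q) ^ 2 :=
  tsum_congr fun x => lintegral_con_mul_siteVariance q x f

lemma IsLocal.conGrad {f : Config d → ℝ} (hf : IsLocal f) (q : I) (x : Site d) :
    IsLocal (conGrad q x f) :=
  (isLocal_con x).map₂ (hf.grad x) fun a b => Real.sqrt (q * (1 - q)) * a * b

lemma eLpNorm_conGrad_sq (q : I) (x : Site d) {f : Config d → ℝ} (hf : IsLocal f) :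
    eLpNorm (conGrad q x f) 2 (bernoulli d q) ^ 2 = ENNReal.ofReal (energy q f x) := by
  rw [← ofReal_integral_sq q ((hf.conGrad q x).memLp q 2), energy_eq q x hf, ← expect_const_mul]
  congr 1
  refine integral_congr_ae (Eventually.of_forall fun η => ?_)
  simp only [conGrad_sq, Pi.mul_apply, Pi.pow_apply]
  ring

lemma measurable_grad (x : Site d) {f : Config d → ℝ} (hf : Measurable f) :
    Measurable (grad x f) :=
  (hf.comp (measurable_update_site x 0)).sub (hf.comp (measurable_update_site x 1))

lemma measurable_conGrad (q : I) (x : Site d) {f : Config d → ℝ} (hf : Measurable f) :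
    Measurable (conGrad q x f) :=
  ((isLocal_con x).measurable.const_mul _).mul (measurable_grad x hf)

/-- Each site contributes a bounded operator on L², so finitely many terms of the Dirichlet form
pass to the limit along L² approximations. -/
lemma eLpNorm_conGrad_sq_le (q : I) (x : Site d) {f : Config d → ℝ} (hf : Measurable f) :
    eLpNorm (conGrad q x f) 2 (bernoulli d q) ^ 2 ≤ 2 * eLpNorm f 2 (bernoulli d q) ^ 2 := by
  have hq0 := q.2.1
  have hq1 := sub_nonneg.2 q.2.2
  rw [eLpNorm_two_sq, eLpNorm_two_sq]
  have hF : Measurable fun η => ENNReal.ofReal (f η ^ 2) := (hf.pow_const 2).ennreal_ofReal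
  have e : ∀ (g : Config d → ℝ) η, ‖g η‖ₑ ^ 2 = ENNReal.ofReal (g η ^ 2) := fun g η => by
    rw [← enorm_pow, Real.enorm_of_nonneg (sq_nonneg _)]
  simp only [e]
  have hm : Measurable fun η => ENNReal.ofReal (q : ℝ) *
      ENNReal.ofReal (f (Function.update η x 0) ^ 2) :=
    (hF.comp (measurable_update_site x 0)).const_mul _
  rw [← lintegral_resample q x hF, ← lintegral_const_mul' _ _ ENNReal.ofReal_ne_top,
    ← lintegral_const_mul' _ _ ENNReal.ofReal_ne_top, ← lintegral_add_left hm,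
    ← lintegral_const_mul' _ _ ENNReal.ofNat_ne_top]
  refine lintegral_mono fun η => ?_
  rw [← ENNReal.ofReal_mul hq0, ← ENNReal.ofReal_mul hq1,
    ← ENNReal.ofReal_add (by positivity) (by positivity)]
  have e2 : (2 : ℝ≥0∞) = ENNReal.ofReal 2 := by simp
  rw [e2, ← ENNReal.ofReal_mul (by norm_num), conGrad_sq, grad]
  apply ENNReal.ofReal_le_ofReal
  set a := f (Function.update η x 0)
  set b := f (Function.update η x 1)
  have h1 : con x η * (q * (1 - q) * (a - b) ^ 2) ≤ 1 * (q * (1 - q) * (a - b) ^ 2) :=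
    mul_le_mul_of_nonneg_right (con_le_one x η) (by positivity)
  have h2 : (q : ℝ) * (1 - q) * (a - b) ^ 2 ≤ 2 * (q * a ^ 2 + (1 - q) * b ^ 2) := by
    have : 2 * (q * a ^ 2 + (1 - q) * b ^ 2) - (q : ℝ) * (1 - q) * (a - b) ^ 2 =
      q * (1 - q) * (a + b) ^ 2 + 2 * (q ^ 2 * a ^ 2 + (1 - q) ^ 2 * b ^ 2) := by ring
    have h3 : 0 ≤ (q : ℝ) * (1 - q) * (a + b) ^ 2 +
      2 * (q ^ 2 * a ^ 2 + (1 - q) ^ 2 * b ^ 2) := by positivity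
    linarith
  linarith

/-- Since both states have positive probability, resampling invariance makes the law of the updated
configuration absolutely continuous. Hence the Dirichlet form, which evaluates `f` at updated
configurations, does not depend on the representative. -/
lemma ae_update (q : I) (hq0 : 0 < (q : ℝ)) (hq1 : (q : ℝ) < 1) {f g : Config d → ℝ}
    (h : f =ᵐ[bernoulli d q] g) (x : Site d) (a : Fin 2) :
    ∀ᵐ η ∂(bernoulli d q), f (Function.update η x a) = g (Function.update η x a) := by
  have hm := measurable_update_site x a
  have hac : (bernoulli d q).map (fun η => Function.update η x a) ≪ bernoulli d q := by
    intro s hs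
    rw [← bernoulli_resample q x, Measure.add_apply, Measure.smul_apply, Measure.smul_apply,
      add_eq_zero, smul_eq_mul, smul_eq_mul, mul_eq_zero, mul_eq_zero] at hs
    have h0 : ENNReal.ofReal (q : ℝ) ≠ 0 := by simpa using hq0
    have h1 : ENNReal.ofReal (1 - (q : ℝ)) ≠ 0 := by simpa using hq1
    have ha : ∀ a : Fin 2, a = 0 ∨ a = 1 := by decide
    rcases ha a with rfl | rfl
    · exact hs.1.resolve_left h0
    · exact hs.2.resolve_left h1
  exact ae_of_ae_map hm.aemeasurable (hac.ae_le h)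

lemma eLpNorm_conGrad_congr (q : I) (hq0 : 0 < (q : ℝ)) (hq1 : (q : ℝ) < 1) {f g : Config d → ℝ}
    (h : f =ᵐ[bernoulli d q] g) (x : Site d) :
    eLpNorm (conGrad q x f) 2 (bernoulli d q) = eLpNorm (conGrad q x g) 2 (bernoulli d q) := by
  refine eLpNorm_congr_ae ?_
  filter_upwards [ae_update q hq0 hq1 h x 0, ae_update q hq0 hq1 h x 1] with η h0 h1
  simp only [conGrad, grad, h0, h1]

/-! ### The generator on local functions -/

lemma localGenerator_eq (q : I) {f : Config d → ℝ} {S : Finset (Site d)}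
    (hS : ∀ x ∉ S, Free x f) :
    localGenerator (faClass d 1) q f = fun η => ∑ x ∈ S, (con x * (avg q x f - f)) η := by
  funext η
  rw [localGenerator]
  have e : ∀ x, constraint (faClass d 1) x η *
      ((∫ s, f (Function.update η x s) ∂(siteMeasure q)) - f η) = (con x * (avg q x f - f)) η := by
    intro x
    rw [integral_siteMeasure]; rfl
  simp only [e]
  refine finsum_eq_sum_of_support_subset _ fun x hx => ?_
  by_contra hxS
  apply hx
  simp [(hS x hxS).avg_eq q]

lemma IsLocal.localGenerator {f : Config d → ℝ} (hf : IsLocal f) (q : I) :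
    IsLocal (localGenerator (faClass d 1) q f) := by
  obtain ⟨S, hS⟩ := hf.exists_free
  rw [localGenerator_eq q hS]
  exact IsLocal.sum S fun x _ => (isLocal_con x).mul ((hf.avg q x).sub hf)

lemma localGenerator_sub (q : I) {f g : Config d → ℝ} (hf : IsLocal f) (hg : IsLocal g) :
    localGenerator (faClass d 1) q (f - g) =
      localGenerator (faClass d 1) q f - localGenerator (faClass d 1) q g := by
  classical
  obtain ⟨S, hS⟩ := hf.exists_free
  obtain ⟨T, hT⟩ := hg.exists_free
  have h1 : ∀ x ∉ S ∪ T, Free x f := fun x hx => hS x fun h => hx (Finset.mem_union_left _ h)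
  have h2 : ∀ x ∉ S ∪ T, Free x g := fun x hx => hT x fun h => hx (Finset.mem_union_right _ h)
  rw [localGenerator_eq q h1, localGenerator_eq q h2,
    localGenerator_eq q fun x hx => (h1 x hx).sub (h2 x hx)]
  funext η
  rw [Pi.sub_apply, ← Finset.sum_sub_distrib]
  refine Finset.sum_congr rfl fun x _ => ?_
  simp only [map_sub, Pi.mul_apply, Pi.sub_apply]
  ring

lemma energy_of_free (q : I) {f : Config d → ℝ} {x : Site d} (h : Free x f) :
    energy q f x = 0 := by
  have : con x * (f - avg q x f) ^ 2 = fun _ => 0 := by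
    funext η; simp [h.avg_eq q]
  rw [energy, this, expect_const]

/-- Reversibility: averaging `f * (avg q x f - f)` over the state of `x` gives minus the variance at
`x`, so the right-hand side is the sum of all the energies. -/
lemma sum_energy_le (q : I) {f : Config d → ℝ} (hf : IsLocal f) (V : Finset (Site d)) :
    ∑ x ∈ V, energy q f x ≤ -expect q (f * localGenerator (faClass d 1) q f) := by
  classical
  obtain ⟨S, hS⟩ := hf.exists_free
  have hL : ∀ x, IsLocal (f * (con x * (avg q x f - f))) := fun x =>
    hf.mul ((isLocal_con x).mul ((hf.avg q x).sub hf))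
  have e1 : f * localGenerator (faClass d 1) q f =
      fun η => ∑ x ∈ S, (f * (con x * (avg q x f - f))) η := by
    rw [localGenerator_eq q hS]
    funext η
    simp only [Pi.mul_apply, Finset.mul_sum]
  have e2 : ∀ x, expect q (f * (con x * (avg q x f - f))) = -energy q f x := by
    intro x
    rw [energy_eq q x hf, ← expect_avg q x (hL x), mul_left_comm, (free_con x).avg_mul,
      ← neg_mul, ← expect_const_mul]
    congr 1
    funext η
    simp only [Pi.mul_apply, avg_apply, Pi.sub_apply, Pi.pow_apply, grad, Function.update_idem]
    ring
  rw [e1, expect_sum q S fun x _ => hL x]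
  simp only [e2, Finset.sum_neg_distrib, neg_neg]
  have h1 : ∑ x ∈ V, energy q f x ≤ ∑ x ∈ V ∪ S, energy q f x :=
    Finset.sum_le_sum_of_subset_of_nonneg Finset.subset_union_left
      fun x _ _ => energy_nonneg q f x
  have h2 : ∑ x ∈ S, energy q f x = ∑ x ∈ V ∪ S, energy q f x :=
    Finset.sum_subset Finset.subset_union_right fun x _ hx => energy_of_free q (hS x hx)
  linarith

/-- From `-f L f ≤ f² + (L f)²`: the energy is controlled by the graph norm of the generator. -/
lemma sum_energy_le_norms (q : I) {f : Config d → ℝ} (hf : IsLocal f) (V : Finset (Site d)) :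
    ENNReal.ofReal (∑ x ∈ V, energy q f x) ≤ eLpNorm f 2 (bernoulli d q) ^ 2 +
      eLpNorm (localGenerator (faClass d 1) q f) 2 (bernoulli d q) ^ 2 := by
  have hL := hf.localGenerator q
  rw [← ofReal_integral_sq q (hf.memLp q 2), ← ofReal_integral_sq q (hL.memLp q 2),
    ← ENNReal.ofReal_add (integral_nonneg fun _ => sq_nonneg _)
      (integral_nonneg fun _ => sq_nonneg _)]
  apply ENNReal.ofReal_le_ofReal
  refine (sum_energy_le q hf V).trans ?_
  have h := expect_mono q ((hf.mul hL).map (fun a => (-1) * a)) ((hf.pow 2).add (hL.pow 2))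
    (fun η => by
      simp only [Pi.mul_apply, Pi.add_apply, Pi.pow_apply]
      nlinarith [sq_nonneg (f η + localGenerator (faClass d 1) q f η), sq_nonneg (f η),
        sq_nonneg (localGenerator (faClass d 1) q f η)])
  rw [expect_const_mul, expect_add q (hf.pow 2) (hL.pow 2)] at h
  have e : ∀ g : Config d → ℝ, expect q (g ^ 2) = ∫ η, g η ^ 2 ∂(bernoulli d q) := fun g => rfl
  rw [e, e] at h
  linarith

/-! ### From local functions to the domain of the generator -/

lemma eLpNorm_conGrad_le (q : I) (x : Site d) {f : Config d → ℝ} (hf : Measurable f) :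
    eLpNorm (conGrad q x f) 2 (bernoulli d q) ≤ 2 * eLpNorm f 2 (bernoulli d q) := by
  rw [← ENNReal.pow_le_pow_left_iff (n := 2) two_ne_zero]
  refine (eLpNorm_conGrad_sq_le q x hf).trans ?_
  rw [mul_pow]
  gcongr
  norm_num

lemma eLpNorm_sub_le_add {q : I} {f g h : Config d → ℝ}
    (hf : AEStronglyMeasurable f (bernoulli d q)) (hg : AEStronglyMeasurable g (bernoulli d q))
    (hh : AEStronglyMeasurable h (bernoulli d q)) :
    eLpNorm (f - g) 2 (bernoulli d q) ≤
      eLpNorm (f - h) 2 (bernoulli d q) + eLpNorm (g - h) 2 (bernoulli d q) := by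
  have e : f - g = (f - h) - (g - h) := by abel
  rw [e]
  exact eLpNorm_sub_le (hf.sub hh) (hg.sub hh) (by norm_num)

/-- Outside `X` the function `v` is its own average, so `u` and `u - v` have the same energy there.
-/
lemma sum_energy_le_of_free (q : I) {u v : Config d → ℝ} (V : Finset (Site d))
    {X : Finset (Site d)} (hX : ∀ x ∉ X, Free x v) :
    ∑ x ∈ V, energy q u x ≤ ∑ x ∈ X, energy q u x + ∑ x ∈ V, energy q (u - v) x := by
  classical
  have h1 : ∑ x ∈ V \ X, energy q u x ≤ ∑ x ∈ V, energy q (u - v) x := by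
    have : ∀ x ∈ V \ X, energy q u x = energy q (u - v) x := by
      intro x hx
      have hfree := (hX x (Finset.mem_sdiff.1 hx).2).avg_eq q
      have e : (u - v) - avg q x (u - v) = u - avg q x u := by
        rw [map_sub, hfree]; abel
      rw [energy, energy, e]
    rw [Finset.sum_congr rfl this]
    exact Finset.sum_le_sum_of_subset_of_nonneg Finset.sdiff_subset
      fun x _ _ => energy_nonneg q _ x
  have h2 : ∑ x ∈ V, energy q u x ≤ ∑ x ∈ X ∪ V \ X, energy q u x :=
    Finset.sum_le_sum_of_subset_of_nonneg (fun x hx => by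
      by_cases hxX : x ∈ X <;> simp [hx, hxX]) fun x _ _ => energy_nonneg q _ x
  rw [Finset.sum_union Finset.disjoint_sdiff] at h2
  linarith

/-- L² convergence `u n → f` alone would only bound the Dirichlet form of `f` by those of the `u n`,
whereas the converse is needed. Convergence of the generators supplies it: inside the finite support
`X` of some `u m` the energies converge, and outside `X` the energy of `u n` equals that of `u n - u
m`, which is small in graph norm. -/
lemma poincare_of_local (q : I) (hq0 : 0 < (q : ℝ)) (hq1 : (q : ℝ) < 1) {c : ℝ} (hc0 : 0 < c)
    (hc : ∀ f : Config d → ℝ, IsLocal f → ∃ V : Finset (Site d),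
      c * expect q ((f - fun _ => expect q f) ^ 2) ≤ ∑ x ∈ V, energy q f x)
    {f : Config d → ℝ} (hf : f ∈ generatorDomain (faClass d 1) q) :
    ENNReal.ofReal c * evariance f (bernoulli d q) ≤ dirichletForm (faClass d 1) q f := by
  obtain ⟨g, hf2, hg2, u, hu, hu1, hu2⟩ := hf
  obtain ⟨f', hf'm, hff'⟩ : ∃ f', Measurable f' ∧ f =ᵐ[bernoulli d q] f' :=
    ⟨hf2.1.aemeasurable.mk f, hf2.1.aemeasurable.measurable_mk, hf2.1.aemeasurable.ae_eq_mk⟩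
  have hf'2 : MemLp f' 2 (bernoulli d q) := hf2.ae_eq hff'
  rw [dirichletForm_eq, evariance_congr hff']
  simp only [eLpNorm_conGrad_congr q hq0 hq1 hff']
  set N : (Config d → ℝ) → ℝ≥0∞ := fun h => eLpNorm h 2 (bernoulli d q) with hN
  set a : ℕ → ℝ≥0∞ := fun n => N (u n - f') with ha
  set b : ℕ → ℝ≥0∞ := fun n => N (localGenerator (faClass d 1) q (u n) - g) with hb
  have ha0 : Tendsto a atTop (𝓝 0) := by
    refine hu1.congr fun n => eLpNorm_congr_ae ?_
    filter_upwards [hff'] with η hη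
    simp [hη]
  have hb0 : Tendsto b atTop (𝓝 0) := hu2
  have hum : ∀ n, AEStronglyMeasurable (u n) (bernoulli d q) := fun n =>
    (hu n).measurable.aestronglyMeasurable
  have hLm : ∀ n, AEStronglyMeasurable (localGenerator (faClass d 1) q (u n)) (bernoulli d q) :=
    fun n => ((hu n).localGenerator q).measurable.aestronglyMeasurable
  have hpair : ∀ {s : ℕ → ℝ≥0∞}, Tendsto s atTop (𝓝 0) →
      Tendsto (fun p : ℕ × ℕ => (s p.1 + s p.2) ^ 2) (atTop ×ˢ atTop) (𝓝 0) := by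
    intro s hs
    have := ENNReal.Tendsto.pow (n := 2) ((hs.comp tendsto_fst).add (hs.comp tendsto_snd))
      (f := atTop ×ˢ atTop)
    simpa using this
  refine ENNReal.le_of_forall_pos_le_add fun ε hε _ => ?_
  -- The index `m` and its support `X` are fixed before `n` tends to infinity; `ε` bounds the energy
  -- of `u n - u m` for every `n ≥ m`.
  obtain ⟨m, X, hX, hm⟩ : ∃ (m : ℕ) (X : Finset (Site d)), (∀ x ∉ X, Free x (u m)) ∧
      ∀ n ≥ m, (a n + a m) ^ 2 + (b n + b m) ^ 2 ≤ ε := by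
    have h := (hpair ha0).add (hpair hb0)
    rw [add_zero] at h
    have hev := h.eventually_le_const (ENNReal.coe_pos.2 hε)
    rw [prod_atTop_atTop_eq, eventually_atTop] at hev
    obtain ⟨⟨m1, m2⟩, hm⟩ := hev
    obtain ⟨X, hX⟩ := (hu (max m1 m2)).exists_free
    exact ⟨max m1 m2, X, hX, fun n hn => hm (n, max m1 m2)
      ⟨(le_max_left _ _).trans hn, le_max_right _ _⟩⟩
  set R : ℕ → ℝ≥0∞ := fun n => ∑ x ∈ X, (N (conGrad q x f') + 2 * a n) ^ 2 + ε with hR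
  have hmain : ∀ n ≥ m, N (u n - fun _ => expect q (u n)) ^ 2 ≤ (ENNReal.ofReal c)⁻¹ * R n := by
    intro n hn
    obtain ⟨V, hV⟩ := hc (u n) (hu n)
    have hloc : IsLocal (u n - fun _ => expect q (u n)) := (hu n).sub (isLocal_const _)
    have h1 : N (u n - fun _ => expect q (u n)) ^ 2 =
        ENNReal.ofReal (expect q ((u n - fun _ => expect q (u n)) ^ 2)) :=
      (ofReal_integral_sq q (hloc.memLp q 2)).symm
    have hc' : ENNReal.ofReal c ≠ 0 := by simpa using hc0
    rw [← ENNReal.mul_le_iff_le_inv hc' ENNReal.ofReal_ne_top, h1, ← ENNReal.ofReal_mul hc0.le]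
    have h2 := hV.trans (sum_energy_le_of_free q (u := u n) V hX)
    refine (ENNReal.ofReal_le_ofReal h2).trans ?_
    refine ENNReal.ofReal_add_le.trans (add_le_add ?_ ?_)
    · rw [ENNReal.ofReal_sum_of_nonneg fun x _ => energy_nonneg q _ x]
      refine Finset.sum_le_sum fun x _ => ?_
      rw [← eLpNorm_conGrad_sq q x (hu n)]
      gcongr
      have e : conGrad q x (u n) = conGrad q x f' + conGrad q x (u n - f') := by
        rw [conGrad_sub]; abel
      rw [e]
      have hum' : Measurable (u n - f') := (hu n).measurable.sub hf'm
      refine (eLpNorm_add_le (measurable_conGrad q x hf'm).aestronglyMeasurable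
        (measurable_conGrad q x hum').aestronglyMeasurable (by norm_num)).trans ?_
      exact add_le_add le_rfl (eLpNorm_conGrad_le q x hum')
    · refine (sum_energy_le_norms q ((hu n).sub (hu m)) V).trans (le_trans ?_ (hm n hn))
      rw [localGenerator_sub q (hu n) (hu m)]
      gcongr
      · exact eLpNorm_sub_le_add (hum n) (hum m) hf'm.aestronglyMeasurable
      · exact eLpNorm_sub_le_add (hLm n) (hLm m) hg2.1
  have hvar : ∀ n ≥ m, evariance f' (bernoulli d q) ≤
      (a n + ((ENNReal.ofReal c)⁻¹ * R n) ^ (1 / 2 : ℝ)) ^ 2 := by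
    intro n hn
    refine (evariance_le q hf'2 (expect q (u n))).trans ?_
    gcongr
    have e : f' - (fun _ => expect q (u n)) = (f' - u n) + (u n - fun _ => expect q (u n)) := by
      abel
    rw [e]
    refine (eLpNorm_add_le (hf'm.aestronglyMeasurable.sub (hum n))
      ((hum n).sub aestronglyMeasurable_const) (by norm_num)).trans (add_le_add ?_ ?_)
    · rw [eLpNorm_sub_comm]
    · rw [one_div, ENNReal.le_rpow_inv_iff (by norm_num)]
      have := hmain n hn
      simpa using this
  have hRlim : Tendsto R atTop (𝓝 (∑ x ∈ X, N (conGrad q x f') ^ 2 + ε)) := by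
    refine Tendsto.add (tendsto_finsetSum _ fun x _ => ?_) tendsto_const_nhds
    have h2a : Tendsto (fun n => 2 * a n) atTop (𝓝 0) := by
      have := ENNReal.Tendsto.const_mul ha0 (a := 2) (Or.inr (by simp))
      simpa using this
    have := ENNReal.Tendsto.pow (n := 2)
      ((tendsto_const_nhds (x := N (conGrad q x f'))).add h2a)
    simpa using this
  have hcinv : (ENNReal.ofReal c)⁻¹ ≠ ∞ := by
    rw [ENNReal.inv_ne_top]; simpa using hc0
  have hlim : Tendsto (fun n => (a n + ((ENNReal.ofReal c)⁻¹ * R n) ^ (1 / 2 : ℝ)) ^ 2) atTop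
      (𝓝 ((ENNReal.ofReal c)⁻¹ * (∑ x ∈ X, N (conGrad q x f') ^ 2 + ε))) := by
    have h1 := ENNReal.Tendsto.const_mul hRlim (a := (ENNReal.ofReal c)⁻¹) (Or.inr hcinv)
    have h2 := (ENNReal.continuous_rpow_const (y := (1 / 2 : ℝ))).continuousAt.tendsto.comp h1
    have h3 := ENNReal.Tendsto.pow (n := 2) (ha0.add h2)
    rw [zero_add, ← ENNReal.rpow_natCast, ← ENNReal.rpow_mul] at h3
    simpa using h3
  have hfin := ge_of_tendsto hlim (eventually_atTop.2 ⟨m, hvar⟩)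
  rw [← ENNReal.mul_le_iff_le_inv (by simpa using hc0) ENNReal.ofReal_ne_top] at hfin
  exact hfin.trans (add_le_add (ENNReal.sum_le_tsum X) le_rfl)

lemma le_gap (q : I) (hq0 : 0 < (q : ℝ)) (hq1 : (q : ℝ) < 1) {c : ℝ} (hc0 : 0 < c)
    (hc : ∀ f : Config d → ℝ, IsLocal f → ∃ V : Finset (Site d),
      c * expect q ((f - fun _ => expect q f) ^ 2) ≤ ∑ x ∈ V, energy q f x) :
    ENNReal.ofReal c ≤ gap (faClass d 1) q := by
  refine le_iInf₂ fun f hf => ?_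
  have hfin : evariance f (bernoulli d q) ≠ ∞ := by
    obtain ⟨g, hf2, _⟩ := hf.1
    exact hf2.evariance_ne_top
  rw [ENNReal.le_div_iff_mul_le (Or.inl hf.2) (Or.inl hfin)]
  exact poincare_of_local q hq0 hq1 hc0 hc hf.1

lemma gap_le (q : I) {f : Config d → ℝ} (hf : IsLocal f) {S : Finset (Site d)}
    (hS : ∀ x ∉ S, Free x f) {v D : ℝ} (hv : 0 < v)
    (hvar : v ≤ expect q ((f - fun _ => expect q f) ^ 2)) (hD : ∑ x ∈ S, energy q f x ≤ D) :
    gap (faClass d 1) q ≤ ENNReal.ofReal (D / v) := by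
  have hL := hf.localGenerator q
  have hdom : f ∈ generatorDomain (faClass d 1) q :=
    ⟨localGenerator (faClass d 1) q f, hf.memLp q 2, hL.memLp q 2, fun _ => f, fun _ => hf,
      by simp, by simp⟩
  have hvar' : ENNReal.ofReal v ≤ evariance f (bernoulli d q) := by
    rw [← (hf.memLp q 2).ofReal_variance_eq,
      variance_eq_integral (hf.memLp q 2).1.aemeasurable]
    exact ENNReal.ofReal_le_ofReal hvar
  have hv0 : 0 < ENNReal.ofReal v := by simpa using hv
  refine (iInf₂_le f ⟨hdom, (hv0.trans_le hvar').ne'⟩).trans ?_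
  rw [ENNReal.ofReal_div_of_pos hv]
  refine ENNReal.div_le_div ?_ hvar'
  rw [dirichletForm_eq, tsum_eq_sum (s := S)]
  · simp only [eLpNorm_conGrad_sq q _ hf]
    rw [← ENNReal.ofReal_sum_of_nonneg fun x _ => energy_nonneg q f x]
    exact ENNReal.ofReal_le_ofReal hD
  · intro x hx
    rw [eLpNorm_conGrad_sq q x hf, energy_of_free q (hS x hx), ENNReal.ofReal_zero]

/-! ### Upper bound on the gap -/

/-- The `ℓ^∞` ball of radius `k` around the origin. -/
def ball (d k : ℕ) : Finset (Site d) := Fintype.piFinset fun _ => Finset.Icc (-(k : ℤ)) k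

lemma mem_ball_iff {k : ℕ} {x : Site d} : x ∈ ball d k ↔ supDist 0 x ≤ k := by
  rw [ball, Fintype.mem_piFinset]
  constructor
  · intro h
    refine supDist_le fun i => ?_
    have := Finset.mem_Icc.1 (h i)
    simp only [Pi.zero_apply, sub_zero]; omega
  · intro h i
    have := natAbs_le_supDist 0 x i
    simp only [Pi.zero_apply, sub_zero] at this
    rw [Finset.mem_Icc]; omega

lemma ball_mono {j k : ℕ} (h : j ≤ k) : ball d j ⊆ ball d k := fun _ hx =>
  mem_ball_iff.2 ((mem_ball_iff.1 hx).trans h)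

lemma card_ball (k : ℕ) : (ball d k).card = (2 * k + 1) ^ d := by
  rw [ball, Fintype.card_piFinset]
  simp only [Int.card_Icc, Finset.prod_const, Finset.card_univ, Fintype.card_fin]
  congr 1
  omega

lemma expect_one_sub_someEmp (q : I) (S : Finset (Site d)) :
    expect q (1 - someEmp S) = (1 - (q : ℝ)) ^ S.card := by
  have l : IsLocal (1 - someEmp S) := (isLocal_const 1).sub (isLocal_someEmp S)
  rw [← expect_avgOn q (S := S) l]
  have : avgOn q S (1 - someEmp S) = fun _ => (1 - (q : ℝ)) ^ S.card :=
    funext (avgOn_one_sub_someEmp q S)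
  rw [this, expect_const]

lemma expect_emp (q : I) (y : Site d) : expect q (emp y) = q := by
  rw [← expect_avg q y (isLocal_emp y)]
  have : avg q y (emp y) = fun _ => (q : ℝ) := by
    funext η; rw [avg_apply, emp_update_zero, emp_update_one]; ring
  rw [this, expect_const]

/-- The distance from the origin to the closest empty site, truncated at `R`. -/
def gapDist (d R : ℕ) (η : Config d) : ℝ := ∑ k ∈ Finset.range R, (1 - someEmp (ball d k) η)

lemma isLocal_gapDist (R : ℕ) : IsLocal (gapDist d R) :=
  IsLocal.sum _ fun k _ => (isLocal_const 1).sub (isLocal_someEmp (ball d k))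

lemma free_gapDist {R : ℕ} {x : Site d} (hx : x ∉ ball d R) : Free x (gapDist d R) := by
  intro η a
  refine Finset.sum_congr rfl fun k hk => ?_
  rw [free_someEmp fun h => hx (ball_mono (Finset.mem_range.1 hk).le h)]

lemma someEmp_eq_one {A : Finset (Site d)} {η : Config d} (h : ∃ z ∈ A, η z = 0) :
    someEmp A η = 1 := if_pos h

/-- An empty neighbour of `x` lies in every ball of radius larger than `supDist 0 x`, and smaller
balls do not contain `x`. So a legal flip of `x` affects at most one term of `gapDist`. -/
lemma con_mul_grad_gapDist_sq_le (R : ℕ) (x : Site d) (η : Config d) :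
    con x η * grad x (gapDist d R) η ^ 2 ≤ con x η := by
  classical
  rw [con_eq]
  split_ifs with h
  · obtain ⟨y, hy, hy0⟩ := h
    have hyx : y ≠ x := by rintro rfl; exact not_mem_neighbors_self _ hy
    have hyn : supDist 0 y ≤ supDist 0 x + 1 := by
      refine supDist_le fun i => ?_
      have h1 := natAbs_le_supDist 0 x i
      have h2 := Finset.mem_Icc.1 ((Fintype.mem_piFinset.1 (mem_unitBox_of_mem_neighbors hy)) i)
      simp only [Pi.zero_apply, sub_zero] at h1 ⊢
      omega
    have hterm : ∀ k, |(1 - someEmp (ball d k) (Function.update η x 0)) -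
        (1 - someEmp (ball d k) (Function.update η x 1))| ≤
        if k = supDist 0 x then 1 else 0 := by
      intro k
      split_ifs with hk
      · rcases someEmp_zero_or_one (ball d k) (Function.update η x 0) with e | e <;>
        rcases someEmp_zero_or_one (ball d k) (Function.update η x 1) with e' | e' <;>
        norm_num [e, e']
      · rcases lt_or_gt_of_ne hk with hlt | hgt
        · have hx : x ∉ ball d k := fun h => by rw [mem_ball_iff] at h; omega
          rw [free_someEmp hx, free_someEmp hx]; simp
        · have hyk : y ∈ ball d k := mem_ball_iff.2 (by omega)
          have e : ∀ a, someEmp (ball d k) (Function.update η x a) = 1 := fun a =>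
            someEmp_eq_one ⟨y, hyk, by rw [Function.update_of_ne hyx, hy0]⟩
          rw [e, e]; simp
    have habs : |grad x (gapDist d R) η| ≤ 1 := by
      rw [grad, gapDist, gapDist, ← Finset.sum_sub_distrib]
      refine (Finset.abs_sum_le_sum_abs _ _).trans ?_
      refine (Finset.sum_le_sum fun k _ => hterm k).trans ?_
      rw [Finset.sum_ite_eq']
      split_ifs <;> norm_num
    rw [one_mul]
    exact (sq_le_one_iff_abs_le_one _).2 habs
  · simp

/-- One factor `q` is the variance at `x`, the other bounds the probability of an empty neighbour.
-/
lemma energy_gapDist_le (q : I) (R : ℕ) (x : Site d) :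
    energy q (gapDist d R) x ≤ 3 ^ d * (q : ℝ) ^ 2 := by
  classical
  have hq0 := q.2.1
  have hq1 := sub_nonneg.2 q.2.2
  rw [energy_eq q x (isLocal_gapDist R)]
  have h1 : expect q (con x * grad x (gapDist d R) ^ 2) ≤ expect q (con x) :=
    expect_mono q ((isLocal_con x).mul (((isLocal_gapDist R).grad x).pow 2)) (isLocal_con x)
      fun η => con_mul_grad_gapDist_sq_le R x η
  have h2 : expect q (con x) ≤ ∑ y ∈ (unitBox x).erase x, expect q (emp y) := by
    rw [← expect_sum q _ fun y _ => isLocal_emp y]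
    exact expect_mono q (isLocal_con x) (IsLocal.sum _ fun y _ => isLocal_emp y)
      fun η => con_le_sum x η
  simp only [expect_emp, Finset.sum_const, nsmul_eq_mul] at h2
  have h3 : (((unitBox x).erase x).card : ℝ) ≤ 3 ^ d := by
    have := Finset.card_le_card (Finset.erase_subset x (unitBox x))
    rw [card_unitBox] at this
    exact_mod_cast this
  have h4 : (0 : ℝ) ≤ expect q (con x) := expect_nonneg q (con_nonneg x)
  calc (q : ℝ) * (1 - q) * expect q (con x * grad x (gapDist d R) ^ 2)
      ≤ q * (1 - q) * expect q (con x) := by gcongr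
    _ ≤ q * 1 * expect q (con x) := by
        gcongr; linarith
    _ ≤ q * 1 * (3 ^ d * q) := by
        gcongr; exact h2.trans (by gcongr)
    _ = _ := by ring

/-- The function equals `2 r` if the ball of radius `2 r` has no vacancy, and is at most `r` if the
ball of radius `r` has one. Both events have probability at least `p`, and whichever side of `3 r /
2` the mean lies on, one of them forces a deviation of at least `r / 2`. -/
lemma variance_gapDist_ge (q : I) (r : ℕ) {p : ℝ}
    (hp1 : p ≤ (1 - (q : ℝ)) ^ ((4 * r + 1) ^ d)) (hp2 : p ≤ 1 - (1 - (q : ℝ)) ^ ((2 * r + 1) ^ d)) :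
    p * (r / 2) ^ 2 ≤
      expect q ((gapDist d (2 * r) - fun _ => expect q (gapDist d (2 * r))) ^ 2) := by
  set f := gapDist d (2 * r) with hf
  set m := expect q f with hm
  have lf : IsLocal f := isLocal_gapDist _
  have lfm : IsLocal ((f - fun _ => m) ^ 2) := (lf.sub (isLocal_const m)).pow 2
  have hb : ∀ χ : Config d → ℝ, IsLocal χ → (∀ η, χ η = 0 ∨ χ η = 1) → p ≤ expect q χ →
      (∀ η, χ η = 1 → ((r : ℝ) / 2) ^ 2 ≤ (f η - m) ^ 2) →
      p * (r / 2) ^ 2 ≤ expect q ((f - fun _ => m) ^ 2) := by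
    intro χ lχ h01 hp h
    calc p * (r / 2) ^ 2 ≤ (r / 2) ^ 2 * expect q χ := by rw [mul_comm]; gcongr
      _ = expect q (fun η => ((r : ℝ) / 2) ^ 2 * χ η) := (expect_const_mul q _ _).symm
      _ ≤ _ := by
        refine expect_mono q (lχ.map _) lfm fun η => ?_
        simp only [Pi.pow_apply, Pi.sub_apply]
        rcases h01 η with e | e
        · rw [e, mul_zero]; positivity
        · rw [e, mul_one]; exact h η e
  rcases le_total m (3 * r / 2) with hmr | hmr
  · refine hb (1 - someEmp (ball d (2 * r))) ((isLocal_const 1).sub (isLocal_someEmp _)) ?_ ?_ ?_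
    · intro η
      simp only [Pi.sub_apply, Pi.one_apply]
      rcases someEmp_zero_or_one (ball d (2 * r)) η with e | e <;> simp [e]
    · rw [expect_one_sub_someEmp, card_ball]
      convert hp1 using 3; ring
    · intro η h
      have h0 : someEmp (ball d (2 * r)) η = 0 := by
        simp only [Pi.sub_apply, Pi.one_apply] at h; linarith
      have hfη : f η = 2 * r := by
        rw [hf, gapDist]
        have : ∀ k ∈ Finset.range (2 * r), 1 - someEmp (ball d k) η = 1 := by
          intro k hk
          have h1 := someEmp_mono (ball_mono (d := d) (Finset.mem_range.1 hk).le) η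
          have h2 := someEmp_nonneg (ball d k) η
          linarith
        rw [Finset.sum_congr rfl this]; simp
      rw [hfη]
      have : (0 : ℝ) ≤ r := by positivity
      gcongr; linarith
  · refine hb (someEmp (ball d r)) (isLocal_someEmp _) (someEmp_zero_or_one _) ?_ ?_
    · have h := expect_sub q (isLocal_const 1) (isLocal_someEmp (ball d r))
      have e : (fun _ : Config d => (1 : ℝ)) - someEmp (ball d r) = 1 - someEmp (ball d r) := rfl
      rw [e, expect_one_sub_someEmp, card_ball, expect_const] at h
      linarith
    · intro η h
      have hfη : f η ≤ r := by
        rw [hf, gapDist]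
        have h1 : ∀ k ∈ Finset.range (2 * r), 1 - someEmp (ball d k) η ≤
            if k < r then 1 else 0 := by
          intro k _
          split_ifs with hk
          · linarith [someEmp_nonneg (ball d k) η]
          · have := someEmp_mono (ball_mono (d := d) (not_lt.1 hk)) η
            linarith
        refine (Finset.sum_le_sum h1).trans ?_
        rw [← Finset.sum_filter, Finset.sum_const, nsmul_eq_mul, mul_one]
        have : ((Finset.range (2 * r)).filter (· < r)).card ≤ r := by
          refine (Finset.card_le_card (t := Finset.range r) fun k hk => ?_).trans
            (Finset.card_range r).le
          exact Finset.mem_range.2 (Finset.mem_filter.1 hk).2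
        exact_mod_cast this
      have : (0 : ℝ) ≤ r := by positivity
      have h2 : (m - f η) ^ 2 = (f η - m) ^ 2 := by ring
      rw [← h2]
      gcongr; linarith

/-- A dimensional constant: lower bound for the probability of a large ball without empty sites. -/
def voidProb (d : ℕ) : ℝ := Real.exp (-(2 * 10 ^ d))

lemma gap_le_of_le_half (hd : 1 ≤ d) (q : I) (hq0 : 0 < (q : ℝ)) (hq : (q : ℝ) ≤ 1 / 2) :
    gap (faClass d 1) q ≤
      ENNReal.ofReal (4 * 30 ^ d / voidProb d * (q : ℝ) ^ (1 + 2 / (d : ℝ))) := by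
  have hd0 : (d : ℝ) ≠ 0 := by positivity
  set y : ℝ := (1 / (q : ℝ)) ^ ((d : ℝ)⁻¹) with hy
  have h1q : 1 ≤ 1 / (q : ℝ) := by rw [le_div_iff₀ hq0]; linarith
  have hy1 : 1 ≤ y := Real.one_le_rpow h1q (by positivity)
  have hyd : y ^ d = 1 / q := by
    rw [hy, ← Real.rpow_natCast, ← Real.rpow_mul (by positivity), inv_mul_cancel₀ hd0,
      Real.rpow_one]
  set r := ⌈y⌉₊ with hr
  have hyr : y ≤ r := Nat.le_ceil y
  have hr1 : (1 : ℝ) ≤ r := hy1.trans hyr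
  have hr2 : (r : ℝ) ≤ 2 * y := by
    have := Nat.ceil_lt_add_one (by linarith : 0 ≤ y)
    linarith
  have hn : (((4 * r + 1) ^ d : ℕ) : ℝ) ≤ 10 ^ d / q := by
    push_cast
    calc (4 * (r : ℝ) + 1) ^ d ≤ (10 * y) ^ d :=
          pow_le_pow_left₀ (by positivity) (by linarith) d
      _ = 10 ^ d / q := by rw [mul_pow, hyd]; ring
  have hp0 : 0 < voidProb d := Real.exp_pos _
  have he : Real.exp (-1) ≤ 1 / 2 := by
    rw [Real.exp_neg, one_div]
    exact inv_anti₀ (by norm_num) (by linarith [Real.add_one_le_exp (1 : ℝ)])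
  have hp1 : voidProb d ≤ (1 - (q : ℝ)) ^ ((4 * r + 1) ^ d) := by
    -- For `q ≤ 1/2` this follows from `(1 + 2 q) (1 - q) ≥ 1`.
    have h1 : Real.exp (-(2 * q)) ≤ 1 - q := by
      rw [Real.exp_neg]
      have h2 := Real.add_one_le_exp (2 * (q : ℝ))
      calc (Real.exp (2 * q))⁻¹ ≤ (2 * (q : ℝ) + 1)⁻¹ := inv_anti₀ (by positivity) h2
        _ ≤ 1 - q := by
          rw [inv_le_iff_one_le_mul₀ (by positivity)]; nlinarith
    calc voidProb d ≤ Real.exp (-(2 * q)) ^ ((4 * r + 1) ^ d) := by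
          rw [← Real.exp_nat_mul, voidProb]
          apply Real.exp_le_exp.2
          rw [le_div_iff₀ hq0] at hn
          linarith
      _ ≤ _ := pow_le_pow_left₀ (Real.exp_pos _).le h1 _
  have hp2 : voidProb d ≤ 1 - (1 - (q : ℝ)) ^ ((2 * r + 1) ^ d) := by
    have h1 : voidProb d ≤ 1 / 2 := by
      refine le_trans (Real.exp_le_exp.2 ?_) he
      have : (1 : ℝ) ≤ 10 ^ d := one_le_pow₀ (by norm_num)
      linarith
    have h2 : (1 - (q : ℝ)) ^ ((2 * r + 1) ^ d) ≤ Real.exp (-q) ^ ((2 * r + 1) ^ d) :=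
      pow_le_pow_left₀ (by linarith) (by linarith [Real.add_one_le_exp (-(q : ℝ))]) _
    have h3 : 1 / (q : ℝ) ≤ (((2 * r + 1) ^ d : ℕ) : ℝ) := by
      push_cast
      rw [← hyd]
      exact pow_le_pow_left₀ (by linarith) (by linarith) d
    rw [div_le_iff₀ hq0] at h3
    rw [← Real.exp_nat_mul] at h2
    have h4 : Real.exp ((((2 * r + 1) ^ d : ℕ) : ℝ) * -q) ≤ Real.exp (-1) :=
      Real.exp_le_exp.2 (by linarith)
    linarith
  have hvar := variance_gapDist_ge q r hp1 hp2
  have hv : 0 < voidProb d * ((r : ℝ) / 2) ^ 2 := by positivity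
  have hD : ∑ x ∈ ball d (2 * r), energy q (gapDist d (2 * r)) x ≤ 30 ^ d * q := by
    refine (Finset.sum_le_sum fun x _ => energy_gapDist_le q (2 * r) x).trans ?_
    rw [Finset.sum_const, card_ball, nsmul_eq_mul, show 2 * (2 * r) + 1 = 4 * r + 1 by ring]
    calc (((4 * r + 1) ^ d : ℕ) : ℝ) * (3 ^ d * (q : ℝ) ^ 2)
        ≤ 10 ^ d / q * (3 ^ d * (q : ℝ) ^ 2) := by gcongr
      _ = (10 * 3) ^ d * (q : ℝ) := by rw [mul_pow]; field_simp
      _ = _ := by norm_num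
  refine (gap_le q (isLocal_gapDist (2 * r)) (fun x hx => free_gapDist hx) hv hvar hD).trans ?_
  apply ENNReal.ofReal_le_ofReal
  have hy2 : (q : ℝ) ^ (1 + 2 / (d : ℝ)) = q / y ^ 2 := by
    have e : y ^ 2 = ((q : ℝ) ^ (2 / (d : ℝ)))⁻¹ := by
      rw [hy, one_div, Real.inv_rpow hq0.le, inv_pow, ← Real.rpow_natCast, ← Real.rpow_mul hq0.le]
      congr 2
      push_cast; ring
    rw [e, Real.rpow_add hq0, Real.rpow_one, div_inv_eq_mul]
  rw [hy2]
  calc 30 ^ d * (q : ℝ) / (voidProb d * ((r : ℝ) / 2) ^ 2)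
      ≤ 30 ^ d * (q : ℝ) / (voidProb d * (y / 2) ^ 2) := by gcongr
    _ = _ := by field_simp; ring

/-- Testing with the state of one site settles the range of `q` away from zero. -/
lemma gap_le_one (q : I) (hq0 : 0 < (q : ℝ)) (hq1 : (q : ℝ) < 1) :
    gap (faClass d 1) q ≤ 1 := by
  have hqq : 0 < (q : ℝ) * (1 - q) := mul_pos hq0 (by linarith)
  have lf : IsLocal (emp (0 : Site d)) := isLocal_emp _
  have hvar : (q : ℝ) * (1 - q) ≤
      expect q ((emp (0 : Site d) - fun _ => expect q (emp (0 : Site d))) ^ 2) := by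
    rw [expect_emp, ← expect_avg q 0 ((lf.sub (isLocal_const _)).pow 2)]
    have : avg q 0 ((emp (0 : Site d) - fun _ => (q : ℝ)) ^ 2) = fun _ => (q : ℝ) * (1 - q) := by
      funext η
      simp only [avg_apply, Pi.pow_apply, Pi.sub_apply, emp_update_zero, emp_update_one]
      ring
    rw [this, expect_const]
  have hD : ∑ x ∈ {(0 : Site d)}, energy q (emp (0 : Site d)) x ≤ q * (1 - q) := by
    rw [Finset.sum_singleton, energy_eq q 0 lf]
    have h1 : expect q (con 0 * grad 0 (emp (0 : Site d)) ^ 2) ≤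
        expect q (fun _ : Config d => (1 : ℝ)) := by
      refine expect_mono q ((isLocal_con 0).mul ((lf.grad 0).pow 2)) (isLocal_const 1) fun η => ?_
      simp only [Pi.mul_apply, Pi.pow_apply, grad, emp_update_zero, emp_update_one]
      linarith [con_le_one (0 : Site d) η]
    rw [expect_const] at h1
    exact mul_le_of_le_one_right hqq.le h1
  have h := gap_le q lf (S := {0}) (fun x hx => free_emp fun h => hx (by simp [h])) hqq hvar hD
  rwa [div_self hqq.ne', ENNReal.ofReal_one] at h

lemma gap_upper (hd : 1 ≤ d) (q : I) (hq0 : 0 < (q : ℝ)) (hq1 : (q : ℝ) < 1) :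
    gap (faClass d 1) q ≤
      ENNReal.ofReal ((8 + 4 * 30 ^ d / voidProb d) * (q : ℝ) ^ (1 + 2 / (d : ℝ))) := by
  have hp0 : 0 < voidProb d := Real.exp_pos _
  have hr0 : 0 < (q : ℝ) ^ (1 + 2 / (d : ℝ)) := Real.rpow_pos_of_pos hq0 _
  rcases le_total (q : ℝ) (1 / 2) with hq | hq
  · refine (gap_le_of_le_half hd q hq0 hq).trans (ENNReal.ofReal_le_ofReal ?_)
    gcongr
    linarith
  -- For `q ≥ 1/2` one has `q^(1+2/d) ≥ q³ ≥ 1/8`, which accounts for the 8 in the constant.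
  · refine (gap_le_one q hq0 hq1).trans ?_
    rw [← ENNReal.ofReal_one]
    apply ENNReal.ofReal_le_ofReal
    have h1 : (q : ℝ) ^ (3 : ℝ) ≤ (q : ℝ) ^ (1 + 2 / (d : ℝ)) := by
      apply Real.rpow_le_rpow_of_exponent_ge hq0 hq1.le
      have : 2 / (d : ℝ) ≤ 2 := div_le_self (by norm_num) (by exact_mod_cast hd)
      linarith
    have h2 : (1 / 8 : ℝ) ≤ (q : ℝ) ^ (3 : ℝ) := by
      have : (q : ℝ) ^ (3 : ℝ) = (q : ℝ) ^ 3 := by exact_mod_cast Real.rpow_natCast (q : ℝ) 3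
      rw [this]
      calc (1 / 8 : ℝ) = (1 / 2) ^ 3 := by norm_num
        _ ≤ _ := pow_le_pow_left₀ (by norm_num) hq 3
    have h3 : 0 ≤ 4 * 30 ^ d / voidProb d := by positivity
    nlinarith

lemma gap_lower (hd : 1 ≤ d) (q : I) (hq0 : 0 < (q : ℝ)) (hq1 : (q : ℝ) < 1) {s : ℝ}
    (hs0 : 0 < s)
    (hs : ∀ M : ℕ, (M : ℝ) ≤ 6 * 2 ^ d / q →
      1 + ∑ j ∈ Finset.range (d * M), 2 / rayWeight d j ≤ s) :
    ENNReal.ofReal ((q : ℝ) ^ 2 / (poincareConst d * s)) ≤ gap (faClass d 1) q := by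
  have hP := poincareConst_pos d
  refine le_gap q hq0 hq1 (by positivity) fun f hf => ?_
  obtain ⟨V, hV⟩ := poincare_local q hq0 hq1 hd hs0.le hs hf
  refine ⟨V, ?_⟩
  calc (q : ℝ) ^ 2 / (poincareConst d * s) * expect q ((f - fun _ => expect q f) ^ 2)
      ≤ (q : ℝ) ^ 2 / (poincareConst d * s) *
        (poincareConst d * s / q ^ 2 * ∑ u ∈ V, energy q f u) := by gcongr
    _ = _ := by field_simp

end KCSM

end

/-! ### Assembly of the three dimensional regimes -/

theorem mainTheorem6 (d : ℕ) (hd : 1 ≤ d) :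
    ∃ C : ℝ, 0 < C ∧ ∀ q : unitInterval, 0 < q → q < 1 →
      (d = 1 →
        ENNReal.ofReal (C⁻¹ * (q : ℝ) ^ 3) ≤ KCSM.gap (KCSM.faClass d 1) q ∧
        KCSM.gap (KCSM.faClass d 1) q ≤ ENNReal.ofReal (C * (q : ℝ) ^ 3)) ∧
      (d = 2 →
        ENNReal.ofReal (C⁻¹ * ((q : ℝ) ^ 2 / max 1 (Real.log (1 / (q : ℝ))))) ≤
          KCSM.gap (KCSM.faClass d 1) q ∧
        KCSM.gap (KCSM.faClass d 1) q ≤ ENNReal.ofReal (C * (q : ℝ) ^ 2)) ∧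
      (3 ≤ d →
        ENNReal.ofReal (C⁻¹ * (q : ℝ) ^ 2) ≤ KCSM.gap (KCSM.faClass d 1) q ∧
        KCSM.gap (KCSM.faClass d 1) q ≤
          ENNReal.ofReal (C * (q : ℝ) ^ (1 + 2 / (d : ℝ)))) := by
  have hP := KCSM.poincareConst_pos d
  have hp0 : 0 < KCSM.voidProb d := Real.exp_pos _
  -- `126 + 4 * d` dominates the resistance constants 25, 101 and `1 + 4 * d` of the three regimes.
  set C₁ : ℝ := KCSM.poincareConst d * (126 + 4 * d) with hC₁
  set C₂ : ℝ := 8 + 4 * 30 ^ d / KCSM.voidProb d with hC₂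
  have hC₁0 : 0 < C₁ := by positivity
  have hC₂0 : 0 < C₂ := by positivity
  refine ⟨C₁ + C₂, by positivity, fun q hq0 hq1 => ?_⟩
  have h0 : (0 : ℝ) < q := hq0
  have h1 : (q : ℝ) < 1 := hq1
  have hup := KCSM.gap_upper hd q h0 h1
  have hup' : ∀ t : ℝ, 0 ≤ t → (q : ℝ) ^ (1 + 2 / (d : ℝ)) = t →
      KCSM.gap (KCSM.faClass d 1) q ≤ ENNReal.ofReal ((C₁ + C₂) * t) := by
    intro t ht e
    rw [e] at hup
    refine hup.trans (ENNReal.ofReal_le_ofReal ?_)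
    exact mul_le_mul_of_nonneg_right (by linarith) ht
  have hlow : ∀ s t : ℝ, 0 < s → 0 ≤ t →
      (∀ M : ℕ, (M : ℝ) ≤ 6 * 2 ^ d / q →
        1 + ∑ j ∈ Finset.range (d * M), 2 / KCSM.rayWeight d j ≤ s) →
      t * s ≤ (126 + 4 * d) * (q : ℝ) ^ 2 →
      ENNReal.ofReal ((C₁ + C₂)⁻¹ * t) ≤ KCSM.gap (KCSM.faClass d 1) q := by
    intro s t hs0 ht hs hts
    refine le_trans (ENNReal.ofReal_le_ofReal ?_) (KCSM.gap_lower hd q h0 h1 hs0 hs)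
    calc (C₁ + C₂)⁻¹ * t ≤ C₁⁻¹ * t := by gcongr; linarith
      _ ≤ _ := by
        rw [inv_mul_le_iff₀ hC₁0, mul_div_assoc', le_div_iff₀ (by positivity), hC₁]
        calc t * (KCSM.poincareConst d * s) = KCSM.poincareConst d * (t * s) := by ring
          _ ≤ KCSM.poincareConst d * ((126 + 4 * d) * (q : ℝ) ^ 2) := by gcongr
          _ = _ := by ring
  refine ⟨?_, ?_, ?_⟩
  · rintro rfl
    refine ⟨?_, hup' _ (by positivity) ?_⟩
    · refine hlow (25 / q) _ (by positivity) (by positivity)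
        (fun M hM => KCSM.resistance_one h0 h1 M hM) ?_
      have : (q : ℝ) ^ 3 * (25 / q) = 25 * (q : ℝ) ^ 2 := by field_simp
      rw [this]
      gcongr
      norm_num
    · rw [show (1 + 2 / ((1 : ℕ) : ℝ)) = ((3 : ℕ) : ℝ) by norm_num, Real.rpow_natCast]
  · rintro rfl
    have hm : 0 < max 1 (Real.log (1 / (q : ℝ))) := lt_max_of_lt_left one_pos
    refine ⟨?_, hup' _ (by positivity) ?_⟩
    · refine hlow (101 * max 1 (Real.log (1 / (q : ℝ)))) _ (by positivity) (by positivity)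
        (fun M hM => KCSM.resistance_two h0 M hM) ?_
      have : (q : ℝ) ^ 2 / max 1 (Real.log (1 / (q : ℝ))) * (101 * max 1 (Real.log (1 / (q : ℝ)))) =
          101 * (q : ℝ) ^ 2 := by field_simp
      rw [this]
      gcongr
      norm_num
    · rw [show (1 + 2 / ((2 : ℕ) : ℝ)) = ((2 : ℕ) : ℝ) by norm_num, Real.rpow_natCast]
  · intro hd3
    refine ⟨?_, hup' _ (by positivity) rfl⟩
    refine hlow (1 + 4 * d) _ (by positivity) (by positivity)
      (fun M _ => KCSM.resistance_three hd3 M) ?_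
    rw [mul_comm]
    gcongr
    norm_num
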